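/- Let $G$ be a finite simple graph and $p\ge 0$ an integer. For $X\subseteq V(G)$ and $v\in V(G)$, a $(2,X)$-path packing rooted at $v$ is a family of paths of length at most $2$, each starting in $v$, ending in a vertex of $X$ and having no interior vertex in $X$, that pairwise share no vertex except $v$; $\mathrm{pp}^2_X(v)$ is the maximum size of such a family. For a linear ordering $<$ of $V(G)$ let $\mathrm{adm}_2(G,<)=\max_{v}\mathrm{pp}^2_{\{w\,:\,w<v\}}(v)$, and let the $2$-admissibility $\mathrm{adm}_2(G)$ be the minimum of $\mathrm{adm}_2(G,<)$ over all orderings. The algorithm **Main**, on input $(G,p)$ with $G$ given by its vertex set and adjacency sets, works as follows. If $|E(G)|>p|V(G)|$ it returns FALSE. Otherwise it keeps a set $L$ (initially $V(G)$), $R=V(G)\setminus L$, the sets $N_L(u)=N(u)\cap L$ and $N_R(u)=N(u)\cap R$, a matching $M_u$ (initially empty) between $N_R(u)$ and $L\setminus(N(u)\cup\{u\})$ for every $u$, with sets of matched vertices $R^M_u$ and $L^M_u$, and a set $\mathsf{Cand}$, initially the set of all vertices of degree at most $p$. While $L\neq\emptyset$: if $\mathsf{Cand}=\emptyset$ it returns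 FALSE; otherwise it removes an arbitrary $v\in\mathsf{Cand}$ from $\mathsf{Cand}$ and from $L$, puts $v$ in front of the output ordering, and runs **Update**$(v)$. When $L=\emptyset$ it returns the ordering. **Update**$(v)$: start with $\mathsf{Check}=\emptyset$. (1) For every $u\in N(v)$ move $v$ from $N_L(u)$ to $N_R(u)$. (2) For every $u\in N_L(v)$: if there is $w\in N_L(v)\setminus(L^M_u\cup N_L(u)\cup\{u\})$, add $vw$ to $M_u$ for one such $w$; put $u$ into $\mathsf{Check}$. (3) For every $u\in\bigcup_{x\in R^M_v}N_L(x)\setminus\{v\}$ with $v\in L^M_u$: remove the edge $vz\in M_u$ incident to $v$; if there is $y\in N_L(z)\setminus(N_L(u)\cup L^M_u\cup\{u\})$ (with $L^M_u$ taken after the removal), add $yz$ to $M_u$ for one such $y$; put $u$ into $\mathsf{Check}$. (4) For every $u\in\mathsf{Check}$ with $|M_u|+|N_L(u)|=p$ and $u\notin\mathsf{Cand}$: run **Augmenting**$(u)$, and put $u$ into $\mathsf{Cand}$ if it returns FALSE. Finally set $M_v=\emptyset$. **Augmenting**$(v)$: build a digraph on the vertices of $M_v$ with an arc $uw$ for every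 $u\in R^M_v$, $w\in L^M_v$ with $uw\in M_v$, and an arc $wu$ for every $u\in R^M_v$, $w\in L^M_v$ with $uw\in E(G)\setminus M_v$. Let $T$ be the set of all $w\in L^M_v$ with a neighbour in $N_R(v)\setminus R^M_v$, and $\mathrm{out}(w)$ such a neighbour; let $S$ be the set of all $u\in R^M_v$ with a neighbour in $L\setminus(L^M_v\cup N_L(v)\cup\{v\})$, and $\mathrm{out}(u)$ such a neighbour. If a graph search finds a directed path $P$ from some $s\in S$ to some $t\in T$, replace $M_v$ by $(M_v\setminus E(P))\cup(E(P)\setminus M_v)\cup\{s\,\mathrm{out}(s),t\,\mathrm{out}(t)\}$ and return TRUE; otherwise return FALSE. All sets and maps are stored in hash tables. The model charges constant time for every access to, insertion into or deletion from a hash table, for asking for its size or for one of its entries, and for elementary operations on registers; clearing or traversing a table takes time linear in the number of its entries. Space is the largest number of words in use at any time, including input and output. **Theorem.** For all choices left open above (the traversal orders of the hash tables, and hence which candidates, vertices and paths are selected), the following holds. 1. If $\mathrm{adm}_2(G)>p$, then Main returns FALSE. Otherwise it returns an ordering $<$ of $V(G)$ with $\mathrm{adm}_2(G,<)\le p$.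 2. If $p\ge1$ and $V(G)\ne\emptyset$, then Main runs in time $O(p^4|V(G)|)$. 3. If $p\ge1$ and $V(G)\neq\emptyset$, then Main uses space $O(|V(G)|+|E(G)|+p^2)$; hence, if $G$ has no isolated vertices, space $O(|E(G)|+p^2)$. The constants in the $O$-terms are absolute. -/

import Mathlib

/-! # Path packings and admissibility -/

namespace TwoAdm

universe u

set_option linter.constructorNameAsVariable false

/-- `P` is an `(r, X)`-path packing rooted at `v`: its members are paths of `G` that start in `v`,
have length at most `r`, end in a vertex of `X`, have no interior vertex in `X`, and pairwise share
no vertex except `v`. -/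
structure IsPathPacking {V : Type u} (G : SimpleGraph V) (r : ℕ) (X : Set V) (v : V)
    (P : Finset (Σ w : V, G.Path v w)) : Prop where
  length_le : ∀ q ∈ P, (q.2 : G.Walk v q.1).length ≤ r
  end_mem : ∀ q ∈ P, q.1 ∈ X
  disjoint : ∀ q ∈ P, ∀ q' ∈ P, q ≠ q' →
    ∀ x ∈ (q.2 : G.Walk v q.1).support, x ∈ (q'.2 : G.Walk v q'.1).support → x = v
  avoids : ∀ q ∈ P, ∀ x ∈ (q.2 : G.Walk v q.1).support, x ≠ v → x ≠ q.1 → x ∉ X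

/-- The maximum size of an `(r, X)`-path packing rooted at `v`. -/
noncomputable def pathPacking {V : Type u} (G : SimpleGraph V) (r : ℕ) (X : Set V) (v : V) : ℕ∞ :=
  ⨆ (P : Finset (Σ w : V, G.Path v w)) (_ : IsPathPacking G r X v P), (P.card : ℕ∞)

/-- The `r`-admissibility of the ordered graph `(G, o)`; the set `{w | w < v}` is the set of all
vertices to the left of `v`. -/
noncomputable def orderAdm {V : Type u} (G : SimpleGraph V) (r : ℕ) (o : LinearOrder V) : ℕ∞ :=
  ⨆ v : V, pathPacking G r {w | o.lt w v} v

/-- The `r`-admissibility of `G`: the minimum over all orderings of the vertex set. -/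
noncomputable def graphAdm {V : Type u} (G : SimpleGraph V) (r : ℕ) : ℕ∞ :=
  ⨅ o : LinearOrder V, orderAdm G r o

/-! # The machine model

Programs work on finitely many registers (each holding a vertex or nothing), counters (each holding
a natural number), flags, and hash tables that map vertices to vertices.  A hash table used as a
set stores every element under itself.  Besides single tables there are families of tables with
one table for every vertex.

Every operation on a single table entry (look up, test, insert, delete), asking for the size of a
table, picking an entry of a table, and every operation on registers, counters and flags takes one
unit of time.  Clearing a table with `k` entries takes `k + 1` units.  A loop over the keys of a
table with `k` entries first makes a private copy of these keys, which takes `k + 1` units of time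
and occupies `k` words until the loop ends; then each iteration takes one unit, plus the time for
testing the loop guard, plus the time for the loop body. -/

/-- Vertex registers. -/
inductive Reg | iter | v | u | w | x | y | z | a | b | c | s | t | cur | prev
  deriving DecidableEq

instance : Fintype Reg where
  elems := {.iter, .v, .u, .w, .x, .y, .z, .a, .b, .c, .s, .t, .cur, .prev}
  complete := by intro i; cases i <;> decide

/-- Counters. -/
inductive Ctr | p | degSum | budget
  deriving DecidableEq

instance : Fintype Ctr where
  elems := {.p, .degSum, .budget}
  complete := by intro i; cases i <;> decide

/-- Flags. -/
inductive Flag | failed | done | found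
  deriving DecidableEq

instance : Fintype Flag where
  elems := {.failed, .done, .found}
  complete := by intro i; cases i <;> decide

/-- Single tables: the vertex set `verts` (input), the sets `L`, `Cand`, `Check`, a set `union`,
and the auxiliary tables of the augmentation procedure. -/
inductive Tab
  | verts | L | cand | check | union
  | auxVerts | S | T | out | frontier | visited | parent | ePlus | eMinus
  deriving DecidableEq

instance : Fintype Tab where
  elems := {.verts, .L, .cand, .check, .union, .auxVerts, .S, .T, .out, .frontier, .visited, .parent, .ePlus, .eMinus}
  complete := by intro i; cases i <;> decide

/-- Families of tables: `adj` (input) holds the neighbourhoods, `NL` and `NR` hold the left and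
right neighbourhoods, `ML` and `MR` hold the matchings, `aux` holds the out-neighbourhoods of the
auxiliary digraph.  The matching of `u` is stored in both directions: for every matching edge with
left end `y` and right end `x`, table `ML` of `u` maps `y` to `x` and table `MR` of `u` maps `x`
to `y`. -/
inductive Fam | adj | NL | NR | ML | MR | aux
  deriving DecidableEq

instance : Fintype Fam where
  elems := {.adj, .NL, .NR, .ML, .MR, .aux}
  complete := by intro i; cases i <;> decide

/-- How a program refers to a table: by its name, or as the member of a family that belongs to the
vertex in a register. -/
inductive Ref
  | tab (d : Tab)
  | fam (f : Fam) (r : Reg)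

/-- Arithmetic expressions. -/
inductive Expr
  | zero
  | ctr (n : Ctr)
  | size (d : Ref)
  | add (e₁ e₂ : Expr)

/-- Boolean expressions. -/
inductive Cond
  | tt
  | flag (f : Flag)
  | isSet (r : Reg)
  | eq (r₁ r₂ : Reg)
  | mem (r : Reg) (d : Ref)
  | isEmpty (d : Ref)
  | numEq (e₁ e₂ : Expr)
  | numLe (e₁ e₂ : Expr)
  | not (c : Cond)
  | and (c₁ c₂ : Cond)

/-- Programs. -/
inductive Stmt
  | skip
  | seq (s₁ s₂ : Stmt)
  | ite (c : Cond) (s₁ s₂ : Stmt)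
  /-- For every key `r` of the table `d`: leave the loop if `c` is false, otherwise run `body`. -/
  | forIn (r : Reg) (d : Ref) (c : Cond) (body : Stmt)
  /-- `r := r'` -/
  | move (r r' : Reg)
  /-- `r := d[k]`; the register becomes empty if there is no such entry. -/
  | lookup (r : Reg) (d : Ref) (k : Reg)
  /-- `r :=` an arbitrary key of `d`; the register becomes empty if `d` is empty. -/
  | pick (r : Reg) (d : Ref)
  /-- `d[k] := x` -/
  | insert (d : Ref) (k x : Reg)
  | delete (d : Ref) (k : Reg)
  | clear (d : Ref)
  | setFlag (f : Flag) (val : Bool)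
  | setCtr (n : Ctr) (e : Expr)
  /-- Put the vertex in `r` in front of the output list. -/
  | emit (r : Reg)

/-- The contents of a hash table. -/
abbrev Table (V : Type u) := V → Option V

/-- A machine state.  `held` is the number of words occupied by the private copies of the running
loops, `time` the time used so far, and `peak` the largest number of words in use so far. -/
structure State (V : Type u) where
  reg : Reg → Option V
  ctr : Ctr → ℕ
  flag : Flag → Bool
  tab : Tab → Table V
  fam : Fam → V → Table V
  output : List V
  held : ℕ
  time : ℕ
  peak : ℕ

/-- The orders in which hash tables are traversed: at time `n` a table with key set `s` is traversed
in the order `order n s`. -/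
structure Traversal (V : Type u) [DecidableEq V] where
  order : ℕ → Finset V → List V
  nodup : ∀ n s, (order n s).Nodup
  toFinset_eq : ∀ n s, (order n s).toFinset = s

section Semantics

variable {V : Type u} [Fintype V] [DecidableEq V]

/-- The set of keys of a table. -/
def keys (d : Table V) : Finset V := Finset.univ.filter fun x => (d x).isSome

namespace State

/-- The number of words in use: one for every register, counter and flag, one plus the number of
entries for every table (including those that hold the input), the output and the loop copies. -/
def words (σ : State V) : ℕ :=
  Fintype.card Reg + Fintype.card Ctr + Fintype.card Flag
    + ∑ d : Tab, (1 + (keys (σ.tab d)).card)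
    + ∑ f : Fam, ∑ x : V, (1 + (keys (σ.fam f x)).card)
    + σ.output.length + σ.held

/-- Let `k` units of time pass and record the memory in use. -/
def charge (k : ℕ) (σ : State V) : State V :=
  { σ with time := σ.time + k, peak := max σ.peak σ.words }

/-- The contents of the table that `d` refers to (empty if the register is empty). -/
def get (σ : State V) : Ref → Table V
  | .tab d => σ.tab d
  | .fam f r =>
    match σ.reg r with
    | none => fun _ => none
    | some x => σ.fam f x

/-- Overwrite the table that `d` refers to (no effect if the register is empty). -/
def put (σ : State V) (d : Ref) (new : Table V) : State V :=
  match d with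
  | .tab d => { σ with tab := Function.update σ.tab d new }
  | .fam f r =>
    match σ.reg r with
    | none => σ
    | some x =>
      { σ with fam := Function.update σ.fam f (Function.update (σ.fam f) x new) }

def setReg (σ : State V) (r : Reg) (x : Option V) : State V :=
  { σ with reg := Function.update σ.reg r x }

end State

def Expr.eval (σ : State V) : Expr → ℕ
  | .zero => 0
  | .ctr n => σ.ctr n
  | .size d => (keys (σ.get d)).card
  | .add e₁ e₂ => e₁.eval σ + e₂.eval σ

def Cond.eval (σ : State V) : Cond → Bool
  | .tt => true
  | .flag f => σ.flag f
  | .isSet r => (σ.reg r).isSome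
  | .eq r₁ r₂ => decide (σ.reg r₁ = σ.reg r₂)
  | .mem r d =>
    match σ.reg r with
    | none => false
    | some x => (σ.get d x).isSome
  | .isEmpty d => decide ((keys (σ.get d)).card = 0)
  | .numEq e₁ e₂ => decide (e₁.eval σ = e₂.eval σ)
  | .numLe e₁ e₂ => decide (e₁.eval σ ≤ e₂.eval σ)
  | .not c => !(c.eval σ)
  | .and c₁ c₂ => c₁.eval σ && c₂.eval σ

/-- The time for evaluating an arithmetic expression. -/
def Expr.cost : Expr → ℕ
  | .zero => 1
  | .ctr _ => 1
  | .size _ => 1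
  | .add e₁ e₂ => e₁.cost + e₂.cost + 1

/-- The time for evaluating a Boolean expression. -/
def Cond.cost : Cond → ℕ
  | .tt => 1
  | .flag _ => 1
  | .isSet _ => 1
  | .eq _ _ => 1
  | .mem _ _ => 1
  | .isEmpty _ => 1
  | .numEq e₁ e₂ => e₁.cost + e₂.cost + 1
  | .numLe e₁ e₂ => e₁.cost + e₂.cost + 1
  | .not c => c.cost + 1
  | .and c₁ c₂ => c₁.cost + c₂.cost + 1

/-- The iterations of a loop over a list of keys with guard `c`. -/
def iterate (r : Reg) (c : Cond) (body : State V → State V) : List V → State V → State V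
  | [], σ => σ
  | x :: l, σ =>
    let σ₁ := ((σ.setReg r (some x)).charge (1 + c.cost))
    if c.eval σ₁ then iterate r c body l (body σ₁) else σ₁

/-- The effect of a program on a machine state. -/
def Stmt.run (τ : Traversal V) : Stmt → State V → State V
  | .skip, σ => σ
  | .seq s₁ s₂, σ => s₂.run τ (s₁.run τ σ)
  | .ite c s₁ s₂, σ =>
    if c.eval σ then s₁.run τ (σ.charge c.cost) else s₂.run τ (σ.charge c.cost)
  | .forIn r d c body, σ =>
    let l := τ.order σ.time (keys (σ.get d))
    let σ₁ := ({ σ with held := σ.held + l.length } : State V).charge (l.length + 1)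
    let σ₂ := iterate r c (body.run τ) l σ₁
    { σ₂ with held := σ.held }
  | .move r r', σ => (σ.setReg r (σ.reg r')).charge 1
  | .lookup r d k, σ => (σ.setReg r ((σ.reg k).bind (σ.get d))).charge 1
  | .pick r d, σ => (σ.setReg r (τ.order σ.time (keys (σ.get d))).head?).charge 1
  | .insert d k x, σ =>
    match σ.reg k, σ.reg x with
    | some k, some x => (σ.put d (Function.update (σ.get d) k (some x))).charge 1
    | _, _ => σ.charge 1
  | .delete d k, σ =>
    match σ.reg k with
    | some k => (σ.put d (Function.update (σ.get d) k none)).charge 1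
    | none => σ.charge 1
  | .clear d, σ => (σ.put d fun _ => none).charge ((keys (σ.get d)).card + 1)
  | .setFlag f val, σ => ({ σ with flag := Function.update σ.flag f val } : State V).charge 1
  | .setCtr n e, σ =>
    ({ σ with ctr := Function.update σ.ctr n (e.eval σ) } : State V).charge (e.cost + 1)
  | .emit r, σ =>
    match σ.reg r with
    | some x => ({ σ with output := x :: σ.output } : State V).charge 1
    | none => σ.charge 1

end Semantics

/-! # The algorithm -/

/-- Sequential composition of a list of programs. -/
def block : List Stmt → Stmt
  | [] => .skip
  | s :: l => .seq s (block l)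

/-- `if c then ...` without an else branch. -/
def when (c : Cond) (l : List Stmt) : Stmt := .ite c (block l) .skip

/-- A loop over all keys of a table. -/
def forAll (r : Reg) (d : Ref) (l : List Stmt) : Stmt := .forIn r d .tt (block l)

/-- A loop over the keys of a table that is left as soon as `c` fails. -/
def forWhile (r : Reg) (d : Ref) (c : Cond) (l : List Stmt) : Stmt := .forIn r d c (block l)

/-- Insert a vertex into a table that is used as a set. -/
def insertSet (d : Ref) (k : Reg) : Stmt := .insert d k k

/-- Add the edge with left end `y` and right end `x` to the matching of `o`. -/
def addEdge (o y x : Reg) : Stmt := .seq (.insert (.fam .ML o) y x) (.insert (.fam .MR o) x y)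

/-- Remove the edge with left end `y` and right end `x` from the matching of `o`. -/
def removeEdge (o y x : Reg) : Stmt := .seq (.delete (.fam .ML o) y) (.delete (.fam .MR o) x)

/-- `w ∉ L^M_o ∪ N_L(o) ∪ {o}` -/
def isFree (w o : Reg) : Cond :=
  .and (.not (.mem w (.fam .ML o))) (.and (.not (.mem w (.fam .NL o))) (.not (.eq w o)))

/-- Construction of the auxiliary digraph for the matching of the vertex in register `a`, with the
sets `S`, `T` and the table `out`. -/
def buildAux : Stmt := block [
  forAll .b (.tab .auxVerts) [.clear (.fam .aux .b)],
  .clear (.tab .auxVerts), .clear (.tab .S), .clear (.tab .T), .clear (.tab .out),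
  forAll .b (.fam .MR .a) [insertSet (.tab .auxVerts) .b],
  forAll .c (.fam .ML .a) [insertSet (.tab .auxVerts) .c],
  forAll .b (.fam .NR .a) [
    forAll .c (.fam .ML .a) [
      .lookup .cur (.fam .MR .a) .b,
      .ite (.eq .cur .c)
        (insertSet (.fam .aux .b) .c)
        (when (.mem .c (.fam .adj .b)) [
          .ite (.mem .b (.fam .MR .a))
            (insertSet (.fam .aux .c) .b)
            (block [insertSet (.tab .T) .c, .insert (.tab .out) .c .b])])]],
  forAll .b (.fam .MR .a) [
    forAll .c (.fam .NL .b) [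
      when (isFree .c .a) [insertSet (.tab .S) .b, .insert (.tab .out) .b .c]]]]

/-- Search for a directed path from `S` to `T` in the auxiliary digraph: sets the flag `found`, and
if there is such a path, its last vertex is put into register `t` and the path can be traced back
through `parent`.  Which discovered vertex is explored next is left open (exploring the most
recent one is a depth-first search). -/
def searchPath : Stmt := block [
  .clear (.tab .frontier), .clear (.tab .visited), .clear (.tab .parent),
  .setFlag .found false,
  forAll .s (.tab .S) [insertSet (.tab .visited) .s, insertSet (.tab .frontier) .s],
  forWhile .iter (.tab .auxVerts) (.and (.not (.flag .found)) (.not (.isEmpty (.tab .frontier)))) [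
    .pick .b (.tab .frontier),
    .delete (.tab .frontier) .b,
    .ite (.mem .b (.tab .T))
      (block [.move .t .b, .setFlag .found true])
      (forAll .c (.fam .aux .b) [
        when (.not (.mem .c (.tab .visited))) [
          insertSet (.tab .visited) .c,
          insertSet (.tab .frontier) .c,
          .insert (.tab .parent) .c .b]])]]

/-- Exchange the edges of the matching of `a` along the path that was found.  Tables `ePlus` and
`eMinus` collect the edges to be added and removed; they map right ends to left ends. -/
def applyPath : Stmt := block [
  .clear (.tab .ePlus), .clear (.tab .eMinus),
  .lookup .b (.tab .out) .t,
  .insert (.tab .ePlus) .b .t,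
  .move .cur .t,
  forWhile .iter (.tab .auxVerts) (.mem .cur (.tab .parent)) [
    .lookup .prev (.tab .parent) .cur,
    .lookup .c (.fam .MR .a) .prev,
    .ite (.eq .c .cur)
      (.insert (.tab .eMinus) .prev .cur)
      (.insert (.tab .ePlus) .cur .prev),
    .move .cur .prev],
  .lookup .c (.tab .out) .cur,
  .insert (.tab .ePlus) .cur .c,
  forAll .b (.tab .eMinus) [.lookup .c (.tab .eMinus) .b, removeEdge .a .c .b],
  forAll .b (.tab .ePlus) [.lookup .c (.tab .ePlus) .b, addEdge .a .c .b]]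

/-- The procedure Augmenting for the vertex in register `a`; its answer is the flag `found`. -/
def augmenting : Stmt := block [buildAux, searchPath, when (.flag .found) [applyPath]]

/-- The procedure Update for the vertex in register `v`. -/
def update : Stmt := block [
  .clear (.tab .check),
  -- Loop 1: update neighbours in `N(v)`
  forAll .u (.fam .adj .v) [.delete (.fam .NL .u) .v, insertSet (.fam .NR .u) .v],
  -- Loop 2: ensure maximality of affected matchings
  forAll .u (.fam .NL .v) [
    .setFlag .done false,
    forWhile .w (.fam .NL .v) (.not (.flag .done)) [
      when (isFree .w .u) [addEdge .u .w .v, .setFlag .done true]],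
    insertSet (.tab .check) .u],
  -- Loop 3: update relevant vertices at distance two
  .clear (.tab .union),
  forAll .x (.fam .MR .v) [
    forAll .u (.fam .NL .x) [when (.not (.eq .u .v)) [insertSet (.tab .union) .u]]],
  forAll .u (.tab .union) [
    when (.mem .v (.fam .ML .u)) [
      .lookup .z (.fam .ML .u) .v,
      removeEdge .u .v .z,
      .setFlag .done false,
      forWhile .y (.fam .NL .z) (.not (.flag .done)) [
        when (isFree .y .u) [addEdge .u .y .z, .setFlag .done true]],
      insertSet (.tab .check) .u]],
  -- Loop 4: check whether affected vertices become candidates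
  forAll .u (.tab .check) [
    when (.and (.numEq (.add (.size (.fam .ML .u)) (.size (.fam .NL .u))) (.ctr .p))
        (.not (.mem .u (.tab .cand)))) [
      .move .a .u,
      augmenting,
      when (.not (.flag .found)) [insertSet (.tab .cand) .u]]],
  .clear (.fam .ML .v), .clear (.fam .MR .v)]

/-- Set the flag `failed` if the graph has more than `p` times as many edges as vertices. -/
def checkEdges : Stmt := block [
  .setCtr .degSum .zero, .setCtr .budget .zero,
  forAll .v (.tab .verts) [
    .setCtr .degSum (.add (.ctr .degSum) (.size (.fam .adj .v))),
    .setCtr .budget (.add (.ctr .budget) (.add (.ctr .p) (.ctr .p)))],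
  when (.not (.numLe (.ctr .degSum) (.ctr .budget))) [.setFlag .failed true]]

/-- Set up `L` and the data structures of the oracle. -/
def setup : Stmt :=
  forAll .v (.tab .verts) [
    insertSet (.tab .L) .v,
    forAll .u (.fam .adj .v) [insertSet (.fam .NL .v) .u],
    when (.numLe (.size (.fam .adj .v)) (.ctr .p)) [insertSet (.tab .cand) .v]]

/-- The algorithm Main.  The flag `failed` stands for the answer FALSE. -/
def main : Stmt := block [
  .setFlag .failed false,
  checkEdges,
  when (.not (.flag .failed)) [
    setup,
    forWhile .iter (.tab .verts) (.and (.not (.isEmpty (.tab .L))) (.not (.flag .failed))) [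
      .pick .v (.tab .cand),
      .ite (.isSet .v)
        (block [.delete (.tab .cand) .v, .delete (.tab .L) .v, .emit .v, update])
        (.setFlag .failed true)]]]

section Input

variable {V : Type u} [Fintype V] [DecidableEq V]

/-- The machine state with input `G` (vertex set and adjacency sets) and `p`, all else empty. -/
def inputState (G : SimpleGraph V) [DecidableRel G.Adj] (p : ℕ) : State V where
  reg _ := none
  ctr n := if n = .p then p else 0
  flag _ := false
  tab d x := if d = .verts then some x else none
  fam f x y := if f = .adj ∧ G.Adj x y then some y else none
  output := []
  held := 0
  time := 0
  peak := 0

/-- The machine state after the run of Main on input `G` and `p`. -/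
def finalState (G : SimpleGraph V) [DecidableRel G.Adj] (p : ℕ) (τ : Traversal V) : State V :=
  main.run τ (inputState G p)

/-- The answer of Main: `none` stands for FALSE, a list for the ordering that lists the vertices
from left to right. -/
def answer (G : SimpleGraph V) [DecidableRel G.Adj] (p : ℕ) (τ : Traversal V) : Option (List V) :=
  if (finalState G p τ).flag .failed then none else some (finalState G p τ).output

/-- The time used by Main. -/
def runTime (G : SimpleGraph V) [DecidableRel G.Adj] (p : ℕ) (τ : Traversal V) : ℕ :=
  (finalState G p τ).time

/-- The space used by Main: the largest number of words in use at any time. -/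
def space (G : SimpleGraph V) [DecidableRel G.Adj] (p : ℕ) (τ : Traversal V) : ℕ :=
  (finalState G p τ).peak

end Input

end TwoAdm

namespace TwoAdm

universe u

set_option linter.constructorNameAsVariable false
set_option linter.unusedSectionVars false
set_option linter.unusedSimpArgs false

/-! ### Frame conditions -/

/-! Fix a set `L` of remaining vertices and `u ∈ L`. The relevant paths from `u` are the edges from
`u` into `L` and the paths of length two through a neighbour outside `L`. A matching between the
neighbours of `u` outside `L` and the vertices of `L` not adjacent to `u`, together with the
neighbours in `L`, gives a packing of size `s(u)`, the number of matching edges plus the number of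
neighbours in `L` (`PreMat.le_pathPacking`). A set that avoids `u` and meets all the paths bounds
every packing from above (`HasCover.pathPacking_le`). König's argument makes both bounds meet: if
the search finds no augmenting path, the visited vertices define a cover of size `s(u)`
(`PreMat.hasCover`, `augmenting_spec`).

Correctness rests on `Inv`: a candidate has a cover of size at most `p`, and every other vertex of
`L` has `s(u) ≥ p + 1`. Covers survive the removal of vertices (`HasCover.erase`). Removing `v`
lowers `s(u)` by at most one, and only for vertices put into `check` (`rematch_spec`); if `s(u)`
becomes `p`, Augmenting either restores `p + 1` or certifies a cover of size `p`. If the candidates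
run out, every vertex of `L` is the root of a packing of size `p + 1`, and in any ordering the last
vertex of `L` shows that the admissibility exceeds `p` (`lt_graphAdm_of_stuck`). If they do not,
every vertex leaves with a small cover, which makes the output ordering good
(`GoodSuffixes.exists_order`). Rejecting graphs with too many edges is sound by
`card_edgeFinset_le`.

The running time is dominated by the calls of Augmenting, each of cost `O(p ^ 2 + p * deg u)`. The
quantity `phi` drops whenever `u` is checked (`phi_erase_lt`) and is at most `2 * p ^ 2 + 2 * p`
when `u` is tested by a call, because its matching is maximal (`PreMat.phi_le`). Hence there are
`O(p ^ 2)` calls per vertex. Summing over all vertices, with at most `p * n` edges, gives `O(p ^ 4 *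
n)`. The remaining work of Update at `v` is `O(p ^ 3 + deg v)`, because the affected vertices at
distance two can be found from the matching of `v` alone (`mem_biUnion_of_matched`).

For space, all permanent tables have linear size and the auxiliary digraph has at most `2 * p`
vertices (`words_le`). Short stretches of the program are bounded by the fact that at most one word
is allocated per unit of time (`grow_run`). Loops that run longer need a memory bound at each
iteration (`forIn_peak`). -/

/-- Parts of a machine state. `famOff f r` stands for register `r` together with all members of the
family `f` except the one that belongs to the vertex in `r`. -/
inductive Loc
  | reg (r : Reg) | ctr (n : Ctr) | flag (f : Flag) | tab (d : Tab) | fam (f : Fam)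
  | famOff (f : Fam) (r : Reg) | output

/-- Does changing register `r` change the given part of the state? -/
def Reg.touches (r : Reg) : Loc → Bool
  | .reg r' => decide (r = r')
  | .famOff _ r' => decide (r = r')
  | _ => false

/-- Does changing the table that `d` refers to change the given part of the state? -/
def Ref.touches : Ref → Loc → Bool
  | .tab d, .tab d' => decide (d = d')
  | .fam f _, .fam f' => decide (f = f')
  | .fam f r, .famOff f' r' => decide (f = f') && !decide (r = r')
  | _, _ => false

/-- Does the program possibly change the given part of the state? -/
def Stmt.writes : Stmt → Loc → Bool
  | .skip, _ => false
  | .seq s₁ s₂, l => s₁.writes l || s₂.writes l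
  | .ite _ s₁ s₂, l => s₁.writes l || s₂.writes l
  | .forIn r _ _ body, l => r.touches l || body.writes l
  | .move r _, l => r.touches l
  | .lookup r _ _, l => r.touches l
  | .pick r _, l => r.touches l
  | .insert d _ _, l => d.touches l
  | .delete d _, l => d.touches l
  | .clear d, l => d.touches l
  | .setFlag f _, .flag f' => decide (f = f')
  | .setCtr n _, .ctr n' => decide (n = n')
  | .emit _, .output => true
  | _, _ => false

section
variable {V : Type u}

/-- The given part is the same in both states. -/
def Loc.Same : Loc → State V → State V → Prop
  | .reg r, σ, σ' => σ'.reg r = σ.reg r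
  | .ctr n, σ, σ' => σ'.ctr n = σ.ctr n
  | .flag f, σ, σ' => σ'.flag f = σ.flag f
  | .tab d, σ, σ' => σ'.tab d = σ.tab d
  | .fam f, σ, σ' => σ'.fam f = σ.fam f
  | .famOff f r, σ, σ' => σ'.reg r = σ.reg r ∧ ∀ x, σ.reg r ≠ some x → σ'.fam f x = σ.fam f x
  | .output, σ, σ' => σ'.output = σ.output

theorem Loc.Same.refl (l : Loc) (σ : State V) : l.Same σ σ := by
  cases l <;> simp [Loc.Same]

theorem Loc.Same.trans {l : Loc} {σ σ' σ'' : State V} (h : l.Same σ σ') (h' : l.Same σ' σ'') :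
    l.Same σ σ'' := by
  cases l with
  | famOff f r =>
    exact ⟨h'.1.trans h.1, fun x hx => (h'.2 x (by rw [h.1]; exact hx)).trans (h.2 x hx)⟩
  | _ => exact Eq.trans h' h

theorem Loc.Same.of_core {l : Loc} {σ σ' : State V} (h₁ : σ'.reg = σ.reg) (h₂ : σ'.ctr = σ.ctr)
    (h₃ : σ'.flag = σ.flag) (h₄ : σ'.tab = σ.tab) (h₅ : σ'.fam = σ.fam)
    (h₆ : σ'.output = σ.output) : l.Same σ σ' := by
  cases l <;> simp [Loc.Same, *]

/-- Everything that the program does not write is the same in both states. -/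
def Frame (s : Stmt) (σ σ' : State V) : Prop := ∀ l : Loc, s.writes l = false → l.Same σ σ'

namespace Frame

variable {s : Stmt} {σ σ' σ'' : State V}

theorem refl (s : Stmt) (σ : State V) : Frame s σ σ := fun l _ => .refl l σ

theorem trans (h : Frame s σ σ') (h' : Frame s σ' σ'') : Frame s σ σ'' :=
  fun l hl => (h l hl).trans (h' l hl)

theorem mono {t : Stmt} (h : Frame s σ σ') (hst : ∀ l, t.writes l = false → s.writes l = false) :
    Frame t σ σ' := fun l hl => h l (hst l hl)

/-- `Stmt.writes` is computable, so for a concrete program the side condition is discharged by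
`rfl`. This is how all facts about untouched parts of the state are obtained later. -/
theorem reg (h : Frame s σ σ') (r : Reg) (hr : s.writes (.reg r) = false := by rfl) :
    σ'.reg r = σ.reg r := h _ hr

theorem ctr (h : Frame s σ σ') (n : Ctr) (hn : s.writes (.ctr n) = false := by rfl) :
    σ'.ctr n = σ.ctr n := h _ hn

theorem flag (h : Frame s σ σ') (f : Flag) (hf : s.writes (.flag f) = false := by rfl) :
    σ'.flag f = σ.flag f := h _ hf

theorem tab (h : Frame s σ σ') (d : Tab) (hd : s.writes (.tab d) = false := by rfl) :
    σ'.tab d = σ.tab d := h _ hd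

theorem fam (h : Frame s σ σ') (f : Fam) (hf : s.writes (.fam f) = false := by rfl) :
    σ'.fam f = σ.fam f := h _ hf

theorem famOff (h : Frame s σ σ') (f : Fam) (r : Reg) {x : V} (hx : σ.reg r ≠ some x)
    (hf : s.writes (.famOff f r) = false := by rfl) : σ'.fam f x = σ.fam f x := (h _ hf).2 x hx

theorem output (h : Frame s σ σ') (hf : s.writes .output = false := by rfl) :
    σ'.output = σ.output := h _ hf

end Frame

end

/-! ### Tables, induction over loops, and soundness of the frame analysis -/

section
variable {V : Type u} [Fintype V] [DecidableEq V]

theorem mem_keys {d : Table V} {x : V} : x ∈ keys d ↔ (d x).isSome := by simp [keys]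

theorem mem_keys_iff {d : Table V} {x : V} : x ∈ keys d ↔ ∃ y, d x = some y := by
  simp [keys, Option.isSome_iff_exists]

theorem not_mem_keys {d : Table V} {x : V} : x ∉ keys d ↔ d x = none := by
  simp [keys]

@[simp] theorem keys_empty : keys (fun _ => none : Table V) = ∅ := by simp [keys]

@[simp] theorem keys_update_some (d : Table V) (k x : V) :
    keys (Function.update d k (some x)) = insert k (keys d) := by
  ext y; by_cases h : y = k <;> simp [keys, Function.update_apply, h]

@[simp] theorem keys_update_none (d : Table V) (k : V) :
    keys (Function.update d k none) = (keys d).erase k := by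
  ext y; by_cases h : y = k <;> simp [keys, Function.update_apply, h]

theorem Reg.same_setReg {r : Reg} {l : Loc} (h : r.touches l = false) (σ : State V)
    (x : Option V) : l.Same σ (σ.setReg r x) := by
  cases l <;> simp_all [Reg.touches, Loc.Same, State.setReg, Function.update_apply, eq_comm]

theorem State.put_fam_none {σ : State V} {r : Reg} (h : σ.reg r = none) (f : Fam) (t : Table V) :
    σ.put (.fam f r) t = σ := by
  simp [State.put, h]

theorem State.put_fam_some {σ : State V} {r : Reg} {x : V} (h : σ.reg r = some x) (f : Fam)
    (t : Table V) : σ.put (.fam f r) t =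
      { σ with fam := Function.update σ.fam f (Function.update (σ.fam f) x t) } := by
  simp [State.put, h]

theorem Ref.same_put {d : Ref} {l : Loc} (h : d.touches l = false) (σ : State V)
    (t : Table V) : l.Same σ (σ.put d t) := by
  cases d with
  | tab d =>
    cases l <;> simp_all [Ref.touches, Loc.Same, State.put, Function.update_apply, eq_comm]
  | fam f r =>
    cases hr : σ.reg r with
    | none => rw [State.put_fam_none hr]; exact .refl l σ
    | some y =>
      rw [State.put_fam_some hr]
      cases l with
      | fam f' => simp_all [Ref.touches, Loc.Same, Function.update_apply, eq_comm]
      | famOff f' r' =>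
        refine ⟨rfl, fun x hx => ?_⟩
        -- If the families coincide, not touching `famOff` forces the registers to coincide, and
        -- then the overwritten member is exactly the exempted one.
        by_cases hf : f = f'
        · subst hf
          have : r = r' := by simpa [Ref.touches] using h
          subst this
          have hxy : x ≠ y := fun e => hx (by rw [hr, e])
          simp [Function.update_apply, hxy]
        · have : f' ≠ f := fun e => hf e.symm
          simp [Function.update_apply, this]
      | _ => exact rfl

theorem Loc.Same.charge {l : Loc} {σ σ' : State V} (h : l.Same σ σ') (k : ℕ) :
    l.Same σ (σ'.charge k) := h.trans (.of_core rfl rfl rfl rfl rfl rfl)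

/-- An induction principle for loops: `I D` holds when the vertices in `D` have been processed, and
`Q` holds when the loop is left early. -/
theorem iterate_induct {r : Reg} {c : Cond} {f : State V → State V} {K : Finset V}
    {I : Finset V → State V → Prop} {Q : State V → Prop}
    (hstep : ∀ D x σ, I D σ → x ∈ K → x ∉ D →
      if c.eval ((σ.setReg r (some x)).charge (1 + c.cost))
      then I (insert x D) (f ((σ.setReg r (some x)).charge (1 + c.cost)))
      else Q ((σ.setReg r (some x)).charge (1 + c.cost))) :
    ∀ (l : List V) (D : Finset V) (σ : State V), l.Nodup → (∀ x ∈ l, x ∈ K ∧ x ∉ D) → I D σ →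
      I (D ∪ l.toFinset) (iterate r c f l σ) ∨ Q (iterate r c f l σ) := by
  intro l
  induction l with
  | nil => intro D σ _ _ h; left; simpa [iterate] using h
  | cons x l ih =>
    intro D σ hl hK h
    have hx := hK x (by simp)
    have h' := hstep D x σ h hx.1 hx.2
    rw [iterate]
    by_cases hc : c.eval ((σ.setReg r (some x)).charge (1 + c.cost)) = true
    · simp only [hc, if_true] at h' ⊢
      have := ih (insert x D) _ (List.nodup_cons.1 hl).2 (fun y hy => ⟨(hK y (by simp [hy])).1, by
        have := (hK y (by simp [hy])).2
        have hne : y ≠ x := fun e => (List.nodup_cons.1 hl).1 (e ▸ hy)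
        simp [this, hne]⟩) h'
      have e : insert x D ∪ l.toFinset = D ∪ (x :: l).toFinset := by
        ext y; simp
      rwa [e] at this
    · simp only [hc] at h' ⊢
      exact Or.inr (by simpa using h')

theorem Traversal.length_order (τ : Traversal V) (n : ℕ) (s : Finset V) :
    (τ.order n s).length = s.card := by
  rw [← List.toFinset_card_of_nodup (τ.nodup n s), τ.toFinset_eq]

/-- The state in which the first iteration of a loop starts. -/
def State.enter (σ : State V) (d : Ref) : State V :=
  ({ σ with held := σ.held + (keys (σ.get d)).card } : State V).charge ((keys (σ.get d)).card + 1)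

/-- The state in which the loop guard is tested. -/
def State.advance (σ : State V) (r : Reg) (x : V) (c : Cond) : State V :=
  (σ.setReg r (some x)).charge (1 + c.cost)

/-- A traversal order lists every key exactly once, so `iterate_induct` applies with the processed
set starting from `∅`. The conclusion speaks of the state just before the copy of the keys is
released. -/
theorem forIn_induct {τ : Traversal V} {r : Reg} {d : Ref} {c : Cond} {body : Stmt} {σ : State V}
    {I : Finset V → State V → Prop} {Q : State V → Prop}
    (h0 : I ∅ (σ.enter d))
    (hstep : ∀ D x σ', I D σ' → x ∈ keys (σ.get d) → x ∉ D →
      if c.eval (σ'.advance r x c) then I (insert x D) (body.run τ (σ'.advance r x c))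
      else Q (σ'.advance r x c)) :
    ∃ σ', (I (keys (σ.get d)) σ' ∨ Q σ') ∧
      (Stmt.forIn r d c body).run τ σ = { σ' with held := σ.held } := by
  have hl := τ.length_order σ.time (keys (σ.get d))
  refine ⟨iterate r c (body.run τ) (τ.order σ.time (keys (σ.get d))) (σ.enter d), ?_, ?_⟩
  · have := iterate_induct (r := r) (c := c) (f := body.run τ) hstep
      (τ.order σ.time (keys (σ.get d))) ∅ (σ.enter d) (τ.nodup _ _)
      (fun x hx => ⟨by rw [← τ.toFinset_eq σ.time (keys (σ.get d))]; simpa using hx, by simp⟩) h0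
    rwa [Finset.empty_union, τ.toFinset_eq] at this
  · simp only [Stmt.run, hl]; rfl

/-- Soundness of the syntactic analysis, by induction on the program; in a loop the required
equality itself serves as the invariant. -/
theorem frame_run (τ : Traversal V) (s : Stmt) (σ : State V) : Frame s σ (s.run τ σ) := by
  induction s generalizing σ with
  | skip => exact .refl _ _
  | seq s t hs ht =>
    intro l hl
    simp only [Stmt.writes, Bool.or_eq_false_iff] at hl
    exact (hs σ l hl.1).trans (ht _ l hl.2)
  | ite c s t hs ht =>
    intro l hl
    simp only [Stmt.writes, Bool.or_eq_false_iff] at hl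
    have hc : l.Same σ (σ.charge c.cost) := (Loc.Same.refl l σ).charge _
    simp only [Stmt.run]
    split
    · exact hc.trans (hs _ l hl.1)
    · exact hc.trans (ht _ l hl.2)
  | forIn r d c body ih =>
    intro l hl
    simp only [Stmt.writes, Bool.or_eq_false_iff] at hl
    obtain ⟨σ', h, e⟩ := forIn_induct (τ := τ) (r := r) (d := d) (c := c) (body := body) (σ := σ)
      (I := fun _ σ' => l.Same σ σ') (Q := fun σ' => l.Same σ σ')
      (.of_core rfl rfl rfl rfl rfl rfl) (by
        intro D x σ' h _ _
        have h1 : l.Same σ (σ'.advance r x c) := (h.trans (Reg.same_setReg hl.1 _ _)).charge _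
        split
        · exact h1.trans (ih _ l hl.2)
        · exact h1)
    rw [e]
    exact (h.elim id id).trans (.of_core rfl rfl rfl rfl rfl rfl)
  | move r r' => exact fun l hl => (Reg.same_setReg hl _ _).charge _
  | lookup r d k => exact fun l hl => (Reg.same_setReg hl _ _).charge _
  | pick r d => exact fun l hl => (Reg.same_setReg hl _ _).charge _
  | insert d k x =>
    intro l hl
    simp only [Stmt.run]
    split
    · exact (Ref.same_put hl _ _).charge _
    · exact (Loc.Same.refl l σ).charge _
  | delete d k =>
    intro l hl
    simp only [Stmt.run]
    split
    · exact (Ref.same_put hl _ _).charge _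
    · exact (Loc.Same.refl l σ).charge _
  | clear d => exact fun l hl => (Ref.same_put hl _ _).charge _
  | setFlag f b =>
    intro l hl
    cases l with
    | flag f' =>
      have : f' ≠ f := fun e => by simp [Stmt.writes, e] at hl
      simp [Loc.Same, Stmt.run, State.charge, Function.update_apply, this]
    | famOff _ _ => exact ⟨rfl, fun _ _ => rfl⟩
    | _ => exact rfl
  | setCtr n e =>
    intro l hl
    cases l with
    | ctr f' =>
      have : f' ≠ n := fun e => by simp [Stmt.writes, e] at hl
      simp [Loc.Same, Stmt.run, State.charge, Function.update_apply, this]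
    | famOff _ _ => exact ⟨rfl, fun _ _ => rfl⟩
    | _ => exact rfl
  | emit r =>
    intro l hl
    cases l with
    | output => simp [Stmt.writes] at hl
    | famOff _ _ => simp only [Stmt.run]; split <;> exact ⟨rfl, fun _ _ => rfl⟩
    | _ => simp only [Stmt.run]; split <;> exact rfl

/-- Every loop resets `held` when it ends, and no other instruction changes it. -/
theorem held_run (τ : Traversal V) (s : Stmt) (σ : State V) : (s.run τ σ).held = σ.held := by
  induction s generalizing σ with
  | skip => rfl
  | seq s t hs ht => simp only [Stmt.run]; rw [ht, hs]
  | ite c s t hs ht =>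
    simp only [Stmt.run]; split
    · rw [hs]; rfl
    · rw [ht]; rfl
  | insert d k x =>
    simp only [Stmt.run]
    split
    · cases d with
      | tab d => rfl
      | fam f r => simp only [State.put, State.charge]; split <;> rfl
    · rfl
  | delete d k =>
    simp only [Stmt.run]
    split
    · cases d with
      | tab d => rfl
      | fam f r => simp only [State.put, State.charge]; split <;> rfl
    · rfl
  | clear d =>
    simp only [Stmt.run]
    cases d with
    | tab d => rfl
    | fam f r => simp only [State.put, State.charge]; split <;> rfl
  | emit r => simp only [Stmt.run]; split <;> rfl
  | _ => rfl

end

section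
variable {V : Type u} [Fintype V] [DecidableEq V]

/-! ### Memory grows at most as fast as time passes -/

/-- The additive form avoids truncated subtraction, so that `omega` can combine it with other
bounds. -/
theorem sum_update_add {ι : Type*} [Fintype ι] [DecidableEq ι] (f : ι → ℕ) (i : ι) (v : ℕ) :
    ∑ j, Function.update f i v j + f i = ∑ j, f j + v := by
  rw [Finset.sum_update_of_mem (Finset.mem_univ i), ← Finset.add_sum_erase _ f (Finset.mem_univ i),
    Finset.sdiff_singleton_eq_erase]
  omega

theorem State.words_held (σ : State V) (h : ℕ) :
    ({ σ with held := h } : State V).words + σ.held = σ.words + h := by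
  simp only [State.words]; omega

theorem State.words_put_tab (σ : State V) (d : Tab) (t : Table V) :
    (σ.put (.tab d) t).words + (keys (σ.tab d)).card = σ.words + (keys t).card := by
  have h := sum_update_add (fun d => 1 + (keys (σ.tab d)).card) d (1 + (keys t).card)
  have e : ∀ j, Function.update (fun d => 1 + (keys (σ.tab d)).card) d (1 + (keys t).card) j =
      1 + (keys (Function.update σ.tab d t j)).card := by
    intro j; by_cases hj : j = d
    · subst hj; simp
    · simp [hj]
  simp only [e] at h
  simp only [State.words, State.put]
  omega

theorem State.words_put_fam {σ : State V} {r : Reg} {x : V} (hr : σ.reg r = some x) (f : Fam)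
    (t : Table V) :
    (σ.put (.fam f r) t).words + (keys (σ.fam f x)).card = σ.words + (keys t).card := by
  have h := sum_update_add (fun y => 1 + (keys (σ.fam f y)).card) x (1 + (keys t).card)
  have e : ∀ j, Function.update (fun y => 1 + (keys (σ.fam f y)).card) x (1 + (keys t).card) j =
      1 + (keys (Function.update (σ.fam f) x t j)).card := by
    intro j; by_cases hj : j = x
    · subst hj; simp
    · simp [hj]
  simp only [e] at h
  have h' := sum_update_add (fun g => ∑ y, (1 + (keys (σ.fam g y)).card)) f
    (∑ y, (1 + (keys (Function.update (σ.fam f) x t y)).card))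
  have e' : ∀ g, Function.update (fun g => ∑ y, (1 + (keys (σ.fam g y)).card)) f
      (∑ y, (1 + (keys (Function.update (σ.fam f) x t y)).card)) g =
      ∑ y, (1 + (keys (Function.update σ.fam f (Function.update (σ.fam f) x t) g y)).card) := by
    intro g; by_cases hg : g = f
    · subst hg; simp
    · simp [hg]
  simp only [e'] at h'
  rw [State.put_fam_some hr]
  simp only [State.words]
  omega

/-- Only an inequality holds in general: if the register is empty nothing is written, although the
new contents may be nonempty. -/
theorem State.words_put (σ : State V) (d : Ref) (t : Table V) :
    (σ.put d t).words + (keys (σ.get d)).card ≤ σ.words + (keys t).card := by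
  cases d with
  | tab d => exact (σ.words_put_tab d t).le
  | fam f r =>
    cases hr : σ.reg r with
    | none => rw [State.put_fam_none hr]; simp [State.get, hr]
    | some x => simpa [State.get, hr] using (State.words_put_fam hr f t).le

@[simp] theorem State.time_put (σ : State V) (d : Ref) (t : Table V) :
    (σ.put d t).time = σ.time := by
  cases d with
  | tab d => rfl
  | fam f r => simp only [State.put]; split <;> rfl

@[simp] theorem State.peak_put (σ : State V) (d : Ref) (t : Table V) :
    (σ.put d t).peak = σ.peak := by
  cases d with
  | tab d => rfl
  | fam f r => simp only [State.put]; split <;> rfl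

/-- Between the two states at most one new word has been used per unit of time. -/
structure Grow (σ σ' : State V) : Prop where
  time : σ.time ≤ σ'.time
  words : σ'.words + σ.time ≤ σ.words + σ'.time
  peak : σ'.peak ≤ max σ.peak (σ.words + (σ'.time - σ.time))

theorem Grow.trans {σ σ' σ'' : State V} (h : Grow σ σ') (h' : Grow σ' σ'') : Grow σ σ'' := by
  have h1 := h.1; have h2 := h.2; have h3 := h.3
  have h1' := h'.1; have h2' := h'.2; have h3' := h'.3
  constructor <;> omega

theorem Grow.charge {σ : State V} {k : ℕ} : Grow σ (σ.charge k) where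
  time := by simp [State.charge]
  words := by
    have : (σ.charge k).words = σ.words := rfl
    simp [State.charge] at *; omega
  peak := by simp only [State.charge]; omega

theorem Grow.step {σ σ' : State V} {k : ℕ} (ht : σ'.time = σ.time) (hp : σ'.peak = σ.peak)
    (hw : σ'.words ≤ σ.words + k) : Grow σ (σ'.charge k) where
  time := by simp [State.charge, ht]
  words := by
    have : (σ'.charge k).words = σ'.words := rfl
    have : (σ'.charge k).time = σ'.time + k := rfl
    omega
  peak := by simp only [State.charge]; omega

/-- Only insertions, output and the key copies of loops allocate words, and each is charged at least
as many units of time. A time bound for a stretch of program is therefore also a bound on the growth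
of its memory. -/
theorem grow_run (τ : Traversal V) (s : Stmt) (σ : State V) : Grow σ (s.run τ σ) := by
  induction s generalizing σ with
  | skip => exact ⟨le_rfl, le_rfl, by simp [Stmt.run]⟩
  | seq s t hs ht => exact (hs σ).trans (ht _)
  | ite c s t hs ht =>
    simp only [Stmt.run]
    split
    · exact Grow.charge.trans (hs _)
    · exact Grow.charge.trans (ht _)
  | forIn r d c body ih =>
    obtain ⟨σ', h, e⟩ := forIn_induct (τ := τ) (r := r) (d := d) (c := c) (body := body) (σ := σ)
      (I := fun _ σ' => Grow σ σ' ∧ σ'.held = σ.held + (keys (σ.get d)).card)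
      (Q := fun σ' => Grow σ σ' ∧ σ'.held = σ.held + (keys (σ.get d)).card)
      ⟨.step rfl rfl (by
        have := σ.words_held (σ.held + (keys (σ.get d)).card)
        omega), rfl⟩ (by
        intro D x σ' h _ _
        have h1 : Grow σ (σ'.advance r x c) := h.1.trans (.step rfl rfl (Nat.le_add_right _ _))
        split
        · exact ⟨h1.trans (ih _), by rw [held_run]; exact h.2⟩
        · exact ⟨h1, h.2⟩)
    rw [e]
    obtain ⟨h, hh⟩ := h.elim id id
    have := σ'.words_held σ.held
    have h1 := h.1; have h2 := h.2; have h3 := h.3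
    constructor <;> simp only <;> omega
  | move r r' => exact .step rfl rfl (Nat.le_add_right _ _)
  | lookup r d k => exact .step rfl rfl (Nat.le_add_right _ _)
  | pick r d => exact .step rfl rfl (Nat.le_add_right _ _)
  | insert d k x =>
    simp only [Stmt.run]
    split
    · rename_i k x _ _
      refine .step (by simp) (by simp) ?_
      have h1 := σ.words_put d (Function.update (σ.get d) k (some x))
      have h2 := Finset.card_insert_le k (keys (σ.get d))
      rw [keys_update_some] at h1
      omega
    · exact .charge
  | delete d k =>
    simp only [Stmt.run]
    split
    · rename_i k _
      refine .step (by simp) (by simp) ?_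
      have h1 := σ.words_put d (Function.update (σ.get d) k none)
      have h2 : ((keys (σ.get d)).erase k).card ≤ (keys (σ.get d)).card := Finset.card_erase_le
      rw [keys_update_none] at h1
      omega
    · exact .charge
  | clear d =>
    refine .step (by simp) (by simp) ?_
    have h1 := σ.words_put d (fun _ => none)
    simp only [keys_empty, Finset.card_empty] at h1
    omega
  | setFlag f b => exact .step rfl rfl (Nat.le_add_right _ _)
  | setCtr n e => exact .step rfl rfl (Nat.le_add_right _ _)
  | emit r =>
    simp only [Stmt.run]
    split
    · refine .step rfl rfl ?_
      simp only [State.words, List.length_cons]; omega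
    · exact .charge

/-- A program that is short in comparison with the available memory does not exceed it. -/
theorem peak_run_le {τ : Traversal V} {s : Stmt} {σ : State V} {t W : ℕ}
    (ht : (s.run τ σ).time ≤ σ.time + t) (hp : σ.peak ≤ W) (hw : σ.words + t ≤ W) :
    (s.run τ σ).peak ≤ W := by
  have h := (grow_run τ s σ).peak
  omega

/-! ### Rules for loops -/

theorem State.get_held (σ : State V) (h : ℕ) (d : Ref) :
    ({ σ with held := h } : State V).get d = σ.get d := by
  cases d <;> rfl

theorem Expr.eval_held (σ : State V) (h : ℕ) (e : Expr) :
    e.eval ({ σ with held := h } : State V) = e.eval σ := by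
  induction e <;> simp_all [Expr.eval, State.get_held]

theorem Cond.eval_held (σ : State V) (h : ℕ) (c : Cond) :
    c.eval ({ σ with held := h } : State V) = c.eval σ := by
  induction c <;> simp_all [Cond.eval, State.get_held, Expr.eval_held]

/-- The invariant does not depend on the resources used, nor on register `r`. -/
def Stable (r : Reg) (I : Finset V → State V → Prop) : Prop :=
  ∀ D σ x h t pk, I D σ →
    I D { σ with reg := Function.update σ.reg r x, held := h, time := t, peak := pk }

theorem Frame.forIn_body {r : Reg} {d : Ref} {c : Cond} {body : Stmt} {σ σ' : State V}
    (h : Frame body σ σ') : Frame (.forIn r d c body) σ σ' :=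
  h.mono fun l hl => by
    simp only [Stmt.writes, Bool.or_eq_false_iff] at hl
    exact hl.2

theorem Frame.advance {r : Reg} {d : Ref} {c : Cond} {body : Stmt} {σ σ' : State V} (x : V)
    (h : Frame (.forIn r d c body) σ σ') : Frame (.forIn r d c body) σ (σ'.advance r x c) :=
  fun l hl => (h l hl).trans ((Reg.same_setReg (by
    simp only [Stmt.writes, Bool.or_eq_false_iff] at hl
    exact hl.1) _ _).charge _)

/-- `D` is the set of keys that were processed, and leaving early is visible as a false guard in the
final state. Evaluating a guard does not depend on `held`, so this survives the release of the key
copy. -/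
theorem forIn_spec {τ : Traversal V} {r : Reg} {d : Ref} {c : Cond} {body : Stmt} {σ : State V}
    (I : Finset V → State V → Prop) (k : V → ℕ) (hI : Stable r I) (h0 : I ∅ σ)
    (hstep : ∀ D x σ', I D σ' → Frame (.forIn r d c body) σ σ' → D ⊆ keys (σ.get d) →
      x ∈ keys (σ.get d) → x ∉ D → σ'.reg r = some x → c.eval σ' = true →
      I (insert x D) (body.run τ σ') ∧ (body.run τ σ').time ≤ σ'.time + k x) :
    (∃ D ⊆ keys (σ.get d), I D ((Stmt.forIn r d c body).run τ σ) ∧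
      (D = keys (σ.get d) ∨ c.eval ((Stmt.forIn r d c body).run τ σ) = false)) ∧
    ((Stmt.forIn r d c body).run τ σ).time ≤
      σ.time + (∑ x ∈ keys (σ.get d), (k x + 1 + c.cost)) + (keys (σ.get d)).card + 1 := by
  set K := keys (σ.get d) with hK
  obtain ⟨σ', h, e⟩ := forIn_induct (τ := τ) (r := r) (d := d) (c := c) (body := body) (σ := σ)
    (I := fun D σ' => I D σ' ∧ Frame (.forIn r d c body) σ σ' ∧ D ⊆ K ∧
      σ'.time ≤ σ.time + (∑ x ∈ D, (k x + 1 + c.cost)) + K.card + 1)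
    (Q := fun σ' => (∃ D ⊆ K, I D σ') ∧ c.eval σ' = false ∧
      σ'.time ≤ σ.time + (∑ x ∈ K, (k x + 1 + c.cost)) + K.card + 1)
    ⟨by
      have := hI ∅ σ (σ.reg r) (σ.enter d).held (σ.enter d).time (σ.enter d).peak h0
      rw [Function.update_eq_self] at this
      exact this, fun l _ => .of_core rfl rfl rfl rfl rfl rfl, by simp, by
        have : (σ.enter d).time = σ.time + (K.card + 1) := rfl
        simp; omega⟩ (by
      intro D x σ' ⟨h1, h2, h3, h4⟩ hx hxD
      have hs : ∑ y ∈ insert x D, (k y + 1 + c.cost) = (k x + 1 + c.cost) +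
        ∑ y ∈ D, (k y + 1 + c.cost) := Finset.sum_insert hxD
      have hsub : insert x D ⊆ K := Finset.insert_subset hx h3
      -- If the guard fails at `x`, the cost of testing it is paid by the summand of `x`, which is
      -- not otherwise used.
      have hle : ∑ y ∈ insert x D, (k y + 1 + c.cost) ≤ ∑ y ∈ K, (k y + 1 + c.cost) :=
        Finset.sum_le_sum_of_subset hsub
      have ht : (σ'.advance r x c).time = σ'.time + (1 + c.cost) := rfl
      have h1' : I D (σ'.advance r x c) := hI D σ' (some x) _ _ _ h1
      split
      · rename_i hc
        have := hstep D x _ h1' (h2.advance x) h3 hx hxD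
          (by simp [State.advance, State.setReg, State.charge]) hc
        exact ⟨this.1, (h2.advance x).trans (frame_run τ body _).forIn_body, hsub, by omega⟩
      · rename_i hc
        exact ⟨⟨D, h3, h1'⟩, by simpa using hc, by omega⟩)
  rw [e]
  have hh : ∀ D, I D σ' → I D { σ' with held := σ.held } := fun D hD => by
    have := hI D σ' (σ'.reg r) σ.held σ'.time σ'.peak hD
    rwa [Function.update_eq_self] at this
  rcases h with ⟨h1, h2, h3, h4⟩ | ⟨⟨D, hD, h1⟩, h2, h3⟩
  · exact ⟨⟨K, subset_rfl, hh _ h1, .inl rfl⟩, h4⟩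
  · exact ⟨⟨D, hD, hh _ h1, .inr (by rw [Cond.eval_held]; exact h2)⟩, h3⟩

/-- Meant for loops whose total time exceeds the permitted memory. The invariant has to bound the
words in use when an iteration starts, key copy included, and each body is then bounded on its own.
-/
theorem forIn_peak {τ : Traversal V} {r : Reg} {d : Ref} {c : Cond} {body : Stmt} {σ : State V}
    (I : Finset V → State V → Prop) (W : ℕ) (hI : Stable r I) (h0 : I ∅ σ)
    (hwords : ∀ D σ', I D σ' → Frame (.forIn r d c body) σ σ' →
      σ'.held = σ.held + (keys (σ.get d)).card → σ'.words ≤ W)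
    (hstep : ∀ D x σ', I D σ' → Frame (.forIn r d c body) σ σ' → D ⊆ keys (σ.get d) →
      σ'.held = σ.held + (keys (σ.get d)).card →
      x ∈ keys (σ.get d) → x ∉ D → σ'.reg r = some x → c.eval σ' = true → σ'.peak ≤ W →
      I (insert x D) (body.run τ σ') ∧ (body.run τ σ').peak ≤ W) (hp : σ.peak ≤ W) :
    ((Stmt.forIn r d c body).run τ σ).peak ≤ W := by
  set K := keys (σ.get d) with hK
  have henter : I ∅ (σ.enter d) := by
    have := hI ∅ σ (σ.reg r) (σ.enter d).held (σ.enter d).time (σ.enter d).peak h0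
    rw [Function.update_eq_self] at this
    exact this
  have hfr : Frame (.forIn r d c body) σ (σ.enter d) := fun l _ =>
    .of_core rfl rfl rfl rfl rfl rfl
  obtain ⟨σ', h, e⟩ := forIn_induct (τ := τ) (r := r) (d := d) (c := c) (body := body) (σ := σ)
    (I := fun D σ' => I D σ' ∧ Frame (.forIn r d c body) σ σ' ∧ D ⊆ K ∧
      σ'.held = σ.held + K.card ∧ σ'.peak ≤ W)
    (Q := fun σ' => σ'.peak ≤ W)
    ⟨henter, hfr, by simp, rfl, by
      have : (σ.enter d).peak = max σ.peak (σ.enter d).words := rfl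
      have := hwords _ _ henter hfr rfl
      omega⟩ (by
      intro D x σ' ⟨h1, h2, h3, h4, h5⟩ hx hxD
      have h1' : I D (σ'.advance r x c) := hI D σ' (some x) _ _ _ h1
      have hpk : (σ'.advance r x c).peak ≤ W := by
        have h6 := hwords _ _ h1' (h2.advance x) h4
        have : (σ'.advance r x c).peak = max σ'.peak (σ'.advance r x c).words := rfl
        omega
      split
      · rename_i hc
        have := hstep D x _ h1' (h2.advance x) h3 h4 hx hxD
          (by simp [State.advance, State.setReg, State.charge]) hc hpk
        exact ⟨this.1, (h2.advance x).trans (frame_run τ body _).forIn_body,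
          Finset.insert_subset hx h3, by rw [held_run]; exact h4, this.2⟩
      · exact hpk)
  rw [e]
  exact h.elim (fun h => h.2.2.2.2) id

/-- The rule for loops over all keys of a table. -/
theorem forAll_spec {τ : Traversal V} {r : Reg} {d : Ref} {l : List Stmt} {σ : State V}
    (I : Finset V → State V → Prop) (k : V → ℕ) (hI : Stable r I) (h0 : I ∅ σ)
    (hstep : ∀ D x σ', I D σ' → Frame (forAll r d l) σ σ' → D ⊆ keys (σ.get d) →
      x ∈ keys (σ.get d) → x ∉ D → σ'.reg r = some x →
      I (insert x D) ((block l).run τ σ') ∧ ((block l).run τ σ').time ≤ σ'.time + k x) :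
    I (keys (σ.get d)) ((forAll r d l).run τ σ) ∧
    ((forAll r d l).run τ σ).time ≤ σ.time + (∑ x ∈ keys (σ.get d), (k x + 3)) + 1 := by
  obtain ⟨⟨D, hD, h1, h2⟩, h3⟩ := forIn_spec (τ := τ) (c := .tt) I k hI h0
    (fun D x σ' a b c d e f _ => hstep D x σ' a b c d e f)
  rcases h2 with rfl | h2
  · refine ⟨h1, h3.trans ?_⟩
    simp only [Cond.cost, Finset.sum_add_distrib, Finset.sum_const, smul_eq_mul]
    omega
  · simp [Cond.eval] at h2

end

section
variable {V : Type u} [Fintype V] [DecidableEq V]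

/-! ### Covers and matchings around a vertex -/

variable (G : SimpleGraph V) [DecidableRel G.Adj]

/-- The neighbours of `u` in `L`. -/
def lN (L : Finset V) (u : V) : Finset V := L.filter (G.Adj u)

/-- The neighbours of `u` outside `L`. -/
def rN (L : Finset V) (u : V) : Finset V := Finset.univ.filter fun x => G.Adj u x ∧ x ∉ L

variable {G} {L : Finset V} {u v : V} {ml mr : Table V} {p : ℕ}

@[simp] theorem mem_lN {y : V} : y ∈ lN G L u ↔ y ∈ L ∧ G.Adj u y := by simp [lN]

@[simp] theorem mem_rN {x : V} : x ∈ rN G L u ↔ G.Adj u x ∧ x ∉ L := by simp [rN]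

theorem lN_card_le_degree : (lN G L u).card ≤ G.degree u := by
  rw [← G.card_neighborFinset_eq_degree]
  exact Finset.card_le_card fun y hy => by simpa using (mem_lN.1 hy).2

theorem rN_card_le_degree : (rN G L u).card ≤ G.degree u := by
  rw [← G.card_neighborFinset_eq_degree]
  exact Finset.card_le_card fun y hy => by simpa using (mem_rN.1 hy).1

variable (G) in
/-- The set `D` meets all paths of length at most two that start in `u`, end in `L`, and have no
interior vertex in `L`. -/
structure IsCover (L : Finset V) (u : V) (D : Finset V) : Prop where
  not_mem : u ∉ D
  left : lN G L u ⊆ D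
  edge : ∀ x y, G.Adj u x → x ∉ L → G.Adj x y → y ∈ L → y ≠ u → x ∈ D ∨ y ∈ D

variable (G) in
/-- There is a cover of size at most `k`. -/
def HasCover (L : Finset V) (u : V) (k : ℕ) : Prop := ∃ D, IsCover G L u D ∧ D.card ≤ k

/-- The same set still works. A path that becomes relevant only now has the removed vertex in its
interior, and that vertex was a neighbour of `u` in `L`, hence in the cover. This is why a candidate
stays a candidate. -/
theorem HasCover.erase {k : ℕ} (h : HasCover G L u k) (v : V) : HasCover G (L.erase v) u k := by
  obtain ⟨D, hD, hk⟩ := h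
  refine ⟨D, ⟨hD.not_mem, fun y hy => hD.left ?_, fun x y hux hx hxy hy hyu => ?_⟩, hk⟩
  · simp only [mem_lN, Finset.mem_erase] at hy ⊢; tauto
  · by_cases hxL : x ∈ L
    · exact .inl (hD.left (by simp [hxL, hux]))
    · exact hD.edge x y hux hxL hxy (Finset.mem_of_mem_erase hy) hyu

theorem HasCover.of_degree_le (h : G.degree u ≤ p) : HasCover G Finset.univ u p := by
  refine ⟨G.neighborFinset u, ⟨by simp, fun y hy => by simpa using hy, fun x y _ hx => ?_⟩, ?_⟩
  · simp at hx
  · simpa using h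

theorem HasCover.lN_card_le (h : HasCover G L u p) : (lN G L u).card ≤ p := by
  obtain ⟨D, hD, hk⟩ := h
  exact (Finset.card_le_card hD.left).trans hk

/-- Every path of the packing meets the cover, necessarily in a vertex other than `u`. Since the
paths share only `u`, choosing such a vertex for each of them is injective. -/
theorem HasCover.pathPacking_le {k : ℕ} (h : HasCover G L u k) {X : Set V}
    (hX : ∀ x, x ∈ X ↔ x ∈ L ∧ x ≠ u) : pathPacking G 2 X u ≤ k := by
  obtain ⟨D, hD, hk⟩ := h
  refine iSup₂_le fun P hP => ?_
  have key : ∀ q ∈ P, ∃ z ∈ D, z ∈ (q.2 : G.Walk u q.1).support := by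
    rintro ⟨w, ⟨q, hq⟩⟩ hqP
    have h1 := hP.length_le _ hqP
    have h2 := (hX _).1 (hP.end_mem _ hqP)
    have h3 := hP.avoids _ hqP
    simp only at h1 h2 h3 ⊢
    match q, hq with
    | .nil, _ => exact absurd rfl h2.2
    | .cons a .nil, _ => exact ⟨w, hD.left (by simp [h2.1, a]), by simp⟩
    | .cons (v := x) a (.cons b .nil), hq =>
      have hxL : x ∉ L := by
        intro hxL
        exact h3 x (by simp) a.ne' b.ne ((hX x).2 ⟨hxL, a.ne'⟩)
      rcases hD.edge x w a hxL b h2.1 h2.2 with h | h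
      · exact ⟨x, h, by simp⟩
      · exact ⟨w, h, by simp⟩
    | .cons a (.cons b (.cons c d)), _ => simp at h1
  have : Nonempty V := ⟨u⟩
  choose! f hf using key
  have : P.card ≤ D.card := by
    refine Finset.card_le_card_of_injOn f (fun q hq => (hf q hq).1) fun q hq q' hq' e => ?_
    by_contra hne
    have := hP.disjoint q hq q' hq' hne (f q) (hf q hq).2 (e ▸ (hf q' hq').2)
    exact hD.not_mem (this ▸ (hf q hq).1)
  exact_mod_cast this.trans hk

variable (G) in
/-- The tables `ml` and `mr` describe a matching between the neighbours of `u` outside `L` and the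
vertices of `L` other than `u` and its neighbours.  Only edges at the vertex `x₀` may be added. -/
structure PreMat (L : Finset V) (u : V) (S : Set V) (ml mr : Table V) : Prop where
  inv : ∀ y x, ml y = some x ↔ mr x = some y
  mem : ∀ {y x}, ml y = some x → y ∈ L
  ne : ∀ {y x}, ml y = some x → y ≠ u
  not_adj : ∀ {y x}, ml y = some x → ¬ G.Adj u y
  adj : ∀ {y x}, ml y = some x → G.Adj u x
  not_mem : ∀ {y x}, ml y = some x → x ∉ L
  edge : ∀ {y x}, ml y = some x → G.Adj x y
  maximal : ∀ x y, x ∉ S → G.Adj u x → x ∉ L → mr x = none → G.Adj x y → y ∈ L → y ≠ u →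
    ¬ G.Adj u y → ml y ≠ none

variable (G) in
/-- The tables `ml` and `mr` describe a maximal matching between the neighbours of `u` outside `L`
and the vertices of `L` other than `u` and its neighbours. -/
abbrev Mat (L : Finset V) (u : V) (ml mr : Table V) : Prop := PreMat G L u ∅ ml mr

namespace PreMat

variable {S : Set V}

theorem keys_right (h : PreMat G L u S ml mr) : keys mr ⊆ rN G L u := by
  intro x hx
  obtain ⟨y, hy⟩ := mem_keys_iff.1 hx
  have := (h.inv y x).2 hy
  exact mem_rN.2 ⟨h.adj this, h.not_mem this⟩

theorem keys_left (h : PreMat G L u S ml mr) : keys ml ⊆ L := by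
  intro y hy
  obtain ⟨x, hx⟩ := mem_keys_iff.1 hy
  exact h.mem hx

theorem card_le_card (h : PreMat G L u S ml mr) : (keys ml).card ≤ (keys mr).card := by
  have key : ∀ y ∈ keys ml, ∃ x, ml y = some x := fun y hy => mem_keys_iff.1 hy
  choose! f hf using key
  refine Finset.card_le_card_of_injOn f (fun y hy => mem_keys_iff.2 ⟨y, (h.inv _ _).1 (hf y hy)⟩)
    fun y hy y' hy' e => ?_
  have h1 := (h.inv _ _).1 (hf y hy)
  have h2 := (h.inv _ _).1 (hf y' hy')
  rw [e, h2] at h1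
  simpa using h1.symm

theorem card_eq (h : PreMat G L u S ml mr) : (keys ml).card = (keys mr).card := by
  refine h.card_le_card.antisymm ?_
  have key : ∀ y ∈ keys mr, ∃ x, mr y = some x := fun y hy => mem_keys_iff.1 hy
  choose! f hf using key
  refine Finset.card_le_card_of_injOn f (fun y hy => mem_keys_iff.2 ⟨y, (h.inv _ _).2 (hf y hy)⟩)
    fun y hy y' hy' e => ?_
  have h1 := (h.inv _ _).2 (hf y hy)
  have h2 := (h.inv _ _).2 (hf y' hy')
  rw [e, h2] at h1
  simpa using h1.symm

theorem card_le_degree (h : PreMat G L u S ml mr) : (keys ml).card ≤ G.degree u :=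
  h.card_eq.trans_le ((Finset.card_le_card h.keys_right).trans rN_card_le_degree)

theorem disjoint_lN (h : PreMat G L u S ml mr) : Disjoint (keys ml) (lN G L u) := by
  rw [Finset.disjoint_left]
  intro y hy hy'
  obtain ⟨x, hx⟩ := mem_keys_iff.1 hy
  exact h.not_adj hx (mem_lN.1 hy').2

/-- A matching gives a path packing. -/
theorem le_pathPacking (h : PreMat G L u S ml mr) {X : Set V} (hu : u ∉ X)
    (hX : ∀ x ∈ L, x ≠ u → x ∈ X) :
    (((keys ml).card + (lN G L u).card : ℕ) : ℕ∞) ≤ pathPacking G 2 X u := by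
  have key : ∀ y ∈ keys ml ∪ lN G L u, ∃ q : Σ w : V, G.Path u w,
      (q.2 : G.Walk u q.1).length ≤ 2 ∧ q.1 ∈ X ∧
      (∀ x ∈ (q.2 : G.Walk u q.1).support, x ≠ u → x ≠ q.1 → x ∉ X) ∧
      ∀ z ∈ (q.2 : G.Walk u q.1).support, z = u ∨ z = y ∨ ml y = some z := by
    intro y hy
    rcases Finset.mem_union.1 hy with hy | hy
    · obtain ⟨x, hx⟩ := mem_keys_iff.1 hy
      -- The set `X` may be larger than `L` without `u`. If the middle vertex already lies in `X`,
      -- the path is cut short there, so that it has no interior vertex in `X`.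
      by_cases hxX : x ∈ X
      · refine ⟨⟨x, ⟨.cons (h.adj hx) .nil, ?_⟩⟩, ?_, hxX, ?_, ?_⟩
        · simpa using (h.adj hx).ne
        · simp
        · simp
        · simp [hx]
      · refine ⟨⟨y, ⟨.cons (h.adj hx) (.cons (h.edge hx) .nil), ?_⟩⟩, ?_, hX y (h.mem hx) (h.ne hx),
          ?_, ?_⟩
        · simp [SimpleGraph.Walk.cons_isPath_iff, (h.edge hx).ne, (h.adj hx).ne, (h.ne hx).symm]
        · simp
        · simp only [SimpleGraph.Walk.support_cons, SimpleGraph.Walk.support_nil, List.mem_cons,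
            List.not_mem_nil, or_false]
          rintro z (rfl | rfl | rfl) h1 h2
          · exact absurd rfl h1
          · exact hxX
          · exact absurd rfl h2
        · simp only [SimpleGraph.Walk.support_cons, SimpleGraph.Walk.support_nil, List.mem_cons,
            List.not_mem_nil, or_false, hx, Option.some.injEq]
          rintro z (rfl | rfl | rfl) <;> simp
    · obtain ⟨hyL, hadj⟩ := mem_lN.1 hy
      refine ⟨⟨y, ⟨.cons hadj .nil, ?_⟩⟩, ?_, hX y hyL hadj.ne', ?_, ?_⟩
      · simpa using hadj.ne
      · simp
      · simp
      · simp
  have : Nonempty (Σ w : V, G.Path u w) := ⟨⟨u, .nil⟩⟩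
  choose! f hf using key
  -- A vertex other than `u` determines the path it lies on: in `L` it is the index `y` itself,
  -- outside `L` it is the partner of a unique `y`.
  have hdisj : ∀ y ∈ keys ml ∪ lN G L u, ∀ y' ∈ keys ml ∪ lN G L u, y ≠ y' →
      ∀ z ∈ ((f y).2 : G.Walk u (f y).1).support, z ∈ ((f y').2 : G.Walk u (f y').1).support →
      z = u := by
    intro y hy y' hy' hne z hz hz'
    have hL : ∀ y ∈ keys ml ∪ lN G L u, y ∈ L := fun y hy => by
      rcases Finset.mem_union.1 hy with hy | hy
      · exact h.keys_left hy
      · exact (mem_lN.1 hy).1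
    rcases (hf y hy).2.2.2 z hz with h1 | h1 | h1
    · exact h1
    · rcases (hf y' hy').2.2.2 z hz' with h2 | h2 | h2
      · exact h2
      · exact absurd (h1.symm.trans h2) hne
      · exact absurd (h1 ▸ hL y hy) (h.not_mem h2)
    · rcases (hf y' hy').2.2.2 z hz' with h2 | h2 | h2
      · exact h2
      · exact absurd (h2 ▸ hL y' hy') (h.not_mem h1)
      · have h3 := (h.inv _ _).1 h1
        rw [(h.inv _ _).1 h2] at h3
        exact absurd (by simpa using h3.symm) hne
  -- Equal paths would share their end vertex, which would then be `u`; but the end lies in `X` and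
  -- `u` does not.
  have hinj : Set.InjOn f (keys ml ∪ lN G L u : Finset V) := by
    intro y hy y' hy' e
    by_contra hne
    have := hdisj y hy y' hy' hne (f y).1 (SimpleGraph.Walk.end_mem_support _)
      (by rw [e]; exact SimpleGraph.Walk.end_mem_support _)
    exact hu (this ▸ (hf y hy).2.1)
  classical
  have hP : IsPathPacking G 2 X u ((keys ml ∪ lN G L u).image f) := by
    constructor
    · intro q hq
      obtain ⟨y, hy, rfl⟩ := Finset.mem_image.1 hq
      exact (hf y hy).1
    · intro q hq
      obtain ⟨y, hy, rfl⟩ := Finset.mem_image.1 hq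
      exact (hf y hy).2.1
    · intro q hq q' hq' hne
      obtain ⟨y, hy, rfl⟩ := Finset.mem_image.1 hq
      obtain ⟨y', hy', rfl⟩ := Finset.mem_image.1 hq'
      exact hdisj y hy y' hy' fun e => hne (by rw [e])
    · intro q hq
      obtain ⟨y, hy, rfl⟩ := Finset.mem_image.1 hq
      exact (hf y hy).2.2.1
  have hc : ((keys ml ∪ lN G L u).image f).card = (keys ml).card + (lN G L u).card := by
    rw [Finset.card_image_of_injOn hinj, Finset.card_union_of_disjoint h.disjoint_lN]
  rw [← hc]
  exact le_iSup₂ (f := fun (P : Finset (Σ w : V, G.Path u w)) (_ : IsPathPacking G 2 X u P) =>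
    (P.card : ℕ∞)) _ hP

/-- Weak duality: the packing given by the matching and the bound given by the cover are compared
for the set `L` without `u`. -/
theorem card_add_le (h : PreMat G L u S ml mr) {k : ℕ} (hc : HasCover G L u k) :
    (keys ml).card + (lN G L u).card ≤ k := by
  have h1 := h.le_pathPacking (X := {x | x ∈ L ∧ x ≠ u}) (by simp) (fun x hx hxu => ⟨hx, hxu⟩)
  exact_mod_cast h1.trans (hc.pathPacking_le fun x => Iff.rfl)

/-- A set that is closed under alternating paths and contains no end of an augmenting path gives
a cover. -/
theorem hasCover (h : Mat G L u ml mr) (Z : Finset V)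
    (hS : ∀ x y, mr x ≠ none → G.Adj x y → y ∈ L → y ≠ u → ¬ G.Adj u y → ml y = none → x ∈ Z)
    (hT : ∀ x y, y ∈ Z → ml y ≠ none → G.Adj u x → x ∉ L → mr x = none → ¬ G.Adj x y)
    (hfwd : ∀ x y, x ∈ Z → mr x = some y → y ∈ Z)
    (hback : ∀ x y, y ∈ Z → ml y ≠ none → mr x ≠ none → G.Adj x y → mr x ≠ some y → x ∈ Z)
    (hpar : ∀ x y, y ∈ Z → ml y = some x → x ∈ Z) :
    HasCover G L u ((keys ml).card + (lN G L u).card) := by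
  -- König's cover: each matching edge contributes its end outside `L` if that end was visited, and
  -- its end in `L` if that one was not visited.
  refine ⟨lN G L u ∪ ((keys mr).filter (· ∈ Z) ∪ (keys ml).filter (· ∉ Z)), ⟨?_, ?_, ?_⟩, ?_⟩
  · simp only [Finset.mem_union, Finset.mem_filter, mem_lN, not_or]
    refine ⟨fun h => h.2.ne rfl, fun hx => ?_, fun hx => ?_⟩
    · exact (mem_rN.1 (h.keys_right hx.1)).1.ne rfl
    · obtain ⟨x, hx⟩ := mem_keys_iff.1 hx.1
      exact h.ne hx rfl
  · exact Finset.subset_union_left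
  · intro x y hux hx hxy hy hyu
    simp only [Finset.mem_union, Finset.mem_filter, mem_lN]
    by_cases huy : G.Adj u y
    · exact .inr (.inl ⟨hy, huy⟩)
    by_cases hyml : ml y = none
    · have hxm : mr x ≠ none := fun e => h.maximal x y (by simp) hux hx e hxy hy hyu huy hyml
      exact .inl (.inr (.inl ⟨by rw [← not_not (a := x ∈ keys mr), not_mem_keys]; exact hxm,
        hS x y hxm hxy hy hyu huy hyml⟩))
    -- For a visited `y`, an unmatched `x` would complete an augmenting path. So `x` is matched, and
    -- it is visited too, either as the partner of `y` or through the arc from `y` along an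
    -- unmatched edge.
    · by_cases hyZ : y ∈ Z
      · have hxm : mr x ≠ none := fun e => hT x y hyZ hyml hux hx e hxy
        have hxk : x ∈ keys mr := by rw [← not_not (a := x ∈ keys mr), not_mem_keys]; exact hxm
        refine .inl (.inr (.inl ⟨hxk, ?_⟩))
        by_cases hm : mr x = some y
        · exact hpar x y hyZ ((h.inv _ _).2 hm)
        · exact hback x y hyZ hyml hxm hxy hm
      · exact .inr (.inr (.inr ⟨by rw [← not_not (a := y ∈ keys ml), not_mem_keys]; exact hyml,
          hyZ⟩))
  -- The partner of a visited vertex outside `L` is visited as well, so at most one end of every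
  -- matching edge is counted.
  · have h1 : ((keys mr).filter (· ∈ Z)).card ≤ ((keys ml).filter (· ∈ Z)).card := by
      have key : ∀ y ∈ (keys mr).filter (· ∈ Z), ∃ x, mr y = some x := fun y hy =>
        mem_keys_iff.1 (Finset.mem_filter.1 hy).1
      choose! f hf using key
      refine Finset.card_le_card_of_injOn f (fun x hx => ?_) fun y hy y' hy' e => ?_
      · simp only [Finset.coe_filter, Set.mem_ofPred_eq]
        exact ⟨mem_keys_iff.2 ⟨x, (h.inv _ _).2 (hf x hx)⟩,
          hfwd x _ (Finset.mem_filter.1 hx).2 (hf x hx)⟩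
      · have h1 := (h.inv _ _).2 (hf y hy)
        have h2 := (h.inv _ _).2 (hf y' hy')
        rw [e, h2] at h1
        simpa using h1.symm
    have h2 := Finset.card_filter_add_card_filter_not (s := keys ml) (· ∈ Z)
    have h3 := Finset.card_union_le (lN G L u)
      ((keys mr).filter (· ∈ Z) ∪ (keys ml).filter (· ∉ Z))
    have h4 := Finset.card_union_le ((keys mr).filter (· ∈ Z)) ((keys ml).filter (· ∉ Z))
    omega

/-! ### Changes of matchings -/

/-- Such a vertex is in no matching edge and does not change sides; its removal only destroys
potential edges, so maximality persists. -/
theorem erase_of_not_adj (h : Mat G L u ml mr) (hadj : ¬ G.Adj u v) (hml : ml v = none) :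
    Mat G (L.erase v) u ml mr where
  inv := h.inv
  mem hy := Finset.mem_erase.2 ⟨fun e => by simp [e, hml] at hy, h.mem hy⟩
  ne := h.ne
  not_adj := h.not_adj
  adj := h.adj
  not_mem hy hx := h.not_mem hy (Finset.mem_of_mem_erase hx)
  edge := h.edge
  maximal x y hx hux hxL := h.maximal x y hx hux (fun hL => hxL (Finset.mem_erase.2
    ⟨fun e => hadj (e ▸ hux), hL⟩)) |> fun f a b c => f a b (Finset.mem_of_mem_erase c)

/-- The removed vertex joins the other side of the bipartite graph, unmatched. It is the only place
where an edge might now be added, hence the exceptional set. -/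
theorem erase_of_adj (h : Mat G L u ml mr) (hadj : G.Adj u v) :
    PreMat G (L.erase v) u {v} ml mr where
  inv := h.inv
  mem hy := Finset.mem_erase.2 ⟨fun e => h.not_adj hy (e ▸ hadj), h.mem hy⟩
  ne := h.ne
  not_adj := h.not_adj
  adj := h.adj
  not_mem hy hx := h.not_mem hy (Finset.mem_of_mem_erase hx)
  edge := h.edge
  maximal x y hx hux hxL := h.maximal x y (by simp) hux (fun hL => hxL (Finset.mem_erase.2
    ⟨fun e => hx (by simp [e]), hL⟩)) |> fun f a b c => f a b (Finset.mem_of_mem_erase c)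

/-- Once the edge at `v` is gone, its other end `z` is the only vertex that is newly unmatched and
may still have a free neighbour. Maximality is suspended there only. -/
theorem erase_of_matched {z : V} (h : Mat G L u ml mr) (hv : ml v = some z) :
    PreMat G (L.erase v) u {z} (Function.update ml v none) (Function.update mr z none) := by
  have e : ∀ {y x}, Function.update ml v none y = some x → y ≠ v ∧ ml y = some x := by
    intro y x hy
    by_cases hyv : y = v
    · simp [hyv] at hy
    · exact ⟨hyv, by simpa [hyv] using hy⟩
  constructor
  · intro y x
    by_cases hyv : y = v
    · subst hyv
      by_cases hxz : x = z
      · simp [hxz]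
      · simp only [Function.update_self, reduceCtorEq, ne_eq, hxz, not_false_eq_true,
          Function.update_of_ne, false_iff]
        rw [← h.inv, hv]
        simpa [eq_comm] using hxz
    · by_cases hxz : x = z
      · subst hxz
        simp only [ne_eq, hyv, not_false_eq_true, Function.update_of_ne, Function.update_self,
          reduceCtorEq, iff_false]
        rw [h.inv, (h.inv _ _).1 hv]
        simpa [eq_comm] using hyv
      · simpa [hyv, hxz] using h.inv y x
  · exact fun hy => Finset.mem_erase.2 ⟨(e hy).1, h.mem (e hy).2⟩
  · exact fun hy => h.ne (e hy).2
  · exact fun hy => h.not_adj (e hy).2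
  · exact fun hy => h.adj (e hy).2
  · exact fun hy hx => h.not_mem (e hy).2 (Finset.mem_of_mem_erase hx)
  · exact fun hy => h.edge (e hy).2
  · intro x y hx hux hxL hm hxy hy hyu huy
    have hxz : x ≠ z := by simpa using hx
    have hyv : y ≠ v := (Finset.mem_erase.1 hy).1
    rw [Function.update_of_ne hyv]
    rw [Function.update_of_ne hxz] at hm
    refine h.maximal x y (by simp) hux (fun hL => hxL (Finset.mem_erase.2 ⟨?_, hL⟩)) hm hxy
      (Finset.mem_of_mem_erase hy) hyu huy
    rintro rfl
    exact h.not_adj hv hux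

/-- Adding an edge at the exceptional vertex. -/
theorem add_edge {x w : V} (h : PreMat G L u {x} ml mr) (hux : G.Adj u x) (hx : x ∉ L)
    (hm : mr x = none) (hxw : G.Adj x w) (hw : w ∈ L) (hml : ml w = none) (hwu : w ≠ u)
    (huw : ¬ G.Adj u w) :
    Mat G L u (Function.update ml w (some x)) (Function.update mr x (some w)) := by
  have e : ∀ {y x'}, Function.update ml w (some x) y = some x' → y = w ∧ x' = x ∨
      ml y = some x' := by
    intro y x' hy
    by_cases hyv : y = w
    · subst hyv; exact .inl ⟨rfl, by simpa [eq_comm] using hy⟩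
    · exact .inr (by simpa [hyv] using hy)
  constructor
  · intro y x'
    by_cases hyw : y = w
    · subst hyw
      by_cases hxx : x' = x
      · simp [hxx]
      · have : mr x' ≠ some y := by rw [Ne, ← h.inv, hml]; simp
        simp [hxx, this, Ne.symm hxx]
    · by_cases hxx : x' = x
      · subst hxx
        have : ml y ≠ some x' := by rw [Ne, h.inv, hm]; simp
        simp [hyw, this]
        exact fun h => hyw h.symm
      · simpa [hyw, hxx] using h.inv y x'
  · intro y x' hy; rcases e hy with ⟨rfl, rfl⟩ | hy; exacts [hw, h.mem hy]
  · intro y x' hy; rcases e hy with ⟨rfl, rfl⟩ | hy; exacts [hwu, h.ne hy]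
  · intro y x' hy; rcases e hy with ⟨rfl, rfl⟩ | hy; exacts [huw, h.not_adj hy]
  · intro y x' hy; rcases e hy with ⟨rfl, rfl⟩ | hy; exacts [hux, h.adj hy]
  · intro y x' hy; rcases e hy with ⟨rfl, rfl⟩ | hy; exacts [hx, h.not_mem hy]
  · intro y x' hy; rcases e hy with ⟨rfl, rfl⟩ | hy; exacts [hxw, h.edge hy]
  · intro x' y _ hux' hxL hm' hxy hy hyu huy
    have hxx : x' ≠ x := by rintro rfl; simp at hm'
    rw [Function.update_of_ne hxx] at hm'
    by_cases hyw : y = w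
    · simp [hyw]
    · rw [Function.update_of_ne hyw]
      exact h.maximal x' y (by simpa using hxx) hux' hxL hm' hxy hy hyu huy

/-- If no edge can be added at the exceptional vertex, the matching is maximal. -/
theorem of_no_edge {x : V} (h : PreMat G L u {x} ml mr)
    (hno : ∀ w, G.Adj x w → w ∈ L → w ≠ u → ¬ G.Adj u w → ml w ≠ none) : Mat G L u ml mr :=
  { h with
    maximal := fun x' y _ hux' hxL hm' hxy hy hyu huy => by
      by_cases hxx : x' = x
      · subst hxx; exact hno y hxy hy hyu huy
      · exact h.maximal x' y (by simpa using hxx) hux' hxL hm' hxy hy hyu huy }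

/-- Overriding the matching by the edges in `ep`. -/
theorem override {ep ml' mr' : Table V} (h : Mat G L u ml mr)
    (hedge : ∀ {x y}, ep x = some y → y ∈ L ∧ y ≠ u ∧ ¬ G.Adj u y ∧ G.Adj u x ∧ x ∉ L ∧ G.Adj x y)
    (hclosed : ∀ {x y}, mr x = some y → ((ep x).isSome ↔ ∃ x', ep x' = some y))
    (hr : ∀ x, mr' x = (ep x).or (mr x)) (hl : ∀ {x y}, ep x = some y → ml' y = some x)
    (hl' : ∀ {y}, (∀ x, ep x ≠ some y) → ml' y = ml y) : Mat G L u ml' mr' := by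
  -- By `hclosed`, an old edge has either both ends overridden or neither. The surviving edges are
  -- therefore disjoint from the new ones.
  have e : ∀ {y x}, ml' y = some x → ep x = some y ∨ (ml y = some x ∧ ep x = none) := by
    intro y x hy
    by_cases hex : ∃ x', ep x' = some y
    · obtain ⟨x', hx'⟩ := hex
      rw [hl hx'] at hy
      obtain rfl : x' = x := by simpa using hy
      exact .inl hx'
    · have := hl' (fun x hx => hex ⟨x, hx⟩)
      rw [this] at hy
      have h2 := hclosed ((h.inv _ _).1 hy)
      refine .inr ⟨hy, ?_⟩
      rw [← not_iff_not] at h2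
      simpa using h2.2 hex
  have e' : ∀ {y x}, ep x = some y ∨ (ml y = some x ∧ ep x = none) → ml' y = some x := by
    rintro y x (hy | ⟨hy, hx⟩)
    · exact hl hy
    · rw [hl', hy]
      intro x' hx'
      have h2 := (hclosed ((h.inv _ _).1 hy)).2 ⟨x', hx'⟩
      simp [hx] at h2
  constructor
  · intro y x
    have h1 : ml' y = some x ↔ ep x = some y ∨ (ml y = some x ∧ ep x = none) := ⟨e, e'⟩
    rw [h1, hr, h.inv]
    cases hx : ep x <;> simp
  · intro y x hy; rcases e hy with hy | hy; exacts [(hedge hy).1, h.mem hy.1]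
  · intro y x hy; rcases e hy with hy | hy; exacts [(hedge hy).2.1, h.ne hy.1]
  · intro y x hy; rcases e hy with hy | hy; exacts [(hedge hy).2.2.1, h.not_adj hy.1]
  · intro y x hy; rcases e hy with hy | hy; exacts [(hedge hy).2.2.2.1, h.adj hy.1]
  · intro y x hy; rcases e hy with hy | hy; exacts [(hedge hy).2.2.2.2.1, h.not_mem hy.1]
  · intro y x hy; rcases e hy with hy | hy; exacts [(hedge hy).2.2.2.2.2, h.edge hy.1]
  -- Overriding never leaves a matched vertex unmatched, so maximality is inherited.
  · intro x y _ hux hxL hm hxy hy hyu huy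
    rw [hr, Option.or_eq_none_iff] at hm
    by_cases hex : ∃ x', ep x' = some y
    · obtain ⟨x', hx'⟩ := hex
      simp [hl hx']
    · rw [hl' (fun x hx => hex ⟨x, hx⟩)]
      exact h.maximal x y (by simp) hux hxL hm.2 hxy hy hyu huy

end PreMat

/-! ### The potential -/

variable (G) in
/-- The vertices of `L` that are reachable from `u` by a path of length two through a vertex outside
`L`, except `u` and its neighbours. -/
def reach (L : Finset V) (u : V) : Finset V :=
  (L.erase u).filter fun y => ¬ G.Adj u y ∧ ∃ x, G.Adj u x ∧ x ∉ L ∧ G.Adj x y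

variable (G) in
-- When a neighbour of `u` leaves `L`, at most `p` vertices become newly reachable through it. The
-- weight `p + 1` of a neighbour outweighs them.
def phi (p : ℕ) (L : Finset V) (u : V) : ℕ := (p + 1) * (lN G L u).card + (reach G L u).card

theorem mem_reach {y : V} : y ∈ reach G L u ↔ (y ≠ u ∧ y ∈ L) ∧ ¬ G.Adj u y ∧
    ∃ x, G.Adj u x ∧ x ∉ L ∧ G.Adj x y := by simp [reach]

theorem lN_erase : lN G (L.erase v) u = (lN G L u).erase v := by
  ext y; simp [and_assoc]

theorem lN_erase_self : lN G (L.erase v) v = lN G L v := by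
  rw [lN_erase, Finset.erase_eq_of_notMem]; simp

theorem lN_erase_of_not_adj (h : ¬ G.Adj u v) : lN G (L.erase v) u = lN G L u := by
  rw [lN_erase, Finset.erase_eq_of_notMem]; simp [h]

theorem reach_erase_of_not_adj (h : ¬ G.Adj u v) :
    reach G (L.erase v) u ⊆ (reach G L u).erase v := by
  intro y hy
  simp only [mem_reach, Finset.mem_erase] at hy ⊢
  obtain ⟨⟨h1, h2, h3⟩, h4, x, h5, h6, h7⟩ := hy
  refine ⟨h2, ⟨h1, h3⟩, h4, x, h5, fun hx => h6 ⟨?_, hx⟩, h7⟩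
  rintro rfl; exact h h5

/-- If `v` is a neighbour, the first term loses `p + 1`, and whatever enters `reach` is a neighbour
of `v` in `L`, of which there are at most `p`. Otherwise nothing enters `reach`, and `v` leaves it.
-/
theorem phi_erase_lt (hv : v ∈ L) (hp : (lN G L v).card ≤ p)
    (h : G.Adj u v ∨ v ∈ reach G L u) : phi G p (L.erase v) u < phi G p L u := by
  unfold phi
  by_cases hadj : G.Adj u v
  · have h1 : (lN G L u).card = (lN G (L.erase v) u).card + 1 := by
      rw [lN_erase, Finset.card_erase_add_one]; simp [hv, hadj]
    have h2 : reach G (L.erase v) u ⊆ reach G L u ∪ lN G L v := by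
      intro y hy
      simp only [mem_reach, Finset.mem_union, Finset.mem_erase, mem_lN] at hy ⊢
      obtain ⟨⟨h1, h2, h3⟩, h4, x, h5, h6, h7⟩ := hy
      by_cases hx : x = v
      · subst hx; exact .inr ⟨h3, h7⟩
      · exact .inl ⟨⟨h1, h3⟩, h4, x, h5, fun h => h6 ⟨hx, h⟩, h7⟩
    have h3 := (Finset.card_le_card h2).trans (Finset.card_union_le _ _)
    rw [h1]
    have h4 : (p + 1) * ((lN G (L.erase v) u).card + 1) =
      (p + 1) * (lN G (L.erase v) u).card + (p + 1) := by ring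
    omega
  · have hr := h.resolve_left hadj
    have h1 := Finset.card_le_card (reach_erase_of_not_adj (L := L) hadj)
    have h2 := Finset.card_erase_add_one hr
    rw [lN_erase_of_not_adj hadj]
    omega

theorem phi_erase_le (hv : v ∈ L) (hp : (lN G L v).card ≤ p) :
    phi G p (L.erase v) u ≤ phi G p L u := by
  by_cases hadj : G.Adj u v
  · exact (phi_erase_lt hv hp (.inl hadj)).le
  · have h1 := Finset.card_le_card ((reach_erase_of_not_adj (L := L) hadj).trans
      (Finset.erase_subset _ _))
    unfold phi
    rw [lN_erase_of_not_adj hadj]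
    omega

/-- By maximality, a vertex of `reach` is either matched or adjacent to a matched vertex outside
`L`, and the latter have at most `p` neighbours in `L` each. So `reach` has at most `p + p ^ 2`
elements, and the first term is at most `(p + 1) * p`. -/
theorem PreMat.phi_le (h : Mat G L u ml mr) (hc : (keys ml).card + (lN G L u).card ≤ p)
    (hR : ∀ x, x ∉ L → (lN G L x).card ≤ p) : phi G p L u ≤ 2 * p ^ 2 + 2 * p := by
  have h1 : reach G L u ⊆ keys ml ∪ (keys mr).biUnion (lN G L) := by
    intro y hy
    obtain ⟨⟨h1, h2⟩, h3, x, h4, h5, h6⟩ := mem_reach.1 hy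
    rw [Finset.mem_union, Finset.mem_biUnion]
    by_cases hx : mr x = none
    · left
      have := h.maximal x y (by simp) h4 h5 hx h6 h2 h1 h3
      rwa [← not_not (a := y ∈ keys ml), not_mem_keys]
    · right
      exact ⟨x, by rwa [← not_not (a := x ∈ keys mr), not_mem_keys], by simp [h2, h6]⟩
  have h2 := (Finset.card_le_card h1).trans (Finset.card_union_le _ _)
  have h3 : ((keys mr).biUnion (lN G L)).card ≤ (keys mr).card * p :=
    Finset.card_biUnion_le_card_mul _ _ _ fun x hx => hR x (mem_rN.1 (h.keys_right hx)).2
  have h4 := h.card_eq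
  unfold phi
  have h5 : (lN G L u).card ≤ p := by omega
  have h6 : (keys mr).card ≤ p := by omega
  nlinarith

/-! ### Orderings -/

theorem orderAdm_le_iff {o : LinearOrder V} {k : ℕ} :
    orderAdm G 2 o ≤ k ↔ ∀ v, pathPacking G 2 {w | o.lt w v} v ≤ k := by
  simp [orderAdm, iSup_le_iff]

/-- If every vertex of `L` is the root of a large packing, the admissibility is large. -/
theorem lt_graphAdm_of_stuck (hL : L.Nonempty)
    (h : ∀ u ∈ L, ∀ X : Set V, u ∉ X → (∀ x ∈ L, x ≠ u → x ∈ X) →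
      ((p + 1 : ℕ) : ℕ∞) ≤ pathPacking G 2 X u) : (p : ℕ∞) < graphAdm G 2 := by
  have h1 : ((p + 1 : ℕ) : ℕ∞) ≤ graphAdm G 2 := by
    refine le_iInf fun o => ?_
    -- The vertex of `L` that comes last in the ordering has all others of `L` to its left.
    obtain ⟨u, hu, hmax⟩ := @Finset.exists_maximal V o.toPreorder.toLE _ L hL
    refine (h u hu {w | o.lt w u} (lt_irrefl u) fun x hx hxu => ?_).trans
      (le_iSup (fun v => pathPacking G 2 {w | o.lt w v} v) u)
    rcases lt_trichotomy x u with h1 | h1 | h1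
    · exact h1
    · exact absurd h1 hxu
    · exact absurd (hmax hx h1.le) (not_le_of_gt h1)
  refine lt_of_lt_of_le ?_ h1
  exact_mod_cast Nat.lt_succ_self p

theorem PreMat.le_pathPacking' {S : Set V} (h : PreMat G L u S ml mr) {k : ℕ}
    (hk : k ≤ (keys ml).card + (lN G L u).card) {X : Set V} (hu : u ∉ X)
    (hX : ∀ x ∈ L, x ≠ u → x ∈ X) : (k : ℕ∞) ≤ pathPacking G 2 X u :=
  le_trans (by exact_mod_cast hk) (h.le_pathPacking hu hX)

theorem emptyMat (u : V) : Mat G Finset.univ u (fun _ => none) (fun _ => none) := by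
  constructor <;> simp

/-- A graph of small admissibility has few edges. -/
theorem card_edgeFinset_le (h : graphAdm G 2 ≤ p) : G.edgeFinset.card ≤ p * Fintype.card V := by
  obtain ⟨o, ho⟩ : ∃ o : LinearOrder V, orderAdm G 2 o ≤ p := by
    have : graphAdm G 2 < ((p + 1 : ℕ) : ℕ∞) := lt_of_le_of_lt h (by exact_mod_cast Nat.lt_succ_self p)
    obtain ⟨o, ho⟩ := iInf_lt_iff.1 this
    exact ⟨o, by
      have : orderAdm G 2 o < (p : ℕ∞) + 1 := by exact_mod_cast ho
      exact ENat.lt_add_one_iff (by simp) |>.1 this⟩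
  rw [orderAdm_le_iff] at ho
  classical
  have hdeg : ∀ v, (Finset.univ.filter fun w => G.Adj v w ∧ o.lt w v).card ≤ p := by
    intro v
    -- The empty matching, with maximality waived everywhere: the resulting packing consists of
    -- single edges to the neighbours on the left.
    have h1 : PreMat G (Finset.univ.filter fun w => o.lt w v) v Set.univ (fun _ => none)
      (fun _ => none) := by constructor <;> simp
    have h2 := h1.le_pathPacking (X := {w | o.lt w v}) (lt_irrefl v) (by
      intro x hx _; simpa using hx)
    have h3 : lN G (Finset.univ.filter fun w => o.lt w v) v =
      Finset.univ.filter fun w => G.Adj v w ∧ o.lt w v := by ext; simp [and_comm]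
    rw [h3] at h2
    have := h2.trans (ho v)
    simpa using this
  have h2 : G.edgeFinset ⊆ Finset.univ.biUnion fun v =>
      (Finset.univ.filter fun w => G.Adj v w ∧ o.lt w v).image fun w => s(v, w) := by
    intro e he
    induction e with
    | h a b =>
      have hab : G.Adj a b := by simpa using he
      simp only [Finset.mem_biUnion, Finset.mem_univ, true_and, Finset.mem_image,
        Finset.mem_filter]
      rcases lt_trichotomy a b with hlt | heq | hlt
      · exact ⟨b, a, ⟨hab.symm, hlt⟩, Sym2.eq_swap⟩
      · exact absurd heq hab.ne
      · exact ⟨a, b, ⟨hab, hlt⟩, rfl⟩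
  refine (Finset.card_le_card h2).trans ((Finset.card_biUnion_le_card_mul _ _ p fun v _ =>
    Finset.card_image_le.trans (hdeg v)).trans ?_)
  rw [Finset.card_univ, mul_comm]

variable (G) in
/-- Every vertex of the list has a small cover at the time when exactly the later vertices of the
list have been removed. -/
def GoodSuffixes (p : ℕ) : List V → Prop
  | [] => True
  | v :: l => HasCover G (Finset.univ \ l.toFinset) v p ∧ GoodSuffixes p l

theorem GoodSuffixes.split {l₁ l₂ : List V} (h : GoodSuffixes G p (l₁ ++ v :: l₂)) :
    HasCover G (Finset.univ \ l₂.toFinset) v p := by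
  induction l₁ with
  | nil => exact h.1
  | cons a l ih => exact ih h.2

/-- The ordering is by position in the list. The vertices to the left of `v` are exactly those that
had not been removed when `v` left, apart from `v` itself, so the cover recorded for `v` bounds its
packings. -/
theorem GoodSuffixes.exists_order {l : List V} (h : GoodSuffixes G p l) (hn : l.Nodup)
    (hl : ∀ v, v ∈ l) :
    ∃ o : LinearOrder V, l.Pairwise o.lt ∧ orderAdm G 2 o ≤ p := by
  let o : LinearOrder V := LinearOrder.lift' (fun v => l.idxOf v)
    (fun a b e => (List.idxOf_inj (hl a)).1 e)
  have hlt : ∀ a b, o.lt a b ↔ l.idxOf a < l.idxOf b := fun a b => Iff.rfl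
  refine ⟨o, ?_, ?_⟩
  · rw [List.pairwise_iff_getElem]
    intro i j hi hj hij
    rw [hlt, hn.idxOf_getElem, hn.idxOf_getElem]
    exact hij
  · rw [orderAdm_le_iff]
    intro v
    obtain ⟨l₁, l₂, e⟩ := List.append_of_mem (hl v)
    have h1 := (e ▸ h).split
    refine h1.pathPacking_le fun x => ?_
    rw [Set.mem_ofPred_eq, hlt]
    have hnd : (l₁ ++ v :: l₂).Nodup := e ▸ hn
    have hx : x ∈ l₁ ++ v :: l₂ := e ▸ hl x
    rw [e]
    have hv1 : v ∉ l₁ := fun hv => (List.nodup_append.1 hnd).2.2 v hv v (by simp) rfl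
    have hiv : (l₁ ++ v :: l₂).idxOf v = l₁.length := by
      rw [List.idxOf_append_of_notMem hv1]; simp
    rw [hiv]
    by_cases hx1 : x ∈ l₁
    · have : l₁.idxOf x < l₁.length := List.idxOf_lt_length_iff.2 hx1
      rw [List.idxOf_append_of_mem hx1]
      have h3 : x ∉ v :: l₂ := fun hv => (List.nodup_append.1 hnd).2.2 x hx1 x hv rfl
      simp only [List.mem_cons, not_or] at h3
      simp [this, h3]
    · rw [List.idxOf_append_of_notMem hx1]
      have h3 : x = v ∨ x ∈ l₂ := by simpa [hx1] using hx
      simp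
      tauto

end

section
variable {V : Type u} [Fintype V] [DecidableEq V]

/-! ### Symbolic execution -/

namespace State

variable (σ : State V) (k : ℕ) (r : Reg) (a : Option V) (t : Table V) (d : Tab) (f : Fam)

@[simp] theorem reg_charge : (σ.charge k).reg = σ.reg := rfl
@[simp] theorem flag_charge : (σ.charge k).flag = σ.flag := rfl
@[simp] theorem tab_charge : (σ.charge k).tab = σ.tab := rfl
@[simp] theorem fam_charge : (σ.charge k).fam = σ.fam := rfl
@[simp] theorem output_charge : (σ.charge k).output = σ.output := rfl
@[simp] theorem time_charge : (σ.charge k).time = σ.time + k := rfl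

@[simp] theorem reg_setReg : (σ.setReg r a).reg = Function.update σ.reg r a := rfl
@[simp] theorem flag_setReg : (σ.setReg r a).flag = σ.flag := rfl
@[simp] theorem tab_setReg : (σ.setReg r a).tab = σ.tab := rfl
@[simp] theorem fam_setReg : (σ.setReg r a).fam = σ.fam := rfl
@[simp] theorem output_setReg : (σ.setReg r a).output = σ.output := rfl
@[simp] theorem time_setReg : (σ.setReg r a).time = σ.time := rfl

@[simp] theorem get_tab : σ.get (.tab d) = σ.tab d := rfl
@[simp] theorem get_fam : σ.get (.fam f r) = match σ.reg r with
    | none => fun _ => none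
    | some x => σ.fam f x := rfl

@[simp] theorem reg_put (d : Ref) : (σ.put d t).reg = σ.reg := by
  cases d with
  | tab d => rfl
  | fam f r => simp only [State.put]; split <;> rfl
@[simp] theorem flag_put (d : Ref) : (σ.put d t).flag = σ.flag := by
  cases d with
  | tab d => rfl
  | fam f r => simp only [State.put]; split <;> rfl
@[simp] theorem output_put (d : Ref) : (σ.put d t).output = σ.output := by
  cases d with
  | tab d => rfl
  | fam f r => simp only [State.put]; split <;> rfl
@[simp] theorem tab_put_tab : (σ.put (.tab d) t).tab = Function.update σ.tab d t := rfl
@[simp] theorem fam_put_tab : (σ.put (.tab d) t).fam = σ.fam := rfl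
@[simp] theorem tab_put_fam : (σ.put (.fam f r) t).tab = σ.tab := by
  simp only [State.put]; split <;> rfl
@[simp] theorem fam_put_fam : (σ.put (.fam f r) t).fam = match σ.reg r with
    | none => σ.fam
    | some x => Function.update σ.fam f (Function.update (σ.fam f) x t) := by
  cases h : σ.reg r <;> simp [State.put, h]

end State

section
variable (τ : Traversal V) (σ : State V)

@[simp] theorem run_seq (s t : Stmt) : (Stmt.seq s t).run τ σ = t.run τ (s.run τ σ) := rfl
@[simp] theorem run_block_nil : (block []).run τ σ = σ := rfl
@[simp] theorem run_block_cons (s : Stmt) (l : List Stmt) :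
    (block (s :: l)).run τ σ = (block l).run τ (s.run τ σ) := rfl
@[simp] theorem run_ite (c : Cond) (s t : Stmt) : (Stmt.ite c s t).run τ σ =
    if c.eval σ then s.run τ (σ.charge c.cost) else t.run τ (σ.charge c.cost) := rfl
@[simp] theorem run_when (c : Cond) (l : List Stmt) : (when c l).run τ σ =
    if c.eval σ then (block l).run τ (σ.charge c.cost) else σ.charge c.cost := rfl
@[simp] theorem run_move (r r' : Reg) :
    (Stmt.move r r').run τ σ = (σ.setReg r (σ.reg r')).charge 1 := rfl
@[simp] theorem run_lookup (r : Reg) (d : Ref) (k : Reg) :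
    (Stmt.lookup r d k).run τ σ = (σ.setReg r ((σ.reg k).bind (σ.get d))).charge 1 := rfl
@[simp] theorem run_insert (d : Ref) (k x : Reg) : (Stmt.insert d k x).run τ σ =
    match σ.reg k, σ.reg x with
    | some k, some x => (σ.put d (Function.update (σ.get d) k (some x))).charge 1
    | _, _ => σ.charge 1 := rfl
@[simp] theorem run_insertSet (d : Ref) (k : Reg) : (insertSet d k).run τ σ =
    (Stmt.insert d k k).run τ σ := rfl
@[simp] theorem run_delete (d : Ref) (k : Reg) : (Stmt.delete d k).run τ σ =
    match σ.reg k with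
    | some k => (σ.put d (Function.update (σ.get d) k none)).charge 1
    | none => σ.charge 1 := rfl
@[simp] theorem run_clear (d : Ref) : (Stmt.clear d).run τ σ =
    (σ.put d fun _ => none).charge ((keys (σ.get d)).card + 1) := rfl

variable (f : Flag) (b : Bool) (n : Ctr) (e : Expr)

@[simp] theorem reg_setFlag : ((Stmt.setFlag f b).run τ σ).reg = σ.reg := rfl
@[simp] theorem flag_setFlag :
    ((Stmt.setFlag f b).run τ σ).flag = Function.update σ.flag f b := rfl
@[simp] theorem tab_setFlag : ((Stmt.setFlag f b).run τ σ).tab = σ.tab := rfl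
@[simp] theorem fam_setFlag : ((Stmt.setFlag f b).run τ σ).fam = σ.fam := rfl
@[simp] theorem time_setFlag : ((Stmt.setFlag f b).run τ σ).time = σ.time + 1 := rfl

@[simp] theorem ctr_setCtr :
    ((Stmt.setCtr n e).run τ σ).ctr = Function.update σ.ctr n (e.eval σ) := rfl

end

attribute [simp] Cond.eval Expr.eval Cond.cost Expr.cost

/-- Does the program contain neither loops nor instructions that clear a table? -/
def Stmt.simple : Stmt → Bool
  | .seq s t => s.simple && t.simple
  | .ite _ s t => s.simple && t.simple
  | .forIn .. => false
  | .clear _ => false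
  | _ => true

/-- An upper bound for the running time of a program without loops. -/
def Stmt.bound : Stmt → ℕ
  | .skip => 0
  | .seq s t => s.bound + t.bound
  | .ite c s t => c.cost + s.bound + t.bound
  | .setCtr _ e => e.cost + 1
  | _ => 1

/-- The bound adds up both branches of a conditional, which loses only a constant and makes it
computable by `rfl` for concrete code. -/
theorem time_simple (τ : Traversal V) (σ : State V) (s : Stmt) (h : s.simple = true) :
    (s.run τ σ).time ≤ σ.time + s.bound := by
  induction s generalizing σ with
  | skip => exact Nat.le_refl _
  | seq s t hs ht =>
    simp only [Stmt.simple, Bool.and_eq_true] at h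
    have h1 := hs σ h.1
    have h2 := ht (s.run τ σ) h.2
    simp only [Stmt.run, Stmt.bound]
    omega
  | ite c s t hs ht =>
    simp only [Stmt.simple, Bool.and_eq_true] at h
    have h1 := hs (σ.charge c.cost) h.1
    have h2 := ht (σ.charge c.cost) h.2
    simp only [State.time_charge] at h1 h2
    simp only [Stmt.run, Stmt.bound]
    split <;> omega
  | forIn _ _ _ _ => simp [Stmt.simple] at h
  | clear _ => simp [Stmt.simple] at h
  | insert d k x => simp only [Stmt.run, Stmt.bound]; split <;> simp
  | delete d k => simp only [Stmt.run, Stmt.bound]; split <;> simp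
  | emit r => simp only [Stmt.run, Stmt.bound]; split <;> simp
  | _ => exact Nat.le_refl _

/-! ### Adding an edge to a matching -/

/-- Match the vertex in register `o` to the first free vertex among its left neighbours. -/
def tryMatch (r o : Reg) : Stmt :=
  forWhile r (.fam .NL o) (.not (.flag .done)) [
    when (isFree r .u) [addEdge .u r o, .setFlag .done true]]

/-- The vertex `w` may be matched in the matching of `u`. -/
def State.Free (σ : State V) (u w : V) : Prop :=
  σ.fam .ML u w = none ∧ σ.fam .NL u w = none ∧ w ≠ u

theorem eval_isFree {σ : State V} {r o : Reg} {u w : V} (ho : σ.reg o = some u)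
    (hr : σ.reg r = some w) : (isFree r o).eval σ = true ↔ σ.Free u w := by
  simp [isFree, ho, hr, State.Free]

/-- The flag `done` ends the loop directly after an insertion, so at most one edge is added. As long
as the flag is down the matchings are unchanged, and freedom may be judged in the initial state. -/
theorem tryMatch_spec {τ : Traversal V} {σ : State V} (r o : Reg) (hr : r ≠ .u) (hro : r ≠ o)
    {u x : V} (hu : σ.reg .u = some u) (ho : σ.reg o = some x) (hdone : σ.flag .done = false) :
    (((∀ w ∈ keys (σ.fam .NL x), ¬ σ.Free u w) ∧ ((tryMatch r o).run τ σ).fam = σ.fam) ∨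
      ∃ w ∈ keys (σ.fam .NL x), σ.Free u w ∧
        ((tryMatch r o).run τ σ).fam .ML u = Function.update (σ.fam .ML u) w (some x) ∧
        ((tryMatch r o).run τ σ).fam .MR u = Function.update (σ.fam .MR u) x (some w)) ∧
    ((tryMatch r o).run τ σ).time ≤ σ.time + 15 * (keys (σ.fam .NL x)).card + 1 := by
  have hK : σ.get (.fam .NL o) = σ.fam .NL x := by simp [ho]
  obtain ⟨⟨D, hD, h1, h2⟩, h3⟩ := forIn_spec (τ := τ) (r := r) (d := .fam .NL o)
    (c := .not (.flag .done)) (body := block [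
      when (isFree r .u) [addEdge .u r o, .setFlag .done true]]) (σ := σ)
    (fun D σ' => (σ'.flag .done = false ∧ σ'.fam = σ.fam ∧ ∀ w ∈ D, ¬ σ.Free u w) ∨
      (σ'.flag .done = true ∧ ∃ w ∈ keys (σ.fam .NL x), σ.Free u w ∧
        σ'.fam .ML u = Function.update (σ.fam .ML u) w (some x) ∧
        σ'.fam .MR u = Function.update (σ.fam .MR u) x (some w))) (fun _ => 11)
    (fun _ _ _ _ _ _ h => h) (.inl ⟨hdone, rfl, by simp⟩) (by
      intro D w σ' hI hF hD hw hwD hreg hc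
      refine ⟨?_, time_simple τ σ' _ rfl⟩
      simp only [Cond.eval, Bool.not_eq_true'] at hc
      rcases hI with ⟨h1, h2, h3⟩ | ⟨h1, _⟩
      · have hu' : σ'.reg .u = some u := by
          rw [hF.reg .u (by simp [Stmt.writes, Reg.touches, block, when, addEdge, Ref.touches, hr]),
            hu]
        have ho' : σ'.reg o = some x := by
          rw [hF.reg o (by simp [Stmt.writes, Reg.touches, block, when, addEdge, Ref.touches, hro]),
            ho]
        have hfree := eval_isFree hu' hreg
        have hfree' : σ'.Free u w ↔ σ.Free u w := by simp [State.Free, h2]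
        by_cases hw' : σ.Free u w
        · right
          have hcond : (isFree r .u).eval σ' = true := hfree.2 (hfree'.2 hw')
          rw [hK] at hw
          refine ⟨by simp [hcond], w, hw, hw', ?_, ?_⟩
          · simp [hcond, addEdge, hu', ho', hreg, h2]
          · simp [hcond, addEdge, hu', ho', hreg, h2]
        · left
          have hcond : (isFree r .u).eval σ' = false := by
            rw [← Bool.not_eq_true, hfree, hfree']; exact hw'
          simp only [run_block_cons, run_block_nil, run_when, hcond, Bool.false_eq_true, if_false]
          refine ⟨h1, h2, fun y hy => ?_⟩
          rcases Finset.mem_insert.1 hy with rfl | hy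
          · exact hw'
          · exact h3 y hy
      · simp [hc] at h1)
  rw [hK] at hD h2 h3
  refine ⟨?_, ?_⟩
  · rcases h2 with rfl | h2
    · rcases h1 with h1 | h1
      · exact .inl ⟨h1.2.2, h1.2.1⟩
      · exact .inr h1.2
    · rcases h1 with h1 | h1
      · simp [h1.1] at h2
      · exact .inr h1.2
  -- Each key costs 11 for the body, 3 for the iteration and its guard, and 1 for the private copy.
  · refine h3.trans ?_
    simp only [Cond.cost, Finset.sum_const, smul_eq_mul]
    omega

end

section
variable {V : Type u} [Fintype V] [DecidableEq V]

/-! ### The auxiliary digraph -/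

/-- Only vertices listed in `auxVerts` can have nonempty tables in this family. Clearing those keeps
the cost in terms of `p`, whereas clearing all tables would cost time proportional to the number of
vertices. -/
theorem clearAux_spec {τ : Traversal V} {σ : State V} {q : ℕ}
    (h : ∀ x ∉ keys (σ.tab .auxVerts), σ.fam .aux x = fun _ => none)
    (hq : ∀ x, (keys (σ.fam .aux x)).card ≤ q) :
    (∀ x, ((forAll .b (.tab .auxVerts) [.clear (.fam .aux .b)]).run τ σ).fam .aux x =
      fun _ => none) ∧
    ((forAll .b (.tab .auxVerts) [.clear (.fam .aux .b)]).run τ σ).time ≤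
      σ.time + (keys (σ.tab .auxVerts)).card * (q + 4) + 1 := by
  obtain ⟨h1, h2⟩ := forAll_spec (τ := τ) (r := .b) (d := .tab .auxVerts)
    (l := [.clear (.fam .aux .b)]) (σ := σ)
    (fun D σ' => ∀ x, (x ∈ D → σ'.fam .aux x = fun _ => none) ∧
      (x ∉ D → σ'.fam .aux x = σ.fam .aux x)) (fun _ => q + 1)
    (fun _ _ _ _ _ _ h => h) (fun x => by simp) (by
      intro D x σ' hI _ hD hx hxD hr
      constructor
      · intro y
        have := hI y
        by_cases hy : y = x
        · subst hy; simp [hr]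
        · simpa [hr, hy] using hI y
      · simpa [hr, (hI x).2 hxD] using hq x)
  refine ⟨fun x => ?_, ?_⟩
  · by_cases hx : x ∈ keys (σ.get (.tab .auxVerts))
    · exact (h1 x).1 hx
    · rw [(h1 x).2 hx]; exact h x hx
  · simpa [Finset.sum_const, add_assoc] using h2

theorem copyKeys_spec {τ : Traversal V} {σ : State V} (r : Reg) (d : Ref) (t : Tab) :
    keys (((forAll r d [insertSet (.tab t) r]).run τ σ).tab t) =
      keys (σ.tab t) ∪ keys (σ.get d) ∧
    ((forAll r d [insertSet (.tab t) r]).run τ σ).time ≤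
      σ.time + 4 * (keys (σ.get d)).card + 1 := by
  obtain ⟨h1, h2⟩ := forAll_spec (τ := τ) (r := r) (d := d)
    (l := [insertSet (.tab t) r]) (σ := σ)
    (fun D σ' => keys (σ'.tab t) = keys (σ.tab t) ∪ D) (fun _ => 1)
    (fun _ _ _ _ _ _ h => h) (by simp) (by
      intro D x σ' hI _ hD hx hxD hr
      constructor
      · simp [hr, hI]
      · simp [hr])
  refine ⟨h1, h2.trans ?_⟩
  simp only [Finset.sum_const, smul_eq_mul]; omega

/-- The instructions that handle a pair of a neighbour outside `L` and a matched vertex of `L`. -/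
def auxPair : List Stmt := [
  .lookup .cur (.fam .MR .a) .b,
  .ite (.eq .cur .c)
    (insertSet (.fam .aux .b) .c)
    (when (.mem .c (.fam .adj .b)) [
      .ite (.mem .b (.fam .MR .a))
        (insertSet (.fam .aux .c) .b)
        (block [insertSet (.tab .T) .c, .insert (.tab .out) .c .b])])]

/-- The arcs and the set `T` after the pairs in `P` have been handled. -/
structure ArcsBuilt (σ : State V) (mr : Table V) (P : V → V → Prop) : Prop where
  arc : ∀ x y, y ∈ keys (σ.fam .aux x) ↔ (P x y ∧ mr x = some y) ∨
    (P y x ∧ mr y ≠ some x ∧ x ∈ keys (σ.fam .adj y) ∧ mr y ≠ none)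
  T : ∀ y, y ∈ keys (σ.tab .T) ↔ ∃ x, P x y ∧ mr x = none ∧ y ∈ keys (σ.fam .adj x)
  out : ∀ y ∈ keys (σ.tab .T), ∃ x, σ.tab .out y = some x ∧ P x y ∧ mr x = none ∧
    y ∈ keys (σ.fam .adj x)
  keys_out : keys (σ.tab .out) = keys (σ.tab .T)

theorem ArcsBuilt.congr {σ : State V} {mr : Table V} {P Q : V → V → Prop}
    (h : ArcsBuilt σ mr P) (hPQ : ∀ x y, P x y ↔ Q x y) : ArcsBuilt σ mr Q := by
  have : P = Q := by funext x y; exact propext (hPQ x y)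
  rwa [← this]

/-- Four cases. A matching edge gives an arc leaving `b`; an unmatched edge at a matched `b` gives
an arc into `b`; an edge at an unmatched `b` makes `c` a target; a non-edge gives nothing. -/
theorem auxPair_spec {τ : Traversal V} {σ : State V} {P : V → V → Prop} {u b c : V}
    (h : ArcsBuilt σ (σ.fam .MR u) P) (ha : σ.reg .a = some u) (hb : σ.reg .b = some b)
    (hc : σ.reg .c = some c) :
    ArcsBuilt ((block auxPair).run τ σ) (σ.fam .MR u) fun x y => P x y ∨ (x = b ∧ y = c) := by
  obtain ⟨h1, h2, h3, h4⟩ := h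
  by_cases hm : σ.fam .MR u b = some c
  · have e1 : ((block auxPair).run τ σ).fam = Function.update σ.fam .aux
        (Function.update (σ.fam .aux) b (Function.update (σ.fam .aux b) c (some c))) := by
      simp [auxPair, ha, hb, hc, hm]
    have e2 : ((block auxPair).run τ σ).tab = σ.tab := by
      simp [auxPair, ha, hb, hc, hm]
    have e3 : ∀ x, ((block auxPair).run τ σ).fam .aux x =
      if x = b then Function.update (σ.fam .aux b) c (some c) else σ.fam .aux x := by
      intro x; rw [e1]; simp [Function.update_apply]
    have e4 : ((block auxPair).run τ σ).fam .adj = σ.fam .adj := by rw [e1]; simp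
    constructor
    · intro x y
      rw [e3, e4]
      split
      · rename_i hx
        subst hx
        rw [keys_update_some, Finset.mem_insert, h1]
        grind
      · rw [h1]; grind
    · intro y; rw [e2, e4, h2]; grind
    · intro y hy; rw [e2] at hy ⊢; rw [e4]; grind
    · rw [e2]; exact h4
  by_cases hadj : c ∈ keys (σ.fam .adj b)
  · have hadj' := mem_keys.1 hadj
    cases hmb : σ.fam .MR u b with
    | some z =>
      have hz : z ≠ c := fun e => hm (by rw [hmb, e])
      have e1 : ((block auxPair).run τ σ).fam = Function.update σ.fam .aux
          (Function.update (σ.fam .aux) c (Function.update (σ.fam .aux c) b (some b))) := by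
        simp [auxPair, ha, hb, hc, hmb, hz, hadj']
      have e2 : ((block auxPair).run τ σ).tab = σ.tab := by
        simp [auxPair, ha, hb, hc, hmb, hz, hadj']
      have e3 : ∀ x, ((block auxPair).run τ σ).fam .aux x =
        if x = c then Function.update (σ.fam .aux c) b (some b) else σ.fam .aux x := by
        intro x; rw [e1]; simp [Function.update_apply]
      have e4 : ((block auxPair).run τ σ).fam .adj = σ.fam .adj := by rw [e1]; simp
      constructor
      · intro x y
        rw [e3, e4]
        split
        · rename_i hx
          subst hx
          rw [keys_update_some, Finset.mem_insert, h1]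
          grind
        · rw [h1]; grind
      · intro y; rw [e2, e4, h2]; grind
      · intro y hy; rw [e2] at hy ⊢; rw [e4]; grind
      · rw [e2]; exact h4
    | none =>
      have e1 : ((block auxPair).run τ σ).fam = σ.fam := by
        simp [auxPair, ha, hb, hc, hmb, hadj']
      have e2 : ((block auxPair).run τ σ).tab .T = Function.update (σ.tab .T) c (some c) := by
        simp [auxPair, ha, hb, hc, hmb, hadj']
      have e3 : ((block auxPair).run τ σ).tab .out = Function.update (σ.tab .out) c (some b) := by
        simp [auxPair, ha, hb, hc, hmb, hadj']
      constructor
      · intro x y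
        rw [e1, h1]; grind
      · intro y
        rw [e1, e2, keys_update_some, Finset.mem_insert, h2]; grind
      · intro y hy
        rw [e2, keys_update_some, Finset.mem_insert] at hy
        rw [e1, e3]
        by_cases hyc : y = c
        · subst hyc; exact ⟨b, by simp, .inr ⟨rfl, rfl⟩, hmb, hadj⟩
        · rw [Function.update_of_ne hyc]; grind
      · rw [e2, e3, keys_update_some, keys_update_some, h4]
  · have hadj' : σ.fam .adj b c = none := not_mem_keys.1 hadj
    have e1 : ((block auxPair).run τ σ).fam = σ.fam := by
      simp [auxPair, ha, hb, hc, hm, hadj']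
    have e2 : ((block auxPair).run τ σ).tab = σ.tab := by
      simp [auxPair, ha, hb, hc, hm, hadj']
    constructor
    · intro x y; rw [e1, h1]; grind
    · intro y; rw [e1, e2, h2]; grind
    · intro y hy; rw [e2] at hy ⊢; rw [e1]; grind
    · rw [e2]; exact h4

theorem auxRow_spec {τ : Traversal V} {σ : State V} {P : V → V → Prop} {u b : V}
    (h : ArcsBuilt σ (σ.fam .MR u) P) (ha : σ.reg .a = some u) (hb : σ.reg .b = some b) :
    ArcsBuilt ((forAll .c (.fam .ML .a) auxPair).run τ σ) (σ.fam .MR u)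
      (fun x y => P x y ∨ (x = b ∧ y ∈ keys (σ.fam .ML u))) ∧
    ((forAll .c (.fam .ML .a) auxPair).run τ σ).time ≤
      σ.time + 11 * (keys (σ.fam .ML u)).card + 1 := by
  obtain ⟨h1, h2⟩ := forAll_spec (τ := τ) (r := .c) (d := .fam .ML .a)
    (l := auxPair) (σ := σ)
    (fun D σ' => ArcsBuilt σ' (σ.fam .MR u) fun x y => P x y ∨ (x = b ∧ y ∈ D)) (fun _ => 8)
    (fun _ _ _ _ _ _ h => ⟨h.1, h.2, h.3, h.4⟩) (h.congr (by simp)) (by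
      intro D x σ' hI hF hD hx hxD hr
      refine ⟨?_, time_simple τ σ' _ rfl⟩
      have hMR := hF.fam .MR
      have := auxPair_spec (τ := τ) (u := u) (hMR ▸ hI) ((hF.reg .a).trans ha)
        ((hF.reg .b).trans hb) hr
      rw [hMR] at this
      refine this.congr fun y z => ?_
      simp only [Finset.mem_insert]; tauto)
  refine ⟨by simpa [ha] using h1, h2.trans ?_⟩
  simp only [State.get_fam, ha, Finset.sum_const, smul_eq_mul]; omega

/-- Kept as a separate step because two arguments run over this loop: one for its time, one for its
peak memory. -/
theorem auxRows_step {τ : Traversal V} {σ σ' : State V} {u x : V} {D : Finset V}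
    (ha : σ.reg .a = some u)
    (hI : ArcsBuilt σ' (σ.fam .MR u) fun x y => x ∈ D ∧ y ∈ keys (σ.fam .ML u))
    (hF : Frame (forAll .b (.fam .NR .a) [forAll .c (.fam .ML .a) auxPair]) σ σ')
    (hr : σ'.reg .b = some x) :
    ArcsBuilt ((block [forAll .c (.fam .ML .a) auxPair]).run τ σ') (σ.fam .MR u)
      (fun y z => y ∈ insert x D ∧ z ∈ keys (σ.fam .ML u)) ∧
    ((block [forAll .c (.fam .ML .a) auxPair]).run τ σ').time ≤
      σ'.time + (11 * (keys (σ.fam .ML u)).card + 1) := by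
  have hMR := hF.fam .MR
  have hML := hF.fam .ML
  obtain ⟨h1, h2⟩ := auxRow_spec (τ := τ) (u := u) (hMR ▸ hI) ((hF.reg .a).trans ha) hr
  rw [hMR, hML] at h1
  rw [hML] at h2
  refine ⟨h1.congr fun y z => ?_, h2⟩
  simp only [Finset.mem_insert]; tauto

theorem auxRows_spec {τ : Traversal V} {σ : State V} {u : V}
    (h : ArcsBuilt σ (σ.fam .MR u) fun _ _ => False) (ha : σ.reg .a = some u) :
    ArcsBuilt ((forAll .b (.fam .NR .a) [forAll .c (.fam .ML .a) auxPair]).run τ σ)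
      (σ.fam .MR u) (fun x y => x ∈ keys (σ.fam .NR u) ∧ y ∈ keys (σ.fam .ML u)) ∧
    ((forAll .b (.fam .NR .a) [forAll .c (.fam .ML .a) auxPair]).run τ σ).time ≤
      σ.time + (keys (σ.fam .NR u)).card * (11 * (keys (σ.fam .ML u)).card + 4) + 1 := by
  obtain ⟨h1, h2⟩ := forAll_spec (τ := τ) (r := .b) (d := .fam .NR .a)
    (l := [forAll .c (.fam .ML .a) auxPair]) (σ := σ)
    (fun D σ' => ArcsBuilt σ' (σ.fam .MR u) fun x y => x ∈ D ∧ y ∈ keys (σ.fam .ML u))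
    (fun _ => 11 * (keys (σ.fam .ML u)).card + 1)
    (fun _ _ _ _ _ _ h => ⟨h.1, h.2, h.3, h.4⟩) (h.congr (by simp))
    (fun D x σ' hI hF hD hx hxD hr => auxRows_step ha hI hF hr)
  refine ⟨by simpa [ha] using h1, h2.trans ?_⟩
  simp [ha, Finset.sum_const]

/-- The set `S` after the pairs in `P` have been handled. -/
structure SourcesBuilt (σ₀ σ : State V) (u : V) (P : V → V → Prop) : Prop where
  S : ∀ x, x ∈ keys (σ.tab .S) ↔ ∃ y, P x y ∧ σ₀.Free u y
  out : ∀ x ∈ keys (σ.tab .S), ∃ y, σ.tab .out x = some y ∧ P x y ∧ σ₀.Free u y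
  out' : ∀ x ∉ keys (σ.tab .S), σ.tab .out x = σ₀.tab .out x

theorem SourcesBuilt.congr {σ₀ σ : State V} {u : V} {P Q : V → V → Prop}
    (h : SourcesBuilt σ₀ σ u P) (hPQ : ∀ x y, P x y ↔ Q x y) : SourcesBuilt σ₀ σ u Q := by
  have : P = Q := by funext x y; exact propext (hPQ x y)
  rwa [← this]

def sourcePair : List Stmt :=
  [when (isFree .c .a) [insertSet (.tab .S) .b, .insert (.tab .out) .b .c]]

theorem sourcePair_spec {τ : Traversal V} {σ₀ σ : State V} {P : V → V → Prop} {u b c : V}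
    (h : SourcesBuilt σ₀ σ u P) (ha : σ.reg .a = some u) (hb : σ.reg .b = some b)
    (hc : σ.reg .c = some c) (hfam : σ.fam = σ₀.fam) :
    SourcesBuilt σ₀ ((block sourcePair).run τ σ) u fun x y => P x y ∨ (x = b ∧ y = c) := by
  have hfree := eval_isFree ha hc
  have hfree' : σ.Free u c ↔ σ₀.Free u c := by simp [State.Free, hfam]
  rw [hfree'] at hfree
  obtain ⟨h1, h2, h3⟩ := h
  by_cases hf : σ₀.Free u c
  · have hcond := hfree.2 hf
    have e1 : ((block sourcePair).run τ σ).tab .S = Function.update (σ.tab .S) b (some b) := by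
      simp [sourcePair, hcond, hb, hc]
    have e2 : ((block sourcePair).run τ σ).tab .out = Function.update (σ.tab .out) b (some c) := by
      simp [sourcePair, hcond, hb, hc]
    constructor
    · intro x; rw [e1, keys_update_some, Finset.mem_insert, h1]; grind
    · intro x hx
      rw [e1, keys_update_some, Finset.mem_insert] at hx
      rw [e2]
      by_cases hxb : x = b
      · subst hxb; exact ⟨c, by simp, .inr ⟨rfl, rfl⟩, hf⟩
      · rw [Function.update_of_ne hxb]
        obtain ⟨y, hy, hy', hy''⟩ := h2 x (hx.resolve_left hxb)
        exact ⟨y, hy, .inl hy', hy''⟩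
    · intro x hx
      rw [e1, keys_update_some, Finset.mem_insert, not_or] at hx
      rw [e2, Function.update_of_ne hx.1, h3 x hx.2]
  · have hcond : (isFree .c .a).eval σ = false := by rw [← Bool.not_eq_true, hfree]; exact hf
    have e1 : ((block sourcePair).run τ σ).tab = σ.tab := by
      simp [sourcePair, hcond]
    constructor
    · intro x; rw [e1, h1]; grind
    · intro x hx
      rw [e1] at hx ⊢
      obtain ⟨y, hy, hy', hy''⟩ := h2 x hx
      exact ⟨y, hy, .inl hy', hy''⟩
    · intro x hx; rw [e1] at hx ⊢; exact h3 x hx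

/-- Sources and targets share the table `out`. The clause `out'` of the result ensures that the
entries written earlier for the targets survive at every key that is not a source. -/
theorem sources_spec {τ : Traversal V} {σ : State V} {u : V} {q : ℕ}
    (hS : keys (σ.tab .S) = ∅) (ha : σ.reg .a = some u)
    (hq : ∀ x ∈ keys (σ.fam .MR u), (keys (σ.fam .NL x)).card ≤ q) :
    SourcesBuilt σ ((forAll .b (.fam .MR .a) [forAll .c (.fam .NL .b) sourcePair]).run τ σ) u
      (fun x y => x ∈ keys (σ.fam .MR u) ∧ y ∈ keys (σ.fam .NL x)) ∧
    ((forAll .b (.fam .MR .a) [forAll .c (.fam .NL .b) sourcePair]).run τ σ).time ≤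
      σ.time + (keys (σ.fam .MR u)).card * (13 * q + 4) + 1 := by
  obtain ⟨h1, h2⟩ := forAll_spec (τ := τ) (r := .b) (d := .fam .MR .a)
    (l := [forAll .c (.fam .NL .b) sourcePair]) (σ := σ)
    (fun D σ' => SourcesBuilt σ σ' u fun x y => x ∈ D ∧ y ∈ keys (σ.fam .NL x))
    (fun _ => 13 * q + 1)
    (fun _ _ _ _ _ _ h => ⟨h.1, h.2, h.3⟩) (⟨by simp [hS], by simp [hS], by simp⟩)
    (by
      intro D x σ' hI hF hD hx hxD hr
      have hNL := hF.fam .NL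
      obtain ⟨h3, h4⟩ := forAll_spec (τ := τ) (r := .c) (d := .fam .NL .b)
        (l := sourcePair) (σ := σ')
        (fun E σ'' => SourcesBuilt σ σ'' u fun y z => (y ∈ D ∧ z ∈ keys (σ.fam .NL y)) ∨
          (y = x ∧ z ∈ E))
        (fun _ => 10) (fun _ _ _ _ _ _ h => ⟨h.1, h.2, h.3⟩) (hI.congr (by simp)) (by
          intro E y σ'' hI' hF' _ _ _ hr'
          refine ⟨?_, time_simple τ σ'' _ rfl⟩
          have hfam : σ''.fam = σ.fam := by
            funext f
            rw [hF'.fam f (by cases f <;> rfl), hF.fam f (by cases f <;> rfl)]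
          refine (sourcePair_spec hI' ((hF'.reg .a).trans ((hF.reg .a).trans ha))
            ((hF'.reg .b).trans hr) hr' hfam).congr fun y' z => ?_
          simp only [Finset.mem_insert]; tauto)
      have hget : σ'.get (.fam .NL .b) = σ.fam .NL x := by simp [hr, hNL]
      rw [hget] at h3 h4
      constructor
      · refine h3.congr fun y z => ?_
        simp only [Finset.mem_insert]
        constructor
        · rintro (h | ⟨rfl, h⟩)
          exacts [⟨.inr h.1, h.2⟩, ⟨.inl rfl, h⟩]
        · rintro ⟨rfl | h, h'⟩
          exacts [.inr ⟨rfl, h'⟩, .inl ⟨h, h'⟩]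
      · have := hq x (by simpa [ha] using hx)
        simp only [Finset.sum_const, smul_eq_mul] at h4
        refine h4.trans ?_
        omega)
  refine ⟨by simpa [ha] using h1, h2.trans ?_⟩
  simp [ha, Finset.sum_const]

end

section
variable {V : Type u} [Fintype V] [DecidableEq V]

/-! ### The search -/

/-- Following `par` from `x` leads to `S` along the vertices of the list. -/
inductive Trace (par : Table V) (S : Finset V) : V → List V → Prop
  | base {s : V} : s ∈ S → par s = none → Trace par S s [s]
  | step {x y : V} {l : List V} : par x = some y → Trace par S y l → x ∉ l → Trace par S x (x :: l)

theorem Trace.mono {par par' : Table V} {S : Finset V} {x : V} {l : List V} (h : Trace par S x l)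
    (hpar : ∀ y ∈ l, par' y = par y) : Trace par' S x l := by
  induction h with
  | base hs hp => exact .base hs ((hpar _ (by simp)).trans hp)
  | step hxy _ hx ih =>
    exact .step ((hpar _ (by simp)).trans hxy) (ih fun y hy => hpar y (by simp [hy])) hx

theorem Trace.mem {par : Table V} {S : Finset V} {x : V} {l : List V} (h : Trace par S x l) :
    x ∈ l := by
  cases h <;> simp

/-- The invariant of the search; `F` is the frontier, `Z` is the set of visited vertices. -/
structure Search (A S : Finset V) (N : V → Finset V) (F Z : Finset V) (par : Table V) : Prop where
  frontier : F ⊆ Z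
  sub : Z ⊆ A
  source : S ⊆ Z
  trace : ∀ x ∈ Z, ∃ l, Trace par S x l ∧ ∀ y ∈ l, y ∈ Z
  arc : ∀ x y, par x = some y → x ∈ N y ∧ x ∈ Z ∧ y ∈ Z
  origin : ∀ x ∈ Z, x ∈ S ∨ ∃ y ∈ Z, x ∈ N y

def State.Search (σ : State V) (A S : Finset V) (N : V → Finset V) : Prop :=
  TwoAdm.Search A S N (keys (σ.tab .frontier)) (keys (σ.tab .visited)) (σ.tab .parent)

def visitStep : List Stmt := [
  when (.not (.mem .c (.tab .visited))) [
    insertSet (.tab .visited) .c,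
    insertSet (.tab .frontier) .c,
    .insert (.tab .parent) .c .b]]

/-- A new vertex enters the visited set and the frontier together, so the explored vertices, those
visited but no longer in the frontier, stay the same. Old traces run inside the visited set and
hence do not notice the new parent entry. -/
theorem visitStep_spec {τ : Traversal V} {σ : State V} {A S : Finset V} {N : V → Finset V}
    {b c : V} (h : σ.Search A S N) (hN : c ∈ N b) (hA : N b ⊆ A)
    (hbZ : b ∈ keys (σ.tab .visited)) (hb : σ.reg .b = some b) (hc : σ.reg .c = some c) :
    ((block visitStep).run τ σ).Search A S N ∧
    c ∈ keys (((block visitStep).run τ σ).tab .visited) ∧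
    keys (σ.tab .visited) ⊆ keys (((block visitStep).run τ σ).tab .visited) ∧
    keys (((block visitStep).run τ σ).tab .visited) \
      keys (((block visitStep).run τ σ).tab .frontier) =
      keys (σ.tab .visited) \ keys (σ.tab .frontier) := by
  by_cases hv : c ∈ keys (σ.tab .visited)
  · have hv' := mem_keys.1 hv
    have e : ((block visitStep).run τ σ).tab = σ.tab := by
      simp [visitStep, hc, hv']
    rw [State.Search, e]
    exact ⟨h, hv, subset_rfl, rfl⟩
  · have hv' : σ.tab .visited c = none := not_mem_keys.1 hv
    have e1 : ((block visitStep).run τ σ).tab .visited =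
        Function.update (σ.tab .visited) c (some c) := by
      simp [visitStep, hb, hc, hv']
    have e2 : ((block visitStep).run τ σ).tab .frontier =
        Function.update (σ.tab .frontier) c (some c) := by
      simp [visitStep, hb, hc, hv']
    have e3 : ((block visitStep).run τ σ).tab .parent =
        Function.update (σ.tab .parent) c (some b) := by
      simp [visitStep, hb, hc, hv']
    rw [State.Search, e1, e2, e3]
    simp only [keys_update_some]
    refine ⟨⟨?_, ?_, ?_, ?_, ?_, ?_⟩, by simp, Finset.subset_insert _ _, ?_⟩
    · exact Finset.insert_subset_insert _ h.frontier
    · exact Finset.insert_subset (hA hN) h.sub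
    · exact h.source.trans (Finset.subset_insert _ _)
    · have key : ∀ x ∈ keys (σ.tab .visited), ∃ l,
          Trace (Function.update (σ.tab .parent) c (some b)) S x l ∧
          ∀ y ∈ l, y ∈ keys (σ.tab .visited) := by
        intro x hx
        obtain ⟨l, hl, hl'⟩ := h.trace x hx
        refine ⟨l, hl.mono fun y hy => Function.update_of_ne ?_ _ _, hl'⟩
        rintro rfl
        exact hv (hl' _ hy)
      intro x hx
      rcases Finset.mem_insert.1 hx with rfl | hx
      · obtain ⟨l, hl, hl'⟩ := key b hbZ
        refine ⟨x :: l, .step (by simp) hl fun hx => hv (hl' _ hx), ?_⟩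
        intro y hy
        rcases List.mem_cons.1 hy with rfl | hy
        · simp
        · exact Finset.mem_insert_of_mem (hl' y hy)
      · obtain ⟨l, hl, hl'⟩ := key x hx
        exact ⟨l, hl, fun y hy => Finset.mem_insert_of_mem (hl' y hy)⟩
    · intro x y hxy
      by_cases hxc : x = c
      · subst hxc
        obtain rfl : b = y := by simpa using hxy
        exact ⟨hN, by simp, Finset.mem_insert_of_mem hbZ⟩
      · rw [Function.update_of_ne hxc] at hxy
        have := h.arc x y hxy
        exact ⟨this.1, Finset.mem_insert_of_mem this.2.1, Finset.mem_insert_of_mem this.2.2⟩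
    · intro x hx
      rcases Finset.mem_insert.1 hx with rfl | hx
      · exact .inr ⟨b, Finset.mem_insert_of_mem hbZ, hN⟩
      · rcases h.origin x hx with h1 | ⟨y, h1, h2⟩
        · exact .inl h1
        · exact .inr ⟨y, Finset.mem_insert_of_mem h1, h2⟩
    · ext x; simp only [Finset.mem_sdiff, Finset.mem_insert]
      by_cases hxc : x = c
      · simp [hxc, hv]
      · simp [hxc]

def searchBody : List Stmt := [
  .pick .b (.tab .frontier),
  .delete (.tab .frontier) .b,
  .ite (.mem .b (.tab .T))
    (block [.move .t .b, .setFlag .found true])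
    (forAll .c (.fam .aux .b) visitStep)]

theorem Traversal.head?_order (τ : Traversal V) (n : ℕ) {s : Finset V} (h : s.Nonempty) :
    ∃ x ∈ s, (τ.order n s).head? = some x := by
  cases hl : τ.order n s with
  | nil =>
    have := τ.toFinset_eq n s
    rw [hl] at this
    simp [← this] at h
  | cons x l =>
    refine ⟨x, ?_, rfl⟩
    rw [← τ.toFinset_eq n s, hl]; simp

/-- Unless a target is found, exactly the picked vertex becomes explored. Explored vertices are not
targets and have all their out-neighbours visited; their number serves as a clock for the search. -/
theorem searchBody_spec {τ : Traversal V} {σ : State V} {A S : Finset V}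
    (h : σ.Search A S fun x => keys (σ.fam .aux x)) (hne : (keys (σ.tab .frontier)).Nonempty)
    (hA : ∀ x, keys (σ.fam .aux x) ⊆ A)
    (hE : ∀ x ∈ keys (σ.tab .visited) \ keys (σ.tab .frontier), x ∉ keys (σ.tab .T) ∧
      keys (σ.fam .aux x) ⊆ keys (σ.tab .visited)) (hfound : σ.flag .found = false) :
    (((block searchBody).run τ σ).Search A S fun x => keys (σ.fam .aux x)) ∧
    ((((block searchBody).run τ σ).flag .found = true ∧ ∃ t,
        ((block searchBody).run τ σ).reg .t = some t ∧ t ∈ keys (σ.tab .T) ∧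
        t ∈ keys (((block searchBody).run τ σ).tab .visited)) ∨
      (((block searchBody).run τ σ).flag .found = false ∧
        (∀ x ∈ keys (((block searchBody).run τ σ).tab .visited) \
            keys (((block searchBody).run τ σ).tab .frontier), x ∉ keys (σ.tab .T) ∧
          keys (σ.fam .aux x) ⊆ keys (((block searchBody).run τ σ).tab .visited)) ∧
        (keys (σ.tab .visited) \ keys (σ.tab .frontier)).card + 1 ≤
          (keys (((block searchBody).run τ σ).tab .visited) \
            keys (((block searchBody).run τ σ).tab .frontier)).card)) ∧
    ((block searchBody).run τ σ).time ≤ σ.time + 9 * A.card + 6 := by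
  obtain ⟨b, hb, hpick⟩ := τ.head?_order σ.time hne
  set σ₁ := (Stmt.delete (.tab .frontier) .b).run τ ((Stmt.pick .b (.tab .frontier)).run τ σ)
    with hσ₁
  have hrun : (Stmt.pick .b (.tab .frontier)).run τ σ = (σ.setReg .b (some b)).charge 1 := by
    simp only [Stmt.run, State.get_tab, hpick]
  have hb1 : σ₁.reg .b = some b := by rw [hσ₁, hrun]; simp
  have hfam1 : σ₁.fam = σ.fam := by rw [hσ₁, hrun]; simp
  have hfr1 : keys (σ₁.tab .frontier) = (keys (σ.tab .frontier)).erase b := by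
    rw [hσ₁, hrun]; simp
  have hvis1 : σ₁.tab .visited = σ.tab .visited := by rw [hσ₁, hrun]; simp
  have hpar1 : σ₁.tab .parent = σ.tab .parent := by rw [hσ₁, hrun]; simp
  have hT1 : σ₁.tab .T = σ.tab .T := by rw [hσ₁, hrun]; simp
  have hfl1 : σ₁.flag = σ.flag := by rw [hσ₁, hrun]; simp
  have ht1 : σ₁.time = σ.time + 2 := by rw [hσ₁, hrun]; simp
  have hbZ : b ∈ keys (σ.tab .visited) := h.frontier hb
  have hS1 : σ₁.Search A S fun x => keys (σ.fam .aux x) := by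
    rw [State.Search, hfr1, hvis1, hpar1]
    exact { h with frontier := (Finset.erase_subset _ _).trans h.frontier }
  have hsd : keys (σ.tab .visited) \ (keys (σ.tab .frontier)).erase b =
      insert b (keys (σ.tab .visited) \ keys (σ.tab .frontier)) := by
    ext x; simp only [Finset.mem_sdiff, Finset.mem_erase, Finset.mem_insert]
    by_cases hxb : x = b
    · simp [hxb, hbZ]
    · simp [hxb]
  have hcard : (keys (σ.tab .visited) \ (keys (σ.tab .frontier)).erase b).card =
      (keys (σ.tab .visited) \ keys (σ.tab .frontier)).card + 1 := by
    rw [hsd, Finset.card_insert_of_notMem]; simp [hb]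
  have hstep : (block searchBody).run τ σ = (Stmt.ite (.mem .b (.tab .T))
      (block [.move .t .b, .setFlag .found true])
      (forAll .c (.fam .aux .b) visitStep)).run τ σ₁ := rfl
  rw [hstep]
  by_cases hbT : b ∈ keys (σ.tab .T)
  · have hbT' := mem_keys.1 hbT
    have hcond : (Cond.mem .b (.tab .T)).eval σ₁ = true := by simp [hb1, hT1, hbT']
    rw [run_ite, hcond]
    simp only [if_true]
    refine ⟨?_, .inl ⟨by simp, b, by simp [hb1], hbT, ?_⟩, ?_⟩
    · exact ⟨hS1.1, hS1.2, hS1.3, hS1.4, hS1.5, hS1.6⟩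
    · simpa [hvis1] using hbZ
    · simp [ht1]; omega
  · have hbT' : σ.tab .T b = none := not_mem_keys.1 hbT
    have hcond : (Cond.mem .b (.tab .T)).eval σ₁ = false := by simp [hb1, hT1, hbT']
    rw [run_ite, hcond]
    simp only [Bool.false_eq_true, if_false]
    set σ₂ := σ₁.charge (Cond.mem .b (.tab .T)).cost with hσ₂
    have hget : σ₂.get (.fam .aux .b) = σ.fam .aux b := by simp [hσ₂, hb1, hfam1]
    obtain ⟨⟨h3, h4, h5, h6⟩, h7⟩ := forAll_spec (τ := τ) (r := .c) (d := .fam .aux .b)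
      (l := visitStep) (σ := σ₂)
      (fun D σ' => (σ'.Search A S fun x => keys (σ.fam .aux x)) ∧
        D ⊆ keys (σ'.tab .visited) ∧ keys (σ.tab .visited) ⊆ keys (σ'.tab .visited) ∧
        keys (σ'.tab .visited) \ keys (σ'.tab .frontier) =
          keys (σ.tab .visited) \ (keys (σ.tab .frontier)).erase b)
      (fun _ => 5) (fun _ _ _ _ _ _ h => h)
      (by
        refine ⟨hS1, by simp, ?_, ?_⟩
        · change _ ⊆ keys (σ₁.tab .visited); rw [hvis1]
        · change keys (σ₁.tab .visited) \ keys (σ₁.tab .frontier) = _; rw [hvis1, hfr1])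
      (by
        rintro D c σ' ⟨h1, h2, h3, h4⟩ hF hD hc hcD hr
        refine ⟨?_, time_simple τ σ' _ rfl⟩
        rw [hget] at hc
        obtain ⟨h5, h6, h7, h8⟩ := visitStep_spec (τ := τ) (b := b) h1 hc (hA b) (h3 hbZ)
          ((hF.reg .b).trans hb1) hr
        exact ⟨h5, Finset.insert_subset h6 (h2.trans h7), h3.trans h7, h8.trans h4⟩)
    rw [hget] at h4 h7
    have hfl : ((forAll .c (.fam .aux .b) visitStep).run τ σ₂).flag .found = false := by
      rw [(frame_run τ (forAll .c (.fam .aux .b) visitStep) σ₂).flag .found]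
      change σ₁.flag .found = false
      rw [hfl1, hfound]
    refine ⟨h3, .inr ⟨hfl, ?_, ?_⟩, ?_⟩
    · intro x hx
      rw [h6, hsd] at hx
      rcases Finset.mem_insert.1 hx with rfl | hx
      · exact ⟨hbT, h4⟩
      · exact ⟨(hE x hx).1, (hE x hx).2.trans h5⟩
    · rw [h6, hcard]
    · refine h7.trans ?_
      have h8 := Finset.card_le_card (hA b)
      have h9 : σ₂.time = σ₁.time + 1 := rfl
      simp only [Finset.sum_const, smul_eq_mul]
      omega

/-- The result of the search. -/
structure SearchResult (σ : State V) (A S : Finset V) (N : V → Finset V) (T : Finset V) : Prop where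
  search : Search A S N (keys (σ.tab .frontier)) (keys (σ.tab .visited)) (σ.tab .parent)
  found : σ.flag .found = true → ∃ t, σ.reg .t = some t ∧ t ∈ T ∧ t ∈ keys (σ.tab .visited)
  not_found : σ.flag .found = false → ∀ x ∈ keys (σ.tab .visited), x ∉ T ∧
    N x ⊆ keys (σ.tab .visited)

def searchGuard : Cond := .and (.not (.flag .found)) (.not (.isEmpty (.tab .frontier)))

/-- The loop over `auxVerts` replaces an unbounded loop. Each iteration that does not find a target
explores a new vertex of `A`, so `A.card` iterations suffice. -/
theorem searchLoop_spec {τ : Traversal V} {σ : State V} {S : Finset V}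
    (hS : S ⊆ keys (σ.tab .auxVerts))
    (hA : ∀ x, keys (σ.fam .aux x) ⊆ keys (σ.tab .auxVerts))
    (hfr : keys (σ.tab .frontier) = S) (hvis : keys (σ.tab .visited) = S)
    (hpar : keys (σ.tab .parent) = ∅) (hfound : σ.flag .found = false) :
    SearchResult ((forWhile .iter (.tab .auxVerts) searchGuard searchBody).run τ σ)
      (keys (σ.tab .auxVerts)) S (fun x => keys (σ.fam .aux x)) (keys (σ.tab .T)) ∧
    ((forWhile .iter (.tab .auxVerts) searchGuard searchBody).run τ σ).time ≤
      σ.time + (keys (σ.tab .auxVerts)).card * (9 * (keys (σ.tab .auxVerts)).card + 13) + 1 := by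
  have hpar' : ∀ x, σ.tab .parent x = none := fun x => not_mem_keys.1 (by simp [hpar])
  set A := keys (σ.tab .auxVerts) with hAdef
  obtain ⟨⟨D, hD, ⟨h1, h2⟩, h3⟩, h4⟩ := forIn_spec (τ := τ) (r := .iter) (d := .tab .auxVerts)
    (c := searchGuard) (body := block searchBody) (σ := σ)
    (fun D σ' => (σ'.Search A S fun x => keys (σ.fam .aux x)) ∧
      ((σ'.flag .found = true ∧ ∃ t,
        σ'.reg .t = some t ∧ t ∈ keys (σ.tab .T) ∧ t ∈ keys (σ'.tab .visited)) ∨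
      (σ'.flag .found = false ∧
        (∀ x ∈ keys (σ'.tab .visited) \ keys (σ'.tab .frontier), x ∉ keys (σ.tab .T) ∧
          keys (σ.fam .aux x) ⊆ keys (σ'.tab .visited)) ∧
        D.card ≤ (keys (σ'.tab .visited) \ keys (σ'.tab .frontier)).card)))
    (fun _ => 9 * A.card + 6) (fun _ _ _ _ _ _ h => h)
    (by
      refine ⟨⟨?_, ?_, ?_, ?_, ?_, ?_⟩, .inr ⟨hfound, ?_, ?_⟩⟩
      · rw [hfr, hvis]
      · rw [hvis]; exact hS
      · rw [hvis]
      · intro x hx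
        rw [hvis] at hx
        exact ⟨[x], .base hx (hpar' x), by simpa [hvis] using hx⟩
      · intro x y hxy; simp [hpar'] at hxy
      · intro x hx; rw [hvis] at hx; exact .inl hx
      · simp [hfr, hvis]
      · simp)
    (by
      rintro D x σ' ⟨h1, h2⟩ hF hD hx hxD hr hc
      simp only [searchGuard, Cond.eval, Bool.and_eq_true, Bool.not_eq_true',
        decide_eq_false_iff_not, Finset.card_eq_zero, State.get_tab] at hc
      have hfam := hF.fam .aux
      have hT := hF.tab .T
      rcases h2 with h2 | ⟨h2, h3, h4⟩
      · simp [hc.1] at h2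
      obtain ⟨h5, h6, h7⟩ := searchBody_spec (τ := τ) (σ := σ') (A := A) (S := S)
        (by rw [hfam]; exact h1) (Finset.nonempty_iff_ne_empty.2 hc.2)
        (by rw [hfam]; exact hA) (by rw [hfam, hT]; exact h3) h2
      rw [hfam] at h5 h6
      rw [hT] at h6
      refine ⟨⟨h5, h6.imp id fun ⟨a, b, c⟩ => ⟨a, b, ?_⟩⟩, h7.trans (by omega)⟩
      rw [Finset.card_insert_of_notMem hxD]
      omega)
  refine ⟨⟨h1, fun hf => ?_, fun hf => ?_⟩, h4.trans ?_⟩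
  · rcases h2 with h2 | h2
    · exact h2.2
    · exact absurd (hf.symm.trans h2.1) (by simp)
  · rcases h2 with h2 | ⟨_, h2, h5⟩
    · exact absurd (hf.symm.trans h2.1) (by simp)
    · have hempty : keys (((forWhile .iter (.tab .auxVerts) searchGuard searchBody).run τ σ).tab
          .frontier) = ∅ := by
        -- If every key was used up, at least `A.card` vertices are explored, hence all of `A`, and
        -- nothing is left in the frontier. Otherwise the guard failed while `found` was down, which
        -- also means an empty frontier.
        rcases h3 with rfl | h3
        · have h6 : keys (((forWhile .iter (.tab .auxVerts) searchGuard searchBody).run τ σ).tab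
            .visited) \ keys (((forWhile .iter (.tab .auxVerts) searchGuard searchBody).run
            τ σ).tab .frontier) = A := Finset.eq_of_subset_of_card_le
              (Finset.sdiff_subset.trans h1.sub) h5
          rw [Finset.eq_empty_iff_forall_notMem]
          intro x hx
          have hxA := h1.sub (h1.frontier hx)
          rw [← h6] at hxA
          exact (Finset.mem_sdiff.1 hxA).2 hx
        · have h3' := h3
          simp only [searchGuard, Cond.eval, Bool.and_eq_false_iff, Bool.not_eq_false',
            decide_eq_true_eq, Finset.card_eq_zero, State.get_tab] at h3'
          rcases h3' with h3' | h3'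
          · exact absurd (hf.symm.trans h3') (by simp)
          · exact h3'
      intro x hx
      refine h2 x ?_
      change x ∈ keys _ \ keys (((forWhile .iter (.tab .auxVerts) searchGuard searchBody).run τ σ).tab
          .frontier)
      rw [hempty, Finset.sdiff_empty]; exact hx
  · simp only [Finset.sum_const, smul_eq_mul, searchGuard, Cond.cost, State.get_tab, ← hAdef]
    ring_nf
    omega

theorem searchPath_spec {τ : Traversal V} {σ : State V}
    (hS : keys (σ.tab .S) ⊆ keys (σ.tab .auxVerts))
    (hA : ∀ x, keys (σ.fam .aux x) ⊆ keys (σ.tab .auxVerts)) :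
    SearchResult (searchPath.run τ σ) (keys (σ.tab .auxVerts)) (keys (σ.tab .S))
      (fun x => keys (σ.fam .aux x)) (keys (σ.tab .T)) ∧
    (searchPath.run τ σ).time ≤ σ.time + (keys (σ.tab .frontier)).card +
      (keys (σ.tab .visited)).card + (keys (σ.tab .parent)).card +
      (keys (σ.tab .auxVerts)).card * (9 * (keys (σ.tab .auxVerts)).card + 18) + 6 := by
  set σ₁ := (block [.clear (.tab .frontier), .clear (.tab .visited), .clear (.tab .parent),
    .setFlag .found false]).run τ σ with hσ₁
  have hF₁ : Frame _ σ σ₁ := frame_run τ _ σ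
  have ht₁ : σ₁.time = σ.time + (keys (σ.tab .frontier)).card +
      (keys (σ.tab .visited)).card + (keys (σ.tab .parent)).card + 4 := by
    simp [hσ₁]; omega
  have hS₁ := hF₁.tab .S
  obtain ⟨⟨h1, h2⟩, h3⟩ := forAll_spec (τ := τ) (r := .s) (d := .tab .S)
    (l := [insertSet (.tab .visited) .s, insertSet (.tab .frontier) .s]) (σ := σ₁)
    (fun D σ' => keys (σ'.tab .visited) = D ∧ keys (σ'.tab .frontier) = D)
    (fun _ => 2) (fun _ _ _ _ _ _ h => h) (by simp [hσ₁])
    (fun D x σ' h hF _ hx _ hr => ⟨by simp [hr, h.1, h.2], time_simple τ σ' _ rfl⟩)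
  set σ₂ := (forAll .s (.tab .S) [insertSet (.tab .visited) .s,
    insertSet (.tab .frontier) .s]).run τ σ₁ with hσ₂
  have hF₂ : Frame _ σ₁ σ₂ := frame_run τ _ σ₁
  have hget : σ₁.get (.tab .S) = σ.tab .S := hS₁
  rw [hget] at h1 h2 h3
  have hV : σ₂.tab .auxVerts = σ.tab .auxVerts := (hF₂.tab _).trans (hF₁.tab _)
  have hT : σ₂.tab .T = σ.tab .T := (hF₂.tab _).trans (hF₁.tab _)
  have hX : σ₂.fam .aux = σ.fam .aux := (hF₂.fam _).trans (hF₁.fam _)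
  obtain ⟨h4, h5⟩ := searchLoop_spec (τ := τ) (σ := σ₂) (S := keys (σ.tab .S))
    (by rw [hV]; exact hS) (by rw [hV, hX]; exact hA) h2 h1
    (by rw [hF₂.tab .parent]; simp [hσ₁]) (by rw [hF₂.flag .found]; simp [hσ₁])
  rw [hV, hT, hX] at h4
  rw [hV] at h5
  refine ⟨h4, h5.trans ?_⟩
  have h6 := Finset.card_le_card hS
  simp only [Finset.sum_const, smul_eq_mul] at h3
  ring_nf at h3 h5 ⊢
  omega

end

section
variable {V : Type u} [Fintype V] [DecidableEq V]

/-! ### Alternating paths -/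

variable {G : SimpleGraph V} [DecidableRel G.Adj] {L A S : Finset V} {u t o : V}
  {ml mr par out : Table V}

variable (G) in
/-- The situation after a successful search for an augmenting path that ends in `t`. -/
structure AltPath (L : Finset V) (u : V) (ml mr par : Table V) (S : Finset V) (out : Table V)
    (t o : V) : Prop where
  mat : Mat G L u ml mr
  arc : ∀ x y, par x = some y → mr y = some x ∨
    (ml y ≠ none ∧ mr x ≠ none ∧ mr x ≠ some y ∧ G.Adj x y)
  target : ml t ≠ none
  adj_o : G.Adj u o
  o_notMem : o ∉ L
  mr_o : mr o = none
  adj_ot : G.Adj o t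
  source : ∀ s ∈ S, mr s ≠ none ∧ ∃ y, out s = some y ∧ G.Adj s y ∧ y ∈ L ∧ y ≠ u ∧
    ¬ G.Adj u y ∧ ml y = none

namespace PreMat

variable {X : Set V}

theorem mem_of_ne_none {y : V} (h : PreMat G L u X ml mr) (hy : ml y ≠ none) : y ∈ L := by
  obtain ⟨x, hx⟩ := Option.ne_none_iff_exists'.1 hy
  exact h.mem hx

theorem notMem_of_ne_none {x : V} (h : PreMat G L u X ml mr) (hx : mr x ≠ none) : x ∉ L := by
  obtain ⟨y, hy⟩ := Option.ne_none_iff_exists'.1 hx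
  exact h.not_mem ((h.inv _ _).2 hy)

theorem right_eq_none {y : V} (h : PreMat G L u X ml mr) (hy : ml y ≠ none) : mr y = none := by
  by_contra hc
  exact h.notMem_of_ne_none hc (h.mem_of_ne_none hy)

theorem left_eq_none {x : V} (h : PreMat G L u X ml mr) (hx : mr x ≠ none) : ml x = none := by
  by_contra hc
  exact h.notMem_of_ne_none hx (h.mem_of_ne_none hc)

end PreMat

/-- The path has been traced back from `t` to `cur`, through the vertices in `d`. -/
structure Walked (ml mr par : Table V) (A S : Finset V) (t o : V) (d : Finset V) (cur : V)
    (ep em : Table V) : Prop where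
  trace : ∃ l, Trace par S cur l ∧ (∀ z ∈ l, z ∉ d) ∧ ∀ z ∈ l, z ∈ A
  sub : d ⊆ A
  next : ∀ x ∈ d, ∃ y ∈ insert cur d, par x = some y
  inj : ∀ x ∈ d, ∀ x' ∈ d, par x = par x' → x = x'
  not_t : ∀ x ∈ d, par x ≠ some t
  prev : ∀ y ∈ insert cur d, y = t ∨ ∃ x ∈ d, par x = some y
  t_mem : t ∈ insert cur d
  ep : ∀ x y, ep x = some y ↔ (x = o ∧ y = t) ∨ (x ∈ d ∧ mr x ≠ none ∧ par x = some y)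
  em : ∀ x y, em x = some y ↔ y ∈ d ∧ ml y ≠ none ∧ par y = some x

namespace Walked

variable {d : Finset V} {cur : V} {ep em : Table V}

theorem mem_A (h : Walked ml mr par A S t o d cur ep em) : cur ∈ A := by
  obtain ⟨l, h1, _, h3⟩ := h.trace
  exact h3 _ h1.mem

theorem cur_notMem (h : Walked ml mr par A S t o d cur ep em) : cur ∉ d := by
  obtain ⟨l, h1, h2, _⟩ := h.trace
  exact h2 _ h1.mem

theorem start {l : List V} (h : Trace par S t l) (hl : ∀ z ∈ l, z ∈ A)
    (hep : ∀ x y, ep x = some y ↔ x = o ∧ y = t) (hem : ∀ x, em x = none) :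
    Walked ml mr par A S t o ∅ t ep em where
  trace := ⟨l, h, by simp, hl⟩
  sub := by simp
  next := by simp
  inj := by simp
  not_t := by simp
  prev := by simp
  t_mem := by simp
  ep := by simpa using hep
  em := by simp [hem]

/-- The arc runs from `y` to `cur`. If it is a matching edge, it is recorded for removal, otherwise
for addition. The trace has no repetitions, so `y` is new and following parents stays injective. -/
theorem step (ha : AltPath G L u ml mr par S out t o) (h : Walked ml mr par A S t o d cur ep em)
    {y : V} (hy : par cur = some y) :
    if mr y = some cur then
      Walked ml mr par A S t o (insert cur d) y ep (Function.update em y (some cur))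
    else Walked ml mr par A S t o (insert cur d) y (Function.update ep cur (some y)) em := by
  obtain ⟨l, h1, h2, h3⟩ := h.trace
  cases h1 with
  | base h4 h5 => simp [h5] at hy
  | @step _ z l h4 h5 h6 =>
    obtain rfl : z = y := by simpa [hy] using h4.symm
    have hzl := h5.mem
    have hzd : z ∉ d := h2 z (by simp [hzl])
    have hzc : z ≠ cur := by rintro rfl; exact h6 hzl
    have hcd := h.cur_notMem
    have trace : ∃ l, Trace par S z l ∧ (∀ w ∈ l, w ∉ insert cur d) ∧ ∀ w ∈ l, w ∈ A :=
      ⟨l, h5, fun w hw => by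
        have : w ≠ cur := by rintro rfl; exact h6 hw
        simp [this, h2 w (by simp [hw])], fun w hw => h3 w (by simp [hw])⟩
    have sub : insert cur d ⊆ A := Finset.insert_subset h.mem_A h.sub
    have next : ∀ x ∈ insert cur d, ∃ y ∈ insert z (insert cur d), par x = some y := by
      intro x hx
      rcases Finset.mem_insert.1 hx with rfl | hx
      · exact ⟨z, by simp, hy⟩
      · obtain ⟨y, hy, hy'⟩ := h.next x hx
        exact ⟨y, Finset.mem_insert_of_mem hy, hy'⟩
    have hne : ∀ x ∈ d, par x ≠ some z := by
      intro x hx e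
      obtain ⟨y, hy, hy'⟩ := h.next x hx
      obtain rfl : z = y := by simpa [e] using hy'
      simp [hzc, hzd] at hy
    have inj : ∀ x ∈ insert cur d, ∀ x' ∈ insert cur d, par x = par x' → x = x' := by
      intro x hx x' hx' e
      rcases Finset.mem_insert.1 hx with rfl | h7 <;> rcases Finset.mem_insert.1 hx' with rfl | h8
      · rfl
      · exact absurd (e.symm.trans hy) (hne x' h8)
      · exact absurd (e.trans hy) (hne x h7)
      · exact h.inj x h7 x' h8 e
    have hzt : z ≠ t := by
      rintro rfl
      have := h.t_mem
      simp [hzc, hzd] at this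
    have not_t : ∀ x ∈ insert cur d, par x ≠ some t := by
      intro x hx
      rcases Finset.mem_insert.1 hx with rfl | hx
      · rw [hy]; simpa using hzt
      · exact h.not_t x hx
    have prev : ∀ y ∈ insert z (insert cur d), y = t ∨ ∃ x ∈ insert cur d, par x = some y := by
      intro y hy'
      rcases Finset.mem_insert.1 hy' with rfl | hy'
      · exact .inr ⟨cur, by simp, hy⟩
      · exact (h.prev y hy').imp id fun ⟨x, hx, hx'⟩ => ⟨x, Finset.mem_insert_of_mem hx, hx'⟩
    have t_mem : t ∈ insert z (insert cur d) := Finset.mem_insert_of_mem h.t_mem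
    split
    · rename_i hm
      have hml : ml cur = some z := (ha.mat.inv _ _).2 hm
      refine ⟨trace, sub, next, inj, not_t, prev, t_mem, fun x y => ?_, fun x y => ?_⟩
      · rw [h.ep]
        have : mr cur = none := ha.mat.right_eq_none (by simp [hml])
        grind
      · by_cases hxz : x = z
        · subst hxz
          rw [Function.update_self]
          constructor
          · intro e
            obtain rfl : cur = y := by simpa using e
            exact ⟨by simp, by simp [hml], hy⟩
          · rintro ⟨h7, h8, h9⟩
            rcases Finset.mem_insert.1 h7 with rfl | h7
            · rfl
            · exact absurd h9 (hne y h7)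
        · rw [Function.update_of_ne hxz, h.em]
          grind
    · rename_i hm
      obtain ⟨h7, h8, h9, h10⟩ := (ha.arc _ _ hy).resolve_left hm
      have hml : ml cur = none := ha.mat.left_eq_none h8
      refine ⟨trace, sub, next, inj, not_t, prev, t_mem, fun x y => ?_, fun x y => ?_⟩
      · have hco : cur ≠ o := by rintro rfl; exact h8 ha.mr_o
        by_cases hxc : x = cur
        · subst hxc
          rw [Function.update_self]
          simp only [hco, false_and, Finset.mem_insert_self, true_and, false_or, hy]
          exact ⟨fun e => ⟨h8, e⟩, fun e => e.2⟩
        · rw [Function.update_of_ne hxc, h.ep]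
          simp [hxc]
      · rw [h.em]
        grind

/-- The exchange of edges along a completely traced path. -/
theorem finish (ha : AltPath G L u ml mr par S out t o)
    (h : Walked ml mr par A S t o d cur ep em) (hcur : par cur = none) :
    ∃ c, out cur = some c ∧
      (∀ x y, Function.update ep cur (some c) x = some y →
        y ∈ L ∧ y ≠ u ∧ ¬ G.Adj u y ∧ G.Adj u x ∧ x ∉ L ∧ G.Adj x y) ∧
      (∀ x y, mr x = some y → ((Function.update ep cur (some c) x).isSome ↔
        ∃ x', Function.update ep cur (some c) x' = some y)) ∧
      (∀ x x' y, Function.update ep cur (some c) x = some y →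
        Function.update ep cur (some c) x' = some y → x = x') ∧
      (∀ x y, em x = some y → (Function.update ep cur (some c) x).isSome ∧
        ∃ x', Function.update ep cur (some c) x' = some y) ∧
      (Function.update ep cur (some c) o).isSome ∧
      keys (Function.update ep cur (some c)) ⊆ insert o A ∧ keys em ⊆ A := by
  have hm := ha.mat
  have hcS : cur ∈ S := by
    obtain ⟨l, h1, _, _⟩ := h.trace
    cases h1 with
    | base h4 h5 => exact h4
    | step h4 => simp [hcur] at h4
  obtain ⟨hcm, c, hc, hcadj, hcL, hcu, hcn, hcml⟩ := ha.source cur hcS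
  have hcd := h.cur_notMem
  have hco : cur ≠ o := by rintro rfl; exact hcm ha.mr_o
  have hct : t ≠ cur := by
    rintro rfl
    exact hcm (hm.right_eq_none ha.target)
  have htd : t ∈ d := (Finset.mem_insert.1 h.t_mem).resolve_left hct
  -- The edges to be added come in three kinds: the one from the target to its unmatched neighbour
  -- `o`, those on unmatched arcs of the path, and the one from the source to its free neighbour
  -- `c`.
  have hep : ∀ x y, Function.update ep cur (some c) x = some y ↔
      (x = o ∧ y = t) ∨ (x ∈ d ∧ mr x ≠ none ∧ par x = some y) ∨ (x = cur ∧ y = c) := by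
    intro x y
    by_cases hx : x = cur
    · subst hx; simp [hco, hcd, eq_comm]
    · rw [Function.update_of_ne hx, h.ep]; simp [hx]
  set ep' := Function.update ep cur (some c) with hep'
  have hright : ∀ x ∈ insert cur d, mr x ≠ none → (ep' x).isSome := by
    intro x hx hxm
    rw [Option.isSome_iff_exists]
    rcases Finset.mem_insert.1 hx with rfl | hx
    · exact ⟨c, (hep _ _).2 (.inr (.inr ⟨rfl, rfl⟩))⟩
    · obtain ⟨y, _, hy⟩ := h.next x hx
      exact ⟨y, (hep _ _).2 (.inr (.inl ⟨hx, hxm, hy⟩))⟩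
  -- the arcs of the path at its vertices in `L`
  have hleft_arc : ∀ y x, ml y ≠ none → par y = some x → mr x = some y := by
    intro y x hy hyx
    rcases ha.arc y x hyx with h1 | h1
    · exact h1
    · exact absurd (hm.left_eq_none h1.2.1) hy
  -- The target receives `o` as its new partner. Any other vertex of `L` on the path receives the
  -- vertex from which it was reached when tracing back.
  have hleft : ∀ y ∈ d, ml y ≠ none → ∃ x', ep' x' = some y := by
    intro y hy hyl
    rcases h.prev y (Finset.mem_insert_of_mem hy) with rfl | ⟨x, hx, hxy⟩
    · exact ⟨o, (hep _ _).2 (.inl ⟨rfl, rfl⟩)⟩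
    · refine ⟨x, (hep _ _).2 (.inr (.inl ⟨hx, ?_, hxy⟩))⟩
      rcases ha.arc x y hxy with h1 | h1
      · exact absurd (hm.right_eq_none hyl) (by simp [h1])
      · exact h1.2.1
  refine ⟨c, hc, ?_, ?_, ?_, ?_, ?_, ?_, ?_⟩
  · intro x y hxy
    rcases (hep x y).1 hxy with ⟨rfl, rfl⟩ | ⟨hx, hxm, hxy⟩ | ⟨rfl, rfl⟩
    · obtain ⟨z, hz⟩ := Option.ne_none_iff_exists'.1 ha.target
      exact ⟨hm.mem hz, hm.ne hz, hm.not_adj hz, ha.adj_o, ha.o_notMem, ha.adj_ot⟩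
    · have hx' := mem_rN.1 (hm.keys_right (by
        rw [← not_not (a := x ∈ keys mr), not_mem_keys]; exact hxm))
      rcases ha.arc x y hxy with h1 | h1
      · exact absurd (hm.left_eq_none hxm) (by simp [(hm.inv _ _).2 h1])
      · obtain ⟨z, hz⟩ := Option.ne_none_iff_exists'.1 h1.1
        exact ⟨hm.mem hz, hm.ne hz, hm.not_adj hz, hx'.1, hx'.2, h1.2.2.2⟩
    · have hx' := mem_rN.1 (hm.keys_right (by
        rw [← not_not (a := x ∈ keys mr), not_mem_keys]; exact hcm))
      exact ⟨hcL, hcu, hcn, hx'.1, hx'.2, hcadj⟩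
  · intro x y hxy
    have hxm : mr x ≠ none := by simp [hxy]
    have hyl : ml y = some x := (hm.inv _ _).2 hxy
    constructor
    · intro hx
      have hxd : x ∈ insert cur d := by
        obtain ⟨z, hz⟩ := Option.isSome_iff_exists.1 hx
        rcases (hep x z).1 hz with ⟨rfl, _⟩ | ⟨hx, _⟩ | ⟨rfl, _⟩
        · exact absurd ha.mr_o hxm
        · exact Finset.mem_insert_of_mem hx
        · simp
      rcases h.prev x hxd with rfl | ⟨z, hz, hzx⟩
      · exact absurd (hm.right_eq_none ha.target) hxm
      · rcases ha.arc z x hzx with h1 | h1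
        · obtain rfl : z = y := by simpa [hxy] using h1.symm
          exact hleft z hz (by simp [hyl])
        · exact absurd (hm.left_eq_none hxm) h1.1
    · rintro ⟨x', hx'⟩
      have hyd : y ∈ d := by
        rcases (hep x' y).1 hx' with ⟨_, rfl⟩ | ⟨h1, h2, h3⟩ | ⟨rfl, rfl⟩
        · exact htd
        · obtain ⟨z, hz, hz'⟩ := h.next x' h1
          obtain rfl : y = z := by simpa [h3] using hz'
          refine (Finset.mem_insert.1 hz).resolve_left ?_
          rintro rfl
          exact hcm (hm.right_eq_none (by simp [hyl]))
        · simp [hcml] at hyl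
      obtain ⟨z, hz, hyz⟩ := h.next y hyd
      have h1 := hleft_arc y z (by simp [hyl]) hyz
      obtain rfl : x = z := by
        have := (hm.inv _ _).2 h1
        simpa [hyl] using this
      exact hright x hz hxm
  -- The ends in `L` of the three kinds of edges are `t`, parents of traced vertices, and `c`. These
  -- are distinct: no traced vertex has parent `t`, and `c` is unmatched while the others are
  -- matched.
  · intro x x' y hx hx'
    have hpar_ne : ∀ w ∈ d, par w ≠ some t := h.not_t
    have hnc : ∀ w ∈ d, mr w ≠ none → par w ≠ some c := by
      intro w hw hwm hwc
      rcases ha.arc w c hwc with h1 | h1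
      · exact absurd (hm.left_eq_none hwm) (by simp [(hm.inv _ _).2 h1])
      · exact h1.1 hcml
    have htc : t ≠ c := by rintro rfl; exact ha.target hcml
    rcases (hep x y).1 hx with ⟨rfl, rfl⟩ | ⟨h1, h2, h3⟩ | ⟨rfl, rfl⟩ <;>
      rcases (hep x' _).1 hx' with ⟨rfl, e⟩ | ⟨h1', h2', h3'⟩ | ⟨rfl, e⟩
    · rfl
    · exact absurd h3' (hpar_ne _ h1')
    · exact absurd e htc
    · exact absurd (e ▸ h3) (hpar_ne _ h1)
    · exact h.inj x h1 x' h1' (h3.trans h3'.symm)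
    · exact absurd (e ▸ h3) (hnc _ h1 h2)
    · exact absurd e.symm htc
    · exact absurd h3' (hnc _ h1' h2')
    · rfl
  · intro x y hxy
    obtain ⟨h1, h2, h3⟩ := (h.em x y).1 hxy
    refine ⟨?_, hleft y h1 h2⟩
    obtain ⟨z, hz, hz'⟩ := h.next y h1
    obtain rfl : x = z := by simpa [h3] using hz'
    exact hright x hz (by simp [hleft_arc y x h2 h3])
  · rw [Option.isSome_iff_exists]
    exact ⟨t, (hep _ _).2 (.inl ⟨rfl, rfl⟩)⟩
  · intro x hx
    obtain ⟨y, hy⟩ := mem_keys_iff.1 hx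
    rcases (hep x y).1 hy with ⟨rfl, _⟩ | ⟨h1, _⟩ | ⟨rfl, _⟩
    · simp
    · exact Finset.mem_insert_of_mem (h.sub h1)
    · exact Finset.mem_insert_of_mem h.mem_A
  · intro x hx
    obtain ⟨y, hy⟩ := mem_keys_iff.1 hx
    obtain ⟨h1, h2, h3⟩ := (h.em x y).1 hy
    obtain ⟨z, hz, hz'⟩ := h.next y h1
    obtain rfl : x = z := by simpa [h3] using hz'
    rcases Finset.mem_insert.1 hz with rfl | hz
    · exact h.mem_A
    · exact h.sub hz

end Walked

/-! ### Exchanging edges along the path -/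

def traceBody : List Stmt := [
  .lookup .prev (.tab .parent) .cur,
  .lookup .c (.fam .MR .a) .prev,
  .ite (.eq .c .cur)
    (.insert (.tab .eMinus) .prev .cur)
    (.insert (.tab .ePlus) .cur .prev),
  .move .cur .prev]

theorem traceBody_spec {τ : Traversal V} {σ : State V} {d : Finset V} {cur y : V}
    (ha : AltPath G L u ml mr par S out t o)
    (h : Walked ml mr par A S t o d cur (σ.tab .ePlus) (σ.tab .eMinus))
    (hreg : σ.reg .a = some u) (hmr : σ.fam .MR u = mr) (hpar : σ.tab .parent = par)
    (hcur : σ.reg .cur = some cur) (hy : par cur = some y) :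
    ((block traceBody).run τ σ).reg .cur = some y ∧
    Walked ml mr par A S t o (insert cur d) y (((block traceBody).run τ σ).tab .ePlus)
      (((block traceBody).run τ σ).tab .eMinus) := by
  have hs := h.step ha hy
  subst hmr
  subst hpar
  by_cases hm : σ.fam .MR u y = some cur
  · rw [if_pos hm] at hs
    refine ⟨by simp [traceBody, hreg, hcur, hy, hm], ?_⟩
    have e1 : ((block traceBody).run τ σ).tab .ePlus = σ.tab .ePlus := by
      simp [traceBody, hreg, hcur, hy, hm]
    have e2 : ((block traceBody).run τ σ).tab .eMinus =
        Function.update (σ.tab .eMinus) y (some cur) := by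
      simp [traceBody, hreg, hcur, hy, hm]
    rwa [e1, e2]
  · rw [if_neg hm] at hs
    refine ⟨by simp [traceBody, hreg, hcur, hy, hm], ?_⟩
    have e1 : ((block traceBody).run τ σ).tab .ePlus =
        Function.update (σ.tab .ePlus) cur (some y) := by
      simp [traceBody, hreg, hcur, hy, hm]
    have e2 : ((block traceBody).run τ σ).tab .eMinus = σ.tab .eMinus := by
      simp [traceBody, hreg, hcur, hy, hm]
    rwa [e1, e2]

/-- Again a loop over `auxVerts` replaces an unbounded one. The traced vertices and the current one
are distinct elements of that set, so the start of the path is reached before the keys run out. -/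
theorem traceLoop_spec {τ : Traversal V} {σ : State V}
    (ha : AltPath G L u ml mr par S out t o)
    (h : Walked ml mr par (keys (σ.tab .auxVerts)) S t o ∅ t (σ.tab .ePlus) (σ.tab .eMinus))
    (hreg : σ.reg .a = some u) (hmr : σ.fam .MR u = mr) (hpar : σ.tab .parent = par)
    (hcur : σ.reg .cur = some t) :
    (∃ d cur,
      ((forWhile .iter (.tab .auxVerts) (.mem .cur (.tab .parent)) traceBody).run τ σ).reg .cur =
        some cur ∧ par cur = none ∧
      Walked ml mr par (keys (σ.tab .auxVerts)) S t o d cur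
        (((forWhile .iter (.tab .auxVerts) (.mem .cur (.tab .parent)) traceBody).run τ σ).tab
          .ePlus)
        (((forWhile .iter (.tab .auxVerts) (.mem .cur (.tab .parent)) traceBody).run τ σ).tab
          .eMinus)) ∧
    ((forWhile .iter (.tab .auxVerts) (.mem .cur (.tab .parent)) traceBody).run τ σ).time ≤
      σ.time + 9 * (keys (σ.tab .auxVerts)).card + 1 := by
  set A := keys (σ.tab .auxVerts) with hA
  obtain ⟨⟨D, hD, ⟨d, cur, h1, h2, h3⟩, h4⟩, h5⟩ := forIn_spec (τ := τ) (r := .iter)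
    (d := .tab .auxVerts) (c := .mem .cur (.tab .parent)) (body := block traceBody) (σ := σ)
    (fun D σ' => ∃ (d : Finset V) (cur : V), σ'.reg .cur = some cur ∧ D.card = d.card ∧
      Walked ml mr par A S t o d cur (σ'.tab .ePlus) (σ'.tab .eMinus))
    (fun _ => 6) (fun _ _ _ _ _ _ h => h) ⟨∅, t, hcur, rfl, h⟩
    (by
      rintro D x σ' ⟨d, cur, h1, h2, h3⟩ hF hD hx hxD hr hc
      have hp : σ'.tab .parent = par := (hF.tab .parent).trans hpar
      simp only [Cond.eval, h1, State.get_tab, hp] at hc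
      obtain ⟨y, hy⟩ := Option.isSome_iff_exists.1 hc
      obtain ⟨h4, h5⟩ := traceBody_spec (τ := τ) ha h3 ((hF.reg .a).trans hreg)
        (by rw [hF.fam .MR, hmr]) hp h1 hy
      refine ⟨⟨insert cur d, y, h4, ?_, h5⟩, time_simple τ σ' _ rfl⟩
      rw [Finset.card_insert_of_notMem hxD, Finset.card_insert_of_notMem h3.cur_notMem, h2])
  have hF : Frame _ σ _ := frame_run τ
    (forWhile .iter (.tab .auxVerts) (.mem .cur (.tab .parent)) traceBody) σ
  refine ⟨⟨d, cur, h1, ?_, h3⟩, h5.trans ?_⟩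
  -- Processing every key would give as many traced vertices as `A` has elements, leaving no room
  -- for `cur` in `A`.
  · rcases h4 with rfl | h4
    · have : insert cur d ⊆ A := Finset.insert_subset h3.mem_A h3.sub
      have := Finset.card_le_card this
      rw [Finset.card_insert_of_notMem h3.cur_notMem] at this
      have e : (keys (σ.get (.tab .auxVerts))).card = A.card := rfl
      omega
    · have hp := (hF.tab .parent).trans hpar
      have h4' : (Cond.mem .cur (.tab .parent)).eval ((forWhile .iter (.tab .auxVerts)
        (.mem .cur (.tab .parent)) traceBody).run τ σ) = false := h4
      have h1' : ((forWhile .iter (.tab .auxVerts)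
        (.mem .cur (.tab .parent)) traceBody).run τ σ).reg .cur = some cur := h1
      simpa only [Cond.eval, h1', State.get_tab, hp, Option.isSome_eq_false_iff,
        Option.isNone_iff_eq_none] using h4'
  · simp only [Finset.sum_const, smul_eq_mul, Cond.cost, State.get_tab, ← hA]
    omega

/-- Nothing is said about the entries of the removed edges, since all of their ends will be
overwritten by added edges. -/
theorem removeEdges_spec {τ : Traversal V} {σ : State V} (ha : σ.reg .a = some u) :
    ((∀ y, (∀ x, σ.tab .eMinus x ≠ some y) → ((forAll .b (.tab .eMinus)
        [.lookup .c (.tab .eMinus) .b, removeEdge .a .c .b]).run τ σ).fam .ML u y =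
          σ.fam .ML u y) ∧
      (∀ x, σ.tab .eMinus x = none → ((forAll .b (.tab .eMinus)
        [.lookup .c (.tab .eMinus) .b, removeEdge .a .c .b]).run τ σ).fam .MR u x =
          σ.fam .MR u x)) ∧
    ((forAll .b (.tab .eMinus)
      [.lookup .c (.tab .eMinus) .b, removeEdge .a .c .b]).run τ σ).time ≤
      σ.time + 6 * (keys (σ.tab .eMinus)).card + 1 := by
  obtain ⟨h1, h2⟩ := forAll_spec (τ := τ) (r := .b) (d := .tab .eMinus)
    (l := [.lookup .c (.tab .eMinus) .b, removeEdge .a .c .b]) (σ := σ)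
    (fun _ σ' => (∀ y, (∀ x, σ.tab .eMinus x ≠ some y) → σ'.fam .ML u y = σ.fam .ML u y) ∧
      (∀ x, σ.tab .eMinus x = none → σ'.fam .MR u x = σ.fam .MR u x))
    (fun _ => 3) (fun _ _ _ _ _ _ h => h) (by simp) (by
      rintro D x σ' ⟨h1, h2⟩ hF hD hx hxD hr
      refine ⟨?_, time_simple τ σ' _ rfl⟩
      have hu := (hF.reg .a).trans ha
      have he := hF.tab .eMinus
      obtain ⟨z, hz⟩ := mem_keys_iff.1 hx
      simp only [State.get_tab] at hz
      constructor
      · intro y hy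
        have hyz : y ≠ z := by rintro rfl; exact hy x hz
        simp [removeEdge, hu, he, hr, hz, hyz, h1 y hy]
      · intro y hy
        have hyx : y ≠ x := by rintro rfl; simp [hz] at hy
        simp [removeEdge, hu, he, hr, hz, hyx, h2 y hy])
  refine ⟨h1, h2.trans ?_⟩
  simp only [Finset.sum_const, smul_eq_mul, State.get_tab]; omega

/-- Injectivity of `ePlus` keeps a later insertion from overwriting the partner of a vertex of `L`
set by an earlier one. -/
theorem addEdges_spec {τ : Traversal V} {σ : State V} (ha : σ.reg .a = some u)
    (hinj : ∀ x x' y, σ.tab .ePlus x = some y → σ.tab .ePlus x' = some y → x = x') :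
    ((∀ x y, σ.tab .ePlus x = some y → ((forAll .b (.tab .ePlus)
        [.lookup .c (.tab .ePlus) .b, addEdge .a .c .b]).run τ σ).fam .ML u y = some x ∧
        ((forAll .b (.tab .ePlus)
          [.lookup .c (.tab .ePlus) .b, addEdge .a .c .b]).run τ σ).fam .MR u x = some y) ∧
      (∀ y, (∀ x, σ.tab .ePlus x ≠ some y) → ((forAll .b (.tab .ePlus)
        [.lookup .c (.tab .ePlus) .b, addEdge .a .c .b]).run τ σ).fam .ML u y =
          σ.fam .ML u y) ∧
      (∀ x, σ.tab .ePlus x = none → ((forAll .b (.tab .ePlus)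
        [.lookup .c (.tab .ePlus) .b, addEdge .a .c .b]).run τ σ).fam .MR u x =
          σ.fam .MR u x)) ∧
    ((forAll .b (.tab .ePlus)
      [.lookup .c (.tab .ePlus) .b, addEdge .a .c .b]).run τ σ).time ≤
      σ.time + 6 * (keys (σ.tab .ePlus)).card + 1 := by
  obtain ⟨h1, h2⟩ := forAll_spec (τ := τ) (r := .b) (d := .tab .ePlus)
    (l := [.lookup .c (.tab .ePlus) .b, addEdge .a .c .b]) (σ := σ)
    (fun D σ' => (∀ x y, x ∈ D → σ.tab .ePlus x = some y →
        σ'.fam .ML u y = some x ∧ σ'.fam .MR u x = some y) ∧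
      (∀ y, (∀ x, σ.tab .ePlus x ≠ some y) → σ'.fam .ML u y = σ.fam .ML u y) ∧
      (∀ x, σ.tab .ePlus x = none → σ'.fam .MR u x = σ.fam .MR u x))
    (fun _ => 3) (fun _ _ _ _ _ _ h => h) (by simp) (by
      rintro D x σ' ⟨h0, h1, h2⟩ hF hD hx hxD hr
      refine ⟨?_, time_simple τ σ' _ rfl⟩
      have hu := (hF.reg .a).trans ha
      have he := hF.tab .ePlus
      obtain ⟨z, hz⟩ := mem_keys_iff.1 hx
      simp only [State.get_tab] at hz
      refine ⟨?_, ?_, ?_⟩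
      · intro x' y hx' hy
        by_cases hxx : x' = x
        · subst hxx
          obtain rfl : z = y := by simpa [hz] using hy
          simp [addEdge, hu, he, hr, hz]
        · have hyz : y ≠ z := by rintro rfl; exact hxx (hinj _ _ _ hy hz)
          have hD' := (Finset.mem_insert.1 hx').resolve_left hxx
          simp [addEdge, hu, he, hr, hz, hxx, hyz, h0 x' y hD' hy]
      · intro y hy
        have hyz : y ≠ z := by rintro rfl; exact hy x hz
        simp [addEdge, hu, he, hr, hz, hyz, h1 y hy]
      · intro y hy
        have hyx : y ≠ x := by rintro rfl; simp [hz] at hy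
        simp [addEdge, hu, he, hr, hz, hyx, h2 y hy])
  refine ⟨⟨fun x y hxy => h1.1 x y (mem_keys_iff.2 ⟨y, hxy⟩) hxy, h1.2⟩, h2.trans ?_⟩
  simp only [Finset.sum_const, smul_eq_mul, State.get_tab]; omega

/-- Both ends of a removed edge belong to added edges, so removing and then adding amounts to
overriding the old matching by `ePlus`, as in `PreMat.override`. The matching grows because `o`
becomes matched and no vertex becomes unmatched. -/
theorem applyPath_spec {τ : Traversal V} {σ : State V} {l : List V}
    (ha : AltPath G L u (σ.fam .ML u) (σ.fam .MR u) (σ.tab .parent) S (σ.tab .out) t o)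
    (hl : Trace (σ.tab .parent) S t l) (hlA : ∀ z ∈ l, z ∈ keys (σ.tab .auxVerts))
    (hreg : σ.reg .a = some u) (ht : σ.reg .t = some t) (ho : σ.tab .out t = some o) :
    Mat G L u ((applyPath.run τ σ).fam .ML u) ((applyPath.run τ σ).fam .MR u) ∧
    (keys (σ.fam .ML u)).card + 1 ≤ (keys ((applyPath.run τ σ).fam .ML u)).card ∧
    (keys ((applyPath.run τ σ).tab .ePlus)).card ≤ (keys (σ.tab .auxVerts)).card + 1 ∧
    (keys ((applyPath.run τ σ).tab .eMinus)).card ≤ (keys (σ.tab .auxVerts)).card ∧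
    (applyPath.run τ σ).time ≤ σ.time + (keys (σ.tab .ePlus)).card +
      (keys (σ.tab .eMinus)).card + 21 * (keys (σ.tab .auxVerts)).card + 16 := by
  set σ₁ := (block [.clear (.tab .ePlus), .clear (.tab .eMinus), .lookup .b (.tab .out) .t,
    .insert (.tab .ePlus) .b .t, .move .cur .t]).run τ σ with hσ₁
  have hF₁ : Frame _ σ σ₁ := frame_run τ _ σ
  have ht₁ : σ₁.time = σ.time + (keys (σ.tab .ePlus)).card + (keys (σ.tab .eMinus)).card + 5 := by
    simp [hσ₁, ht, ho]; omega
  have hcur₁ : σ₁.reg .cur = some t := by simp [hσ₁, ht, ho]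
  have hep₁ : σ₁.tab .ePlus = Function.update (fun _ => none) o (some t) := by
    simp [hσ₁, ht, ho]
  have hem₁ : σ₁.tab .eMinus = fun _ => none := by simp [hσ₁, ht, ho]
  have hW : Walked (σ.fam .ML u) (σ.fam .MR u) (σ.tab .parent) (keys (σ.tab .auxVerts)) S t o ∅ t
      (σ₁.tab .ePlus) (σ₁.tab .eMinus) := by
    refine .start hl hlA (fun x y => ?_) (fun x => by rw [hem₁])
    rw [hep₁]
    by_cases hx : x = o
    · subst hx; simp [eq_comm]
    · simp [hx]
  have hA₁ : σ₁.tab .auxVerts = σ.tab .auxVerts := hF₁.tab _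
  obtain ⟨⟨d, cur, h1, h2, h3⟩, h4⟩ := traceLoop_spec (τ := τ) (σ := σ₁) ha (by rwa [hA₁])
    ((hF₁.reg .a).trans hreg) (by rw [hF₁.fam .MR]) (hF₁.tab .parent) hcur₁
  set σ₂ := (forWhile .iter (.tab .auxVerts) (.mem .cur (.tab .parent)) traceBody).run τ σ₁
    with hσ₂
  have hF₂ : Frame _ σ₁ σ₂ := frame_run τ _ σ₁
  obtain ⟨c, hc, h5, h6, h7, h8, h9, h10, h11⟩ := h3.finish ha h2
  have hout : σ₂.tab .out = σ.tab .out := (hF₂.tab _).trans (hF₁.tab _)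
  set σ₃ := (block [.lookup .c (.tab .out) .cur, .insert (.tab .ePlus) .cur .c]).run τ σ₂ with hσ₃
  have hF₃ : Frame _ σ₂ σ₃ := frame_run τ _ σ₂
  have hep₃ : σ₃.tab .ePlus = Function.update (σ₂.tab .ePlus) cur (some c) := by
    simp [hσ₃, h1, hout, hc]
  have ht₃ : σ₃.time = σ₂.time + 2 := by simp [hσ₃, h1, hout, hc]
  have hem₃ : σ₃.tab .eMinus = σ₂.tab .eMinus := hF₃.tab _
  have hreg₃ : σ₃.reg .a = some u :=
    (hF₃.reg .a).trans ((hF₂.reg .a).trans ((hF₁.reg .a).trans hreg))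
  have hML₃ : σ₃.fam .ML = σ.fam .ML := (hF₃.fam _).trans ((hF₂.fam _).trans (hF₁.fam _))
  have hMR₃ : σ₃.fam .MR = σ.fam .MR := (hF₃.fam _).trans ((hF₂.fam _).trans (hF₁.fam _))
  rw [← hep₃] at h5 h6 h7 h8 h9 h10
  rw [← hem₃] at h8 h11
  rw [hA₁] at h10 h11 h4
  obtain ⟨⟨h12, h13⟩, h14⟩ := removeEdges_spec (τ := τ) (σ := σ₃) hreg₃
  set σ₄ := (forAll .b (.tab .eMinus)
    [.lookup .c (.tab .eMinus) .b, removeEdge .a .c .b]).run τ σ₃ with hσ₄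
  have hF₄ : Frame _ σ₃ σ₄ := frame_run τ _ σ₃
  have hep₄ : σ₄.tab .ePlus = σ₃.tab .ePlus := hF₄.tab _
  obtain ⟨⟨h15, h16, h17⟩, h18⟩ := addEdges_spec (τ := τ) (σ := σ₄) ((hF₄.reg .a).trans hreg₃)
    (by rw [hep₄]; exact h7)
  have hrun : applyPath.run τ σ = (forAll .b (.tab .ePlus)
    [.lookup .c (.tab .ePlus) .b, addEdge .a .c .b]).run τ σ₄ := rfl
  rw [hrun]
  set σ₅ := (forAll .b (.tab .ePlus)
    [.lookup .c (.tab .ePlus) .b, addEdge .a .c .b]).run τ σ₄ with hσ₅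
  have hF₅ : Frame _ σ₄ σ₅ := frame_run τ _ σ₄
  rw [hep₄] at h15 h16 h17 h18
  have hr : ∀ x, σ₅.fam .MR u x = (σ₃.tab .ePlus x).or (σ.fam .MR u x) := by
    intro x
    cases hx : σ₃.tab .ePlus x with
    | some y => simpa using (h15 x y hx).2
    | none =>
      rw [h17 x hx, h13 x, hMR₃]
      · rfl
      · by_contra hne
        obtain ⟨y, hy⟩ := Option.ne_none_iff_exists'.1 hne
        simpa [hx] using (h8 x y hy).1
  have hmat : Mat G L u (σ₅.fam .ML u) (σ₅.fam .MR u) := by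
    refine ha.mat.override (ep := σ₃.tab .ePlus) (h5 _ _) (h6 _ _) hr (fun h => (h15 _ _ h).1) ?_
    intro y hy
    rw [h16 y hy, h12 y, hML₃]
    intro x hx
    obtain ⟨x', hx'⟩ := (h8 x y hx).2
    exact hy x' hx'
  have hcep : (keys (σ₃.tab .ePlus)).card ≤ (keys (σ.tab .auxVerts)).card + 1 :=
    (Finset.card_le_card h10).trans (Finset.card_insert_le _ _)
  have hcem := Finset.card_le_card h11
  refine ⟨hmat, ?_, ?_, ?_, ?_⟩
  · rw [hmat.card_eq, ha.mat.card_eq]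
    -- Counting ends outside `L`: the old ones all remain, and `o` is new.
    have hsub : insert o (keys (σ.fam .MR u)) ⊆ keys (σ₅.fam .MR u) := by
      intro x hx
      rw [mem_keys, hr, Option.isSome_or, Bool.or_eq_true]
      rcases Finset.mem_insert.1 hx with rfl | hx
      · exact .inl h9
      · exact .inr (mem_keys.1 hx)
    have := Finset.card_le_card hsub
    rwa [Finset.card_insert_of_notMem (not_mem_keys.2 ha.mr_o)] at this
  · rw [hF₅.tab .ePlus, hep₄]; exact hcep
  · rw [hF₅.tab .eMinus, hF₄.tab .eMinus]; exact hcem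
  · omega

end

section
variable {V : Type u} [Fintype V] [DecidableEq V]

/-! ### Memory in use -/

variable {G : SimpleGraph V} [DecidableRel G.Adj] {L : Finset V} {u : V} {p : ℕ}

variable (G) in
/-- The families of tables, except for the auxiliary digraph, are not larger than the graph. -/
structure FamOk (σ : State V) : Prop where
  adj : ∀ x, (keys (σ.fam .adj x)).card ≤ G.degree x
  NL : ∀ x, (keys (σ.fam .NL x)).card ≤ G.degree x
  NR : ∀ x, (keys (σ.fam .NR x)).card ≤ G.degree x
  ML : ∀ x, (keys (σ.fam .ML x)).card ≤ G.degree x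
  MR : ∀ x, (keys (σ.fam .MR x)).card ≤ G.degree x
  output : σ.output.length ≤ Fintype.card V

/-- The auxiliary digraph has at most `2 * p` vertices. -/
structure DigraphOk (p : ℕ) (σ : State V) : Prop where
  aux : ∀ x ∉ keys (σ.tab .auxVerts), σ.fam .aux x = fun _ => none
  aux_sub : ∀ x, keys (σ.fam .aux x) ⊆ keys (σ.tab .auxVerts)
  card_le : (keys (σ.tab .auxVerts)).card ≤ 2 * p

variable (G) in
/-- A bound for the memory occupied by tables, registers and the output. -/
def base (p : ℕ) : ℕ := 34 + 21 * Fintype.card V + 10 * G.edgeFinset.card + 4 * p ^ 2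

theorem keys_card_le (t : Table V) : (keys t).card ≤ Fintype.card V := Finset.card_le_univ _

/-- Each single table has at most `n` entries, and each of five families has at most the sum of the
degrees, which is `2 * m`. The auxiliary family has at most `2 * p` nonempty tables of at most `2 *
p` entries. The constants arise as `34 = 20 + 14`, `21 = 14 + 6 + 1` and `10 = 5 * 2`. -/
theorem words_le {σ : State V} (h : FamOk G σ) (h' : DigraphOk p σ) :
    σ.words ≤ base G p + σ.held := by
  have hdeg : ∑ x, G.degree x = 2 * G.edgeFinset.card := G.sum_degrees_eq_twice_card_edges
  have h1 : ∑ d : Tab, (1 + (keys (σ.tab d)).card) ≤ 14 * (1 + Fintype.card V) := by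
    have := Finset.sum_le_card_nsmul (Finset.univ : Finset Tab)
      (fun d => 1 + (keys (σ.tab d)).card) (1 + Fintype.card V) fun d _ => by
        have := keys_card_le (σ.tab d); omega
    exact this
  have h2 : ∀ f : Fam, (∀ x, (keys (σ.fam f x)).card ≤ G.degree x) →
      ∑ x : V, (1 + (keys (σ.fam f x)).card) ≤ Fintype.card V + 2 * G.edgeFinset.card := by
    intro f hf
    rw [Finset.sum_add_distrib, ← hdeg]
    have := Finset.sum_le_sum fun x (_ : x ∈ Finset.univ) => hf x
    simp only [Finset.sum_const, Finset.card_univ, smul_eq_mul, mul_one]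
    omega
  have h3 : ∑ x : V, (1 + (keys (σ.fam .aux x)).card) ≤ Fintype.card V + 4 * p ^ 2 := by
    rw [Finset.sum_add_distrib]
    have e : ∑ x : V, (keys (σ.fam .aux x)).card =
        ∑ x ∈ keys (σ.tab .auxVerts), (keys (σ.fam .aux x)).card := by
      symm
      refine Finset.sum_subset (Finset.subset_univ _) fun x _ hx => ?_
      rw [h'.aux x hx]; simp
    have := Finset.sum_le_card_nsmul (keys (σ.tab .auxVerts))
      (fun x => (keys (σ.fam .aux x)).card) (2 * p) fun x _ =>
        (Finset.card_le_card (h'.aux_sub x)).trans h'.card_le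
    have h4 := Nat.mul_le_mul_right (2 * p) h'.card_le
    simp only [smul_eq_mul] at this
    have h5 : 2 * p * (2 * p) = 4 * p ^ 2 := by ring
    rw [e]
    simp only [Finset.sum_const, Finset.card_univ, smul_eq_mul, mul_one]
    omega
  have h4 : ∑ f : Fam, ∑ x : V, (1 + (keys (σ.fam f x)).card) =
      ∑ x : V, (1 + (keys (σ.fam .adj x)).card) + (∑ x : V, (1 + (keys (σ.fam .NL x)).card) +
      (∑ x : V, (1 + (keys (σ.fam .NR x)).card) + (∑ x : V, (1 + (keys (σ.fam .ML x)).card) +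
      (∑ x : V, (1 + (keys (σ.fam .MR x)).card) + ∑ x : V, (1 + (keys (σ.fam .aux x)).card))))) :=
    rfl
  have h5 := h2 _ h.adj; have h6 := h2 _ h.NL; have h7 := h2 _ h.NR; have h8 := h2 _ h.ML
  have h9 := h2 _ h.MR; have h10 := h.output
  have e1 : Fintype.card Reg = 14 := rfl
  have e2 : Fintype.card Ctr = 3 := rfl
  have e3 : Fintype.card Flag = 3 := rfl
  unfold State.words base
  rw [h4, e1, e2, e3]
  omega

theorem Grow.peak_le {σ σ' : State V} {t W : ℕ} (h : Grow σ σ') (ht : σ'.time ≤ σ.time + t)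
    (hp : σ.peak ≤ W) (hw : σ.words + t ≤ W) : σ'.peak ≤ W := by
  have := h.peak; omega

/-! ### The procedure Augmenting -/

/-- The tables used by the search. -/
def auxTabs : Finset Tab := {.S, .T, .out, .frontier, .visited, .parent, .ePlus, .eMinus}

/-- The tables used by the search are small. -/
structure AuxOk (p : ℕ) (σ : State V) : Prop extends DigraphOk p σ where
  small : ∀ d ∈ auxTabs, (keys (σ.tab d)).card ≤ 2 * p + 1

variable (G) in
/-- The sets of left and right neighbours are those that belong to `L`. -/
structure NbrOk (L : Finset V) (σ : State V) : Prop where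
  adj : ∀ x, keys (σ.fam .adj x) = G.neighborFinset x
  NL : ∀ x, keys (σ.fam .NL x) = lN G L x
  NR : ∀ x, keys (σ.fam .NR x) = rN G L x

/-- A bound for the running time of Augmenting at a vertex of degree `d`. -/
def augCost (p d : ℕ) : ℕ := 53 * p ^ 2 + 200 * p + 100 + d * (11 * p + 4)

theorem ArcsBuilt.digraphOk {σ : State V} {P : V → V → Prop} {ml mr : Table V} {S : Set V}
    (h : ArcsBuilt σ mr P) (hm : PreMat G L u S ml mr) (hP : ∀ x y, P x y → y ∈ keys ml)
    (hp : (keys ml).card ≤ p) (hA : keys (σ.tab .auxVerts) = keys mr ∪ keys ml) :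
    DigraphOk p σ := by
  have key : ∀ x y, y ∈ keys (σ.fam .aux x) → x ∈ keys mr ∪ keys ml ∧ y ∈ keys mr ∪ keys ml := by
    intro x y hy
    rw [Finset.mem_union, Finset.mem_union]
    rcases (h.arc x y).1 hy with ⟨h1, h2⟩ | ⟨h1, h2, h3, h4⟩
    · exact ⟨.inl (mem_keys_iff.2 ⟨y, h2⟩), .inr (hP _ _ h1)⟩
    · refine ⟨.inr (hP _ _ h1), .inl ?_⟩
      rwa [← not_not (a := y ∈ keys mr), not_mem_keys]
  refine ⟨fun x hx => ?_, fun x y hy => hA ▸ (key x y hy).2, ?_⟩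
  · funext y
    rw [← not_mem_keys]
    intro hy
    exact hx (hA ▸ (key x y hy).1)
  · rw [hA]
    have := Finset.card_union_le (keys mr) (keys ml)
    have := hm.card_eq
    omega

/-- The first part of the construction: all tables are cleared and the vertex set is set up. -/
def auxInit : Stmt := block [
  forAll .b (.tab .auxVerts) [.clear (.fam .aux .b)],
  .clear (.tab .auxVerts), .clear (.tab .S), .clear (.tab .T), .clear (.tab .out),
  forAll .b (.fam .MR .a) [insertSet (.tab .auxVerts) .b],
  forAll .c (.fam .ML .a) [insertSet (.tab .auxVerts) .c]]

theorem auxInit_spec {τ : Traversal V} {σ : State V} (ha : σ.reg .a = some u)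
    (hm : Mat G L u (σ.fam .ML u) (σ.fam .MR u)) (hp : (keys (σ.fam .ML u)).card ≤ p)
    (hx : AuxOk p σ) :
    keys ((auxInit.run τ σ).tab .auxVerts) = keys (σ.fam .MR u) ∪ keys (σ.fam .ML u) ∧
    (∀ x, (auxInit.run τ σ).fam .aux x = fun _ => none) ∧
    keys ((auxInit.run τ σ).tab .S) = ∅ ∧ keys ((auxInit.run τ σ).tab .T) = ∅ ∧
    keys ((auxInit.run τ σ).tab .out) = ∅ ∧
    (auxInit.run τ σ).time ≤ σ.time + 4 * p ^ 2 + 24 * p + 10 := by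
  obtain ⟨h1, h2⟩ := clearAux_spec (τ := τ) (q := 2 * p) hx.aux fun x =>
    (Finset.card_le_card (hx.aux_sub x)).trans hx.card_le
  set σ₁ := (forAll .b (.tab .auxVerts) [.clear (.fam .aux .b)]).run τ σ with hσ₁
  have hF₁ : Frame _ σ σ₁ := frame_run τ _ σ
  set σ₂ := (block [.clear (.tab .auxVerts), .clear (.tab .S), .clear (.tab .T),
    .clear (.tab .out)]).run τ σ₁ with hσ₂
  have hF₂ : Frame _ σ₁ σ₂ := frame_run τ _ σ₁
  have ht₂ : σ₂.time = σ₁.time + (keys (σ₁.tab .auxVerts)).card + (keys (σ₁.tab .S)).card +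
      (keys (σ₁.tab .T)).card + (keys (σ₁.tab .out)).card + 4 := by
    simp [hσ₂]; omega
  rw [hF₁.tab .auxVerts, hF₁.tab .S, hF₁.tab .T, hF₁.tab .out] at ht₂
  have ha₂ : σ₂.reg .a = some u := (hF₂.reg .a).trans ((hF₁.reg .a).trans ha)
  have hML₂ : σ₂.fam .ML = σ.fam .ML := (hF₂.fam _).trans (hF₁.fam _)
  have hMR₂ : σ₂.fam .MR = σ.fam .MR := (hF₂.fam _).trans (hF₁.fam _)
  obtain ⟨h3, h4⟩ := copyKeys_spec (τ := τ) (σ := σ₂) .b (.fam .MR .a) .auxVerts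
  set σ₃ := (forAll .b (.fam .MR .a) [insertSet (.tab .auxVerts) .b]).run τ σ₂ with hσ₃
  have hF₃ : Frame _ σ₂ σ₃ := frame_run τ _ σ₂
  have ha₃ : σ₃.reg .a = some u := (hF₃.reg .a).trans ha₂
  have hML₃ : σ₃.fam .ML = σ.fam .ML := (hF₃.fam _).trans hML₂
  obtain ⟨h5, h6⟩ := copyKeys_spec (τ := τ) (σ := σ₃) .c (.fam .ML .a) .auxVerts
  have hrun : auxInit.run τ σ = (forAll .c (.fam .ML .a) [insertSet (.tab .auxVerts) .c]).run τ σ₃ :=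
    rfl
  rw [hrun]
  set σ₄ := (forAll .c (.fam .ML .a) [insertSet (.tab .auxVerts) .c]).run τ σ₃ with hσ₄
  have hF₄ : Frame _ σ₃ σ₄ := frame_run τ _ σ₃
  have e1 : σ₂.get (.fam .MR .a) = σ.fam .MR u := by simp [ha₂, hMR₂]
  have e2 : σ₃.get (.fam .ML .a) = σ.fam .ML u := by simp [ha₃, hML₃]
  rw [e1] at h3 h4
  rw [e2] at h5 h6
  have hV₂ : keys (σ₂.tab .auxVerts) = ∅ := by simp [hσ₂]
  refine ⟨?_, ?_, ?_, ?_, ?_, ?_⟩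
  · rw [h5, h3, hV₂, Finset.empty_union]
  · intro x; rw [hF₄.fam .aux, hF₃.fam .aux, hF₂.fam .aux, h1]
  · rw [hF₄.tab .S, hF₃.tab .S]; simp [hσ₂]
  · rw [hF₄.tab .T, hF₃.tab .T]; simp [hσ₂]
  · rw [hF₄.tab .out, hF₃.tab .out]; simp [hσ₂]
  · have h7 := hx.small .S (by decide)
    have h8 := hx.small .T (by decide)
    have h9 := hx.small .out (by decide)
    have h10 := hx.card_le
    have h11 := hm.card_eq
    have h12 := Nat.mul_le_mul_right (2 * p + 4) h10
    have h13 : 2 * p * (2 * p + 4) = 4 * p ^ 2 + 8 * p := by ring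
    omega

variable (G) in
/-- The auxiliary digraph of the matching of `u`. -/
structure AuxBuilt (L : Finset V) (u : V) (ml mr : Table V) (σ : State V) : Prop where
  verts : keys (σ.tab .auxVerts) = keys mr ∪ keys ml
  arc : ∀ x y, y ∈ keys (σ.fam .aux x) ↔ mr x = some y ∨
    (ml x ≠ none ∧ mr y ≠ none ∧ mr y ≠ some x ∧ G.Adj y x)
  T : ∀ y, y ∈ keys (σ.tab .T) ↔
    ml y ≠ none ∧ ∃ x, G.Adj u x ∧ x ∉ L ∧ mr x = none ∧ G.Adj x y
  T_out : ∀ y ∈ keys (σ.tab .T), ∃ x, σ.tab .out y = some x ∧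
    G.Adj u x ∧ x ∉ L ∧ mr x = none ∧ G.Adj x y
  S : ∀ x, x ∈ keys (σ.tab .S) ↔ mr x ≠ none ∧ ∃ y, G.Adj x y ∧ y ∈ L ∧ y ≠ u ∧
    ¬ G.Adj u y ∧ ml y = none
  S_out : ∀ x ∈ keys (σ.tab .S), mr x ≠ none ∧ ∃ y, σ.tab .out x = some y ∧ G.Adj x y ∧ y ∈ L ∧
    y ≠ u ∧ ¬ G.Adj u y ∧ ml y = none
  out : keys (σ.tab .out) ⊆ keys mr ∪ keys ml

/-- The available memory is stated with `augCost p 0`, without the degree of `u`. Only the loop over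
the neighbours outside `L` has a duration that depends on this degree, and its memory is therefore
controlled separately. -/
theorem buildAux_spec {τ : Traversal V} {σ : State V} {W : ℕ} (ha : σ.reg .a = some u)
    (hm : Mat G L u (σ.fam .ML u) (σ.fam .MR u)) (hp : (keys (σ.fam .ML u)).card ≤ p)
    (hx : AuxOk p σ) (hn : NbrOk G L σ) (hR : ∀ x ∉ L, (lN G L x).card ≤ p) (hf : FamOk G σ)
    (hW : base G p + σ.held + Fintype.card V + augCost p 0 ≤ W) (hpk : σ.peak ≤ W) :
    AuxBuilt G L u (σ.fam .ML u) (σ.fam .MR u) (buildAux.run τ σ) ∧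
    DigraphOk p (buildAux.run τ σ) ∧
    (buildAux.run τ σ).time ≤ σ.time + 17 * p ^ 2 + 28 * p + 12 + G.degree u * (11 * p + 4) ∧
    (buildAux.run τ σ).peak ≤ W := by
  obtain ⟨h1, h2, h3, h4, h5, h6⟩ := auxInit_spec (τ := τ) ha hm hp hx
  set σ₁ := auxInit.run τ σ with hσ₁
  have hF₁ : Frame _ σ σ₁ := frame_run τ _ σ
  have hML₁ : σ₁.fam .ML = σ.fam .ML := hF₁.fam _
  have hMR₁ : σ₁.fam .MR = σ.fam .MR := hF₁.fam _
  have hNL₁ : σ₁.fam .NL = σ.fam .NL := hF₁.fam _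
  have hNR₁ : σ₁.fam .NR = σ.fam .NR := hF₁.fam _
  have hadj₁ : σ₁.fam .adj = σ.fam .adj := hF₁.fam _
  have ha₁ : σ₁.reg .a = some u := (hF₁.reg .a).trans ha
  have hd₁ : σ₁.held = σ.held := held_run τ _ σ
  have hpk₁ : σ₁.peak ≤ W := by
    refine (grow_run τ auxInit σ).peak_le (t := 4 * p ^ 2 + 24 * p + 10) (by rw [← hσ₁]; omega) hpk ?_
    have := words_le hf hx.toDigraphOk
    simp only [augCost] at hW
    omega
  have hAB₁ : ArcsBuilt σ₁ (σ₁.fam .MR u) fun _ _ => False := by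
    constructor
    · intro x y; rw [h2]; simp
    · intro y; rw [h4]; simp
    · intro y; rw [h4]; simp
    · rw [h4, h5]
  obtain ⟨h7, h8⟩ := auxRows_spec (τ := τ) hAB₁ ha₁
  -- The rows take time of order `p * deg u`, too long to charge one word per unit. At each row,
  -- however, the arcs built so far stay inside `auxVerts`, which bounds the tables, and a single
  -- row is short.
  have hpk₂ : ((forAll .b (.fam .NR .a) [forAll .c (.fam .ML .a) auxPair]).run τ σ₁).peak ≤ W := by
    have hcard : (keys (σ₁.get (.fam .NR .a))).card ≤ Fintype.card V := keys_card_le _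
    have hwords : ∀ (D : Finset V) (σ' : State V),
        ArcsBuilt σ' (σ₁.fam .MR u) (fun x y => x ∈ D ∧ y ∈ keys (σ₁.fam .ML u)) →
        Frame (forAll .b (.fam .NR .a) [forAll .c (.fam .ML .a) auxPair]) σ₁ σ' →
        σ'.held = σ₁.held + (keys (σ₁.get (.fam .NR .a))).card →
        σ'.words ≤ base G p + σ.held + Fintype.card V := by
      intro D σ' hI hF hh
      have hdg : DigraphOk p σ' := hI.digraphOk (hML₁ ▸ hMR₁ ▸ hm)
        (fun x y h => h.2) (by rw [hML₁]; exact hp) (by rw [hF.tab .auxVerts, hML₁, hMR₁]; exact h1)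
      have hfm : FamOk G σ' := by
        constructor
        · rw [hF.fam .adj, hadj₁]; exact hf.adj
        · rw [hF.fam .NL, hNL₁]; exact hf.NL
        · rw [hF.fam .NR, hNR₁]; exact hf.NR
        · rw [hF.fam .ML, hML₁]; exact hf.ML
        · rw [hF.fam .MR, hMR₁]; exact hf.MR
        · rw [hF.output, hF₁.output]; exact hf.output
      have := words_le hfm hdg
      omega
    refine forIn_peak (τ := τ) (r := .b) (d := .fam .NR .a) (c := .tt)
      (body := block [forAll .c (.fam .ML .a) auxPair]) (σ := σ₁)
      (fun D σ' => ArcsBuilt σ' (σ₁.fam .MR u) fun x y => x ∈ D ∧ y ∈ keys (σ₁.fam .ML u)) W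
      (fun _ _ _ _ _ _ h => ⟨h.1, h.2, h.3, h.4⟩) (hAB₁.congr (by simp))
      (fun D σ' hI hF hh => (hwords D σ' hI hF hh).trans (by omega)) ?_ hpk₁
    intro D x σ' hI hF hD hh hx' hxD hr hc hpk'
    obtain ⟨h9, h10⟩ := auxRows_step (τ := τ) ha₁ hI hF hr
    refine ⟨h9, peak_run_le h10 hpk' ?_⟩
    have := hwords D σ' hI hF hh
    rw [hML₁]
    simp only [augCost] at hW
    omega
  set σ₂ := (forAll .b (.fam .NR .a) [forAll .c (.fam .ML .a) auxPair]).run τ σ₁ with hσ₂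
  have hF₂ : Frame _ σ₁ σ₂ := frame_run τ _ σ₁
  have hML₂ : σ₂.fam .ML = σ.fam .ML := (hF₂.fam _).trans hML₁
  have hMR₂ : σ₂.fam .MR = σ.fam .MR := (hF₂.fam _).trans hMR₁
  have hNL₂ : σ₂.fam .NL = σ.fam .NL := (hF₂.fam _).trans hNL₁
  have hNR₂ : σ₂.fam .NR = σ.fam .NR := (hF₂.fam _).trans hNR₁
  have hadj₂ : σ₂.fam .adj = σ.fam .adj := (hF₂.fam _).trans hadj₁
  have ha₂ : σ₂.reg .a = some u := (hF₂.reg .a).trans ha₁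
  have hd₂ : σ₂.held = σ.held := (held_run τ _ σ₁).trans hd₁
  have hV₂ : keys (σ₂.tab .auxVerts) = keys (σ.fam .MR u) ∪ keys (σ.fam .ML u) := by
    rw [hF₂.tab .auxVerts]; exact h1
  have hS₂ : keys (σ₂.tab .S) = ∅ := by rw [hF₂.tab .S]; exact h3
  rw [hMR₁, hML₁, hNR₁] at h7
  rw [hML₁, hNR₁, hn.NR] at h8
  have hdg₂ : DigraphOk p σ₂ := h7.digraphOk hm (fun x y h => h.2) hp hV₂
  have hf₂ : FamOk G σ₂ := by
    constructor
    · rw [hadj₂]; exact hf.adj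
    · rw [hNL₂]; exact hf.NL
    · rw [hNR₂]; exact hf.NR
    · rw [hML₂]; exact hf.ML
    · rw [hMR₂]; exact hf.MR
    · rw [hF₂.output, hF₁.output]; exact hf.output
  obtain ⟨h9, h10⟩ := sources_spec (τ := τ) (σ := σ₂) (q := p) hS₂ ha₂ (by
    intro x hx
    rw [hMR₂] at hx
    rw [hNL₂, hn.NL]
    exact hR x (mem_rN.1 (hm.keys_right hx)).2)
  have hrun : buildAux.run τ σ =
    (forAll .b (.fam .MR .a) [forAll .c (.fam .NL .b) sourcePair]).run τ σ₂ := rfl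
  rw [hrun]
  have hg₃ := grow_run τ (forAll .b (.fam .MR .a) [forAll .c (.fam .NL .b) sourcePair]) σ₂
  set σ₃ := (forAll .b (.fam .MR .a) [forAll .c (.fam .NL .b) sourcePair]).run τ σ₂ with hσ₃
  have hF₃ : Frame _ σ₂ σ₃ := frame_run τ _ σ₂
  have hV₃ : σ₃.tab .auxVerts = σ₂.tab .auxVerts := hF₃.tab _
  have haux₃ : σ₃.fam .aux = σ₂.fam .aux := hF₃.fam _
  have hfree : ∀ y, σ₂.Free u y ↔ σ.fam .ML u y = none ∧ y ∉ lN G L u ∧ y ≠ u := by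
    intro y
    rw [State.Free, hML₂, hNL₂, ← hn.NL, not_mem_keys]
  rw [hMR₂] at h9 h10
  rw [hNL₂] at h9
  have hMRp : (keys (σ.fam .MR u)).card ≤ p := hm.card_eq ▸ hp
  have hto₂ : σ₃.time ≤ σ₂.time + (13 * p ^ 2 + 4 * p + 1) := by
    have := Nat.mul_le_mul_right (13 * p + 4) hMRp
    have e : p * (13 * p + 4) = 13 * p ^ 2 + 4 * p := by ring
    omega
  have hS : ∀ x, x ∈ keys (σ₃.tab .S) ↔ σ.fam .MR u x ≠ none ∧ ∃ y, G.Adj x y ∧ y ∈ L ∧ y ≠ u ∧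
      ¬ G.Adj u y ∧ σ.fam .ML u y = none := by
    intro x
    rw [h9.S]
    constructor
    · rintro ⟨y, ⟨h11, h12⟩, h13⟩
      rw [hn.NL, mem_lN] at h12
      rw [hfree, mem_lN] at h13
      refine ⟨fun h => not_mem_keys.2 h h11, y, h12.2, h12.1, h13.2.2, fun h => h13.2.1 ⟨h12.1, h⟩, h13.1⟩
    · rintro ⟨h11, y, h12, h13, h14, h15, h16⟩
      refine ⟨y, ⟨?_, ?_⟩, ?_⟩
      · rwa [← not_not (a := x ∈ _), not_mem_keys]
      · rw [hn.NL, mem_lN]; exact ⟨h13, h12⟩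
      · rw [hfree, mem_lN]; exact ⟨h16, fun h => h15 h.2, h14⟩
  have hT₃ : σ₃.tab .T = σ₂.tab .T := hF₃.tab _
  have hadjm : ∀ x y, y ∈ keys (σ₂.fam .adj x) ↔ G.Adj x y := by
    intro x y; rw [hadj₂, hn.adj]; simp
  have hT : ∀ y, y ∈ keys (σ₃.tab .T) ↔ σ.fam .ML u y ≠ none ∧ ∃ x, G.Adj u x ∧ x ∉ L ∧
      σ.fam .MR u x = none ∧ G.Adj x y := by
    intro y
    rw [hT₃, h7.T]
    simp only [hadjm, hn.NR, mem_rN]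
    constructor
    · rintro ⟨x, ⟨⟨h11, h12⟩, h13⟩, h14, h15⟩
      exact ⟨fun h => not_mem_keys.2 h h13, x, h11, h12, h14, h15⟩
    · rintro ⟨h11, x, h12, h13, h14, h15⟩
      refine ⟨x, ⟨⟨h12, h13⟩, ?_⟩, h14, h15⟩
      rwa [← not_not (a := y ∈ _), not_mem_keys]
  -- Targets lie in `L` and sources outside it, so the shared table `out` keeps its entries for the
  -- targets.
  have hST : ∀ y ∈ keys (σ₃.tab .T), y ∉ keys (σ₃.tab .S) := by
    intro y hy hy'
    exact ((hS y).1 hy').1 (hm.right_eq_none ((hT y).1 hy).1)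
  refine ⟨⟨?_, ?_, hT, ?_, hS, ?_, ?_⟩, ?_, ?_, ?_⟩
  · rw [hV₃]; exact hV₂
  · intro x y
    rw [haux₃, h7.arc]
    simp only [hadjm, hn.NR]
    constructor
    · rintro (⟨h11, h12⟩ | ⟨h11, h12, h13, h14⟩)
      · exact .inl h12
      · exact .inr ⟨fun h => not_mem_keys.2 h h11.2, h14, h12, h13⟩
    · rintro (h11 | ⟨h11, h12, h13, h14⟩)
      · exact .inl ⟨⟨hm.keys_right (mem_keys_iff.2 ⟨y, h11⟩),
          mem_keys_iff.2 ⟨x, (hm.inv _ _).2 h11⟩⟩, h11⟩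
      · refine .inr ⟨⟨hm.keys_right ?_, ?_⟩, h13, h14, h12⟩
        · rwa [← not_not (a := y ∈ _), not_mem_keys]
        · rwa [← not_not (a := x ∈ _), not_mem_keys]
  · intro y hy
    rw [h9.out' y (hST y hy)]
    rw [hT₃] at hy
    obtain ⟨x, h11, h12, h13, h14⟩ := h7.out y hy
    rw [hn.NR, mem_rN] at h12
    exact ⟨x, h11, h12.1.1, h12.1.2, h13, (hadjm _ _).1 h14⟩
  · intro x hx
    obtain ⟨y, h11, ⟨h12, h13⟩, h14⟩ := h9.out x hx
    rw [hn.NL, mem_lN] at h13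
    rw [hfree, mem_lN] at h14
    exact ⟨((hS x).1 hx).1, y, h11, h13.2, h13.1, h14.2.2, fun h => h14.2.1 ⟨h13.1, h⟩, h14.1⟩
  · intro x hx'
    rw [Finset.mem_union]
    by_cases hxS : x ∈ keys (σ₃.tab .S)
    · left
      rw [← not_not (a := x ∈ _), not_mem_keys]; exact ((hS x).1 hxS).1
    · right
      rw [mem_keys, h9.out' x hxS, ← mem_keys, h7.keys_out, ← hT₃, hT] at hx'
      rw [← not_not (a := x ∈ _), not_mem_keys]; exact hx'.1
  · exact ⟨by rw [hV₃, haux₃]; exact hdg₂.aux, by rw [hV₃, haux₃]; exact hdg₂.aux_sub,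
      by rw [hV₃]; exact hdg₂.card_le⟩
  · have h11 : (rN G L u).card ≤ G.degree u := rN_card_le_degree
    have h12 : (rN G L u).card * (11 * (keys (σ.fam .ML u)).card + 4) ≤
      G.degree u * (11 * p + 4) := Nat.mul_le_mul h11 (by omega)
    omega
  · refine hg₃.peak_le hto₂ hpk₂ ?_
    have := words_le hf₂ hdg₂
    simp only [augCost] at hW
    omega

/-- If the search fails, the visited set is closed under arcs, contains all sources and no target,
which is what König's cover needs. If it succeeds, the traced path is exchanged and the matching
grows. -/
theorem augmenting_spec {τ : Traversal V} {σ : State V} {W : ℕ} (ha : σ.reg .a = some u)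
    (hm : Mat G L u (σ.fam .ML u) (σ.fam .MR u)) (hp : (keys (σ.fam .ML u)).card ≤ p)
    (hx : AuxOk p σ) (hn : NbrOk G L σ) (hR : ∀ x ∉ L, (lN G L x).card ≤ p) (hf : FamOk G σ)
    (hW : base G p + σ.held + Fintype.card V + augCost p 0 ≤ W) (hpk : σ.peak ≤ W) :
    AuxOk p (augmenting.run τ σ) ∧
    Mat G L u ((augmenting.run τ σ).fam .ML u) ((augmenting.run τ σ).fam .MR u) ∧
    ((augmenting.run τ σ).flag .found = true →
      (keys (σ.fam .ML u)).card + 1 ≤ (keys ((augmenting.run τ σ).fam .ML u)).card) ∧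
    ((augmenting.run τ σ).flag .found = false →
      (augmenting.run τ σ).fam .ML u = σ.fam .ML u ∧
      HasCover G L u ((keys (σ.fam .ML u)).card + (lN G L u).card)) ∧
    (augmenting.run τ σ).time ≤ σ.time + augCost p (G.degree u) ∧
    (augmenting.run τ σ).peak ≤ W := by
  obtain ⟨h1, h2, h3, h4⟩ := buildAux_spec (τ := τ) ha hm hp hx hn hR hf hW hpk
  set σ₁ := buildAux.run τ σ with hσ₁
  have hF₁ : Frame _ σ σ₁ := frame_run τ _ σ
  have hML₁ : σ₁.fam .ML = σ.fam .ML := hF₁.fam _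
  have hMR₁ : σ₁.fam .MR = σ.fam .MR := hF₁.fam _
  have hd₁ : σ₁.held = σ.held := held_run τ _ σ
  have hSV : keys (σ₁.tab .S) ⊆ keys (σ₁.tab .auxVerts) := by
    intro x hx
    rw [h1.verts, Finset.mem_union]
    left
    rw [← not_not (a := x ∈ _), not_mem_keys]; exact (h1.S_out x hx).1
  have hTV : keys (σ₁.tab .T) ⊆ keys (σ₁.tab .auxVerts) := by
    intro x hx
    rw [h1.verts, Finset.mem_union]
    right
    rw [← not_not (a := x ∈ _), not_mem_keys]; exact ((h1.T x).1 hx).1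
  have hOV : keys (σ₁.tab .out) ⊆ keys (σ₁.tab .auxVerts) := by
    rw [h1.verts]; exact h1.out
  obtain ⟨h5, h6⟩ := searchPath_spec (τ := τ) (σ := σ₁) hSV h2.aux_sub
  set σ₂ := searchPath.run τ σ₁ with hσ₂
  have hF₂ : Frame _ σ₁ σ₂ := frame_run τ _ σ₁
  have hML₂ : σ₂.fam .ML = σ.fam .ML := (hF₂.fam _).trans hML₁
  have hMR₂ : σ₂.fam .MR = σ.fam .MR := (hF₂.fam _).trans hMR₁
  have hV₂ : σ₂.tab .auxVerts = σ₁.tab .auxVerts := hF₂.tab _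
  have hout₂ : σ₂.tab .out = σ₁.tab .out := hF₂.tab _
  have hep₂ : σ₂.tab .ePlus = σ.tab .ePlus := (hF₂.tab _).trans (hF₁.tab _)
  have hem₂ : σ₂.tab .eMinus = σ.tab .eMinus := (hF₂.tab _).trans (hF₁.tab _)
  have hA := h2.card_le
  have ht₂ : σ₂.time ≤ σ₁.time + (36 * p ^ 2 + 42 * p + 9) := by
    have e1 := hx.small .frontier (by decide)
    have e2 := hx.small .visited (by decide)
    have e3 := hx.small .parent (by decide)
    have e4 : (keys (σ₁.tab .auxVerts)).card * (9 * (keys (σ₁.tab .auxVerts)).card + 18) ≤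
      2 * p * (9 * (2 * p) + 18) := Nat.mul_le_mul hA (by omega)
    have e5 : 2 * p * (9 * (2 * p) + 18) = 36 * p ^ 2 + 36 * p := by ring
    rw [hF₁.tab .frontier, hF₁.tab .visited, hF₁.tab .parent] at h6
    omega
  have harc : ∀ x y, σ₂.tab .parent x = some y → σ.fam .MR u y = some x ∨
      (σ.fam .ML u y ≠ none ∧ σ.fam .MR u x ≠ none ∧ σ.fam .MR u x ≠ some y ∧ G.Adj x y) :=
    fun x y hxy => (h1.arc y x).1 (h5.search.arc x y hxy).1
  have hrun : augmenting.run τ σ = (when (.flag .found) [applyPath]).run τ σ₂ := rfl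
  have hfm₁ : FamOk G σ₁ := by
    constructor
    · rw [hF₁.fam .adj]; exact hf.adj
    · rw [hF₁.fam .NL]; exact hf.NL
    · rw [hF₁.fam .NR]; exact hf.NR
    · rw [hML₁]; exact hf.ML
    · rw [hMR₁]; exact hf.MR
    · rw [hF₁.output]; exact hf.output
  have hw₁ := words_le hfm₁ h2
  have hg : Grow σ₁ (augmenting.run τ σ) := (grow_run τ _ σ₁).trans (grow_run τ _ σ₂)
  -- After the digraph has been built, the remaining time is `O(p ^ 2)` whatever the degree, so the
  -- peak may be bounded by charging one word per unit.
  have hg' : ∀ t, (augmenting.run τ σ).time ≤ σ₂.time + t → t ≤ 46 * p + 30 →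
      (augmenting.run τ σ).time ≤ σ.time + augCost p (G.degree u) ∧
      (augmenting.run τ σ).peak ≤ W := by
    intro t ht htp
    simp only [augCost] at hW ⊢
    refine ⟨by omega, hg.peak_le (t := 36 * p ^ 2 + 88 * p + 39) (by omega) h4 (by omega)⟩
  have hsmall : ∀ d ∈ auxTabs, d ≠ .ePlus → d ≠ .eMinus →
      (keys (σ₂.tab d)).card ≤ 2 * p + 1 := by
    have key : ∀ s : Finset V, s ⊆ keys (σ₁.tab .auxVerts) → s.card ≤ 2 * p + 1 := fun s hs => by
      have := Finset.card_le_card hs; omega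
    intro d hd h7 h8
    simp only [auxTabs, Finset.mem_insert, Finset.mem_singleton] at hd
    rcases hd with rfl | rfl | rfl | rfl | rfl | rfl | rfl | rfl
    · rw [hF₂.tab .S]; exact key _ hSV
    · rw [hF₂.tab .T]; exact key _ hTV
    · rw [hout₂]; exact key _ hOV
    · exact key _ (h5.search.frontier.trans h5.search.sub)
    · exact key _ h5.search.sub
    · refine key _ fun x hx => ?_
      obtain ⟨y, hy⟩ := mem_keys_iff.1 hx
      exact h5.search.sub (h5.search.arc x y hy).2.1
    · exact absurd rfl h7
    · exact absurd rfl h8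
  have hep := hx.small .ePlus (by decide)
  have hem := hx.small .eMinus (by decide)
  cases hfound : σ₂.flag .found with
  | false =>
    have hrun' : augmenting.run τ σ = σ₂.charge 1 := by
      rw [hrun, run_when]; simp [hfound]
    have hML₃ : (augmenting.run τ σ).fam .ML = σ.fam .ML := by rw [hrun']; exact hML₂
    have hMR₃ : (augmenting.run τ σ).fam .MR = σ.fam .MR := by rw [hrun']; exact hMR₂
    have hfl₃ : (augmenting.run τ σ).flag .found = false := by rw [hrun']; exact hfound
    refine ⟨⟨⟨?_, ?_, ?_⟩, ?_⟩, by rw [hML₃, hMR₃]; exact hm, by simp [hfl₃],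
      fun _ => ⟨by rw [hML₃], ?_⟩, hg' 1 (by rw [hrun']; simp) (by omega)⟩
    · rw [hrun', State.tab_charge, State.fam_charge, hV₂, hF₂.fam .aux]; exact h2.aux
    · rw [hrun', State.tab_charge, State.fam_charge, hV₂, hF₂.fam .aux]; exact h2.aux_sub
    · rw [hrun', State.tab_charge, hV₂]; exact h2.card_le
    · intro d hd
      rw [hrun', State.tab_charge]
      by_cases h7 : d = .ePlus
      · rw [h7, hep₂]; exact hep
      by_cases h8 : d = .eMinus
      · rw [h8, hem₂]; exact hem
      exact hsmall d hd h7 h8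
    · have hnf := h5.not_found hfound
      refine hm.hasCover (keys (σ₂.tab .visited)) ?_ ?_ ?_ ?_ ?_
      · intro x y h7 h8 h9 h10 h11 h12
        exact h5.search.source ((h1.S x).2 ⟨h7, y, h8, h9, h10, h11, h12⟩)
      · intro x y h7 h8 h9 h10 h11 h12
        exact (hnf y h7).1 ((h1.T y).2 ⟨h8, x, h9, h10, h11, h12⟩)
      · intro x y h7 h8
        exact (hnf x h7).2 ((h1.arc x y).2 (.inl h8))
      · intro x y h7 h8 h9 h10 h11
        exact (hnf y h7).2 ((h1.arc y x).2 (.inr ⟨h8, h9, h11, h10⟩))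
      -- A vertex of `L` is never a source, and the only arc into it comes from its partner. If it
      -- was visited, then so was the partner.
      · intro x y h7 h8
        have hyl : σ.fam .ML u y ≠ none := by simp [h8]
        rcases h5.search.origin y h7 with h9 | ⟨z, h9, h10⟩
        · exact absurd (hm.right_eq_none hyl) (h1.S_out y h9).1
        · rcases (h1.arc z y).1 h10 with h11 | h11
          · have := (hm.inv _ _).2 h11
            obtain rfl : x = z := by simpa [h8] using this
            exact h9
          · exact absurd (hm.right_eq_none hyl) h11.2.1
  | true =>
    have hrun' : augmenting.run τ σ = applyPath.run τ (σ₂.charge 1) := by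
      rw [hrun, run_when]; simp [hfound]
    obtain ⟨t, ht, htT, htZ⟩ := h5.found hfound
    obtain ⟨l, hl, hlZ⟩ := h5.search.trace t htZ
    obtain ⟨o, ho, hou, hoL, hom, hot⟩ := h1.T_out t htT
    have hAP : AltPath G L u ((σ₂.charge 1).fam .ML u) ((σ₂.charge 1).fam .MR u)
        ((σ₂.charge 1).tab .parent) (keys (σ₁.tab .S)) ((σ₂.charge 1).tab .out) t o := by
      rw [State.fam_charge, State.tab_charge, hML₂, hMR₂, hout₂]
      exact ⟨hm, harc, ((h1.T t).1 htT).1, hou, hoL, hom, hot, h1.S_out⟩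
    obtain ⟨h7, h8, h9, h10, h11⟩ := applyPath_spec (τ := τ) (σ := σ₂.charge 1) hAP hl
      (fun z hz => by
        rw [State.tab_charge, hV₂]; exact h5.search.sub (hlZ z hz))
      ((hF₂.reg .a).trans ((hF₁.reg .a).trans ha)) ht (by rw [State.tab_charge, hout₂]; exact ho)
    rw [← hrun'] at h7 h8 h9 h10 h11
    have hF₃ : Frame _ (σ₂.charge 1) (augmenting.run τ σ) := hrun' ▸ frame_run τ applyPath _
    have hfl₃ : (augmenting.run τ σ).flag .found = true := (hF₃.flag .found).trans hfound
    simp only [State.tab_charge, State.fam_charge, State.time_charge, hV₂, hML₂, hep₂, hem₂]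
      at h8 h9 h10 h11
    have hV₃ : (augmenting.run τ σ).tab .auxVerts = σ₁.tab .auxVerts := (hF₃.tab .auxVerts).trans hV₂
    have hX₃ : (augmenting.run τ σ).fam .aux = σ₁.fam .aux :=
      (hF₃.fam .aux).trans (hF₂.fam .aux)
    refine ⟨⟨⟨?_, ?_, ?_⟩, ?_⟩, h7, fun _ => h8, by simp [hfl₃],
      hg' (46 * p + 19) (by omega) (by omega)⟩
    · rw [hV₃, hX₃]; exact h2.aux
    · rw [hV₃, hX₃]; exact h2.aux_sub
    · rw [hV₃]; exact h2.card_le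
    · intro d hd
      by_cases h12 : d = .ePlus
      · rw [h12]; omega
      by_cases h13 : d = .eMinus
      · rw [h13]; omega
      have h14 := hsmall d hd h12 h13
      simp only [auxTabs, Finset.mem_insert, Finset.mem_singleton] at hd
      have h15 : (augmenting.run τ σ).tab d = σ₂.tab d := by
        rcases hd with rfl | rfl | rfl | rfl | rfl | rfl | rfl | rfl
        · exact hF₃.tab _
        · exact hF₃.tab _
        · exact hF₃.tab _
        · exact hF₃.tab _
        · exact hF₃.tab _
        · exact hF₃.tab _
        · exact absurd rfl h12
        · exact absurd rfl h13
      rw [h15]; exact h14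

end

section
variable {V : Type u} [Fintype V] [DecidableEq V]

/-! ### The procedure Update -/

variable {G : SimpleGraph V} [DecidableRel G.Adj] {L : Finset V} {u v : V} {p : ℕ}

/-- If no neighbour of `x` in `L` is free, maximality already holds at the exceptional vertex `x`;
otherwise the edge that is added matches `x`. Either way the exception disappears. -/
theorem tryMatch_mat {τ : Traversal V} {σ : State V} (r o : Reg) (hr : r ≠ .u) (hro : r ≠ o)
    {x : V} (hu : σ.reg .u = some u) (ho : σ.reg o = some x) (hdone : σ.flag .done = false)
    (hNL : ∀ x, keys (σ.fam .NL x) = lN G L x)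
    (hm : PreMat G L u {x} (σ.fam .ML u) (σ.fam .MR u)) (hux : G.Adj u x) (hx : x ∉ L)
    (hmx : σ.fam .MR u x = none) :
    Mat G L u (((tryMatch r o).run τ σ).fam .ML u) (((tryMatch r o).run τ σ).fam .MR u) ∧
    (keys (σ.fam .ML u)).card ≤ (keys (((tryMatch r o).run τ σ).fam .ML u)).card ∧
    ((tryMatch r o).run τ σ).time ≤ σ.time + 15 * (lN G L x).card + 1 := by
  obtain ⟨h1, h2⟩ := tryMatch_spec (τ := τ) r o hr hro hu ho hdone
  have hfree : ∀ w, σ.Free u w ↔ σ.fam .ML u w = none ∧ w ∉ lN G L u ∧ w ≠ u := by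
    intro w; rw [State.Free, ← hNL, not_mem_keys]
  rw [hNL] at h1 h2
  refine ⟨?_, ?_, h2⟩
  · rcases h1 with ⟨h1, h3⟩ | ⟨w, h1, h3, h4, h5⟩
    · rw [h3]
      refine hm.of_no_edge fun w h4 h5 h6 h7 h8 => ?_
      exact h1 w (mem_lN.2 ⟨h5, h4⟩) ((hfree w).2 ⟨h8, fun h => h7 (mem_lN.1 h).2, h6⟩)
    · rw [h4, h5]
      obtain ⟨h6, h7, h8⟩ := (hfree w).1 h3
      obtain ⟨h9, h10⟩ := mem_lN.1 h1
      exact hm.add_edge hux hx hmx h10 h9 h6 h8 fun h => h7 (mem_lN.2 ⟨h9, h⟩)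
  · rcases h1 with ⟨h1, h3⟩ | ⟨w, h1, h3, h4, h5⟩
    · rw [h3]
    · rw [h4, keys_update_some]
      exact Finset.card_le_card (Finset.subset_insert _ _)

def moveNbrs : Stmt :=
  forAll .u (.fam .adj .v) [.delete (.fam .NL .u) .v, insertSet (.fam .NR .u) .v]

theorem moveNbrs_spec {τ : Traversal V} {σ : State V} (hv : σ.reg .v = some v) (hvL : v ∈ L)
    (hn : NbrOk G L σ) :
    NbrOk G (L.erase v) (moveNbrs.run τ σ) ∧
    (moveNbrs.run τ σ).time ≤ σ.time + 5 * G.degree v + 1 := by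
  obtain ⟨h1, h2⟩ := forAll_spec (τ := τ) (r := .u) (d := .fam .adj .v)
    (l := [.delete (.fam .NL .u) .v, insertSet (.fam .NR .u) .v]) (σ := σ)
    (fun D σ' => ∀ x, keys (σ'.fam .NL x) = (if x ∈ D then (lN G L x).erase v else lN G L x) ∧
      keys (σ'.fam .NR x) = (if x ∈ D then insert v (rN G L x) else rN G L x)) (fun _ => 2)
    (fun _ _ _ _ _ _ h => h) (fun x => by simp [hn.NL, hn.NR]) (by
      intro D x σ' hI hF hD hx hxD hr
      refine ⟨fun y => ?_, time_simple τ σ' _ rfl⟩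
      have hv' := (hF.reg .v).trans hv
      have hy := hI y
      by_cases hyx : y = x
      · subst hyx
        simp only [hxD, if_false] at hy
        simp [hv', hr, hy.1, hy.2]
      · simp only [Finset.mem_insert, hyx, false_or]
        simpa [hv', hr, hyx] using hy)
  have hget : keys (σ.get (.fam .adj .v)) = G.neighborFinset v := by simp [hv, hn.adj]
  rw [hget] at h1 h2
  have hF : Frame moveNbrs σ (moveNbrs.run τ σ) := frame_run τ _ σ
  refine ⟨⟨?_, fun x => ?_, fun x => ?_⟩, h2.trans ?_⟩
  · rw [hF.fam .adj]; exact hn.adj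
  · refine (h1 x).1.trans ?_
    rw [lN_erase]
    split
    · rfl
    · rename_i h
      rw [Finset.erase_eq_of_notMem]
      simp only [SimpleGraph.mem_neighborFinset] at h
      rw [mem_lN]; exact fun h' => h h'.2.symm
  · refine (h1 x).2.trans ?_
    ext y
    split <;> rename_i h <;> simp only [SimpleGraph.mem_neighborFinset] at h <;>
      simp only [Finset.mem_insert, mem_rN, Finset.mem_erase]
    · by_cases hy : y = v
      · subst hy; simp [h.symm]
      · simp [hy]
    · by_cases hy : y = v
      · subst hy
        have h' : ¬ G.Adj x y := fun e => h e.symm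
        simp [h']
      · simp [hy]
  · simp only [Finset.sum_const, smul_eq_mul, SimpleGraph.card_neighborFinset_eq_degree]
    omega

def rematchNbrs : Stmt :=
  forAll .u (.fam .NL .v) [.setFlag .done false, tryMatch .w .v, insertSet (.tab .check) .u]

/-- For each neighbour `u` in `L`, the vertex `v` is now an unmatched vertex outside `L`, and it is
the only threat to maximality. Different `u` own different tables, so the iterations do not
interfere. -/
theorem rematchNbrs_spec {τ : Traversal V} {σ : State V} (hv : σ.reg .v = some v) (hvL : v ∈ L)
    (hn : NbrOk G (L.erase v) σ) (hm : ∀ u ∈ L, Mat G L u (σ.fam .ML u) (σ.fam .MR u))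
    (hp : (lN G L v).card ≤ p) (hc : keys (σ.tab .check) = ∅) :
    (∀ u ∈ lN G L v, Mat G (L.erase v) u ((rematchNbrs.run τ σ).fam .ML u)
        ((rematchNbrs.run τ σ).fam .MR u) ∧
      (keys (σ.fam .ML u)).card ≤ (keys ((rematchNbrs.run τ σ).fam .ML u)).card) ∧
    (∀ u ∉ lN G L v, (rematchNbrs.run τ σ).fam .ML u = σ.fam .ML u ∧
      (rematchNbrs.run τ σ).fam .MR u = σ.fam .MR u) ∧
    keys ((rematchNbrs.run τ σ).tab .check) = lN G L v ∧
    (rematchNbrs.run τ σ).time ≤ σ.time + 15 * p ^ 2 + 6 * p + 1 := by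
  have hget : keys (σ.get (.fam .NL .v)) = lN G L v := by
    simp [hv, hn.NL, lN_erase_self]
  obtain ⟨⟨h1, h2, h3⟩, h4⟩ := forAll_spec (τ := τ) (r := .u) (d := .fam .NL .v)
    (l := [.setFlag .done false, tryMatch .w .v, insertSet (.tab .check) .u]) (σ := σ)
    (fun D σ' => (∀ u ∈ D, Mat G (L.erase v) u (σ'.fam .ML u) (σ'.fam .MR u) ∧
        (keys (σ.fam .ML u)).card ≤ (keys (σ'.fam .ML u)).card) ∧
      (∀ u ∉ D, σ'.fam .ML u = σ.fam .ML u ∧ σ'.fam .MR u = σ.fam .MR u) ∧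
      keys (σ'.tab .check) = D) (fun _ => 15 * p + 3)
    (fun _ _ _ _ _ _ h => h) (by simp [hc]) (by
      rintro D x σ' ⟨h1, h2, h3⟩ hF hD hx hxD hr
      rw [hget, mem_lN] at hx
      set σ₁ := (Stmt.setFlag .done false).run τ σ' with hσ₁
      have hv₁ : σ₁.reg .v = some v := (hF.reg .v).trans hv
      have hNL₁ : σ₁.fam .NL = σ.fam .NL := hF.fam .NL
      have hadj : G.Adj x v := hx.2.symm
      have hML : σ₁.fam .ML x = σ.fam .ML x := (h2 x hxD).1
      have hMR : σ₁.fam .MR x = σ.fam .MR x := (h2 x hxD).2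
      obtain ⟨h5, h6, h7⟩ := tryMatch_mat (τ := τ) (σ := σ₁) (L := L.erase v) .w .v
        (by decide) (by decide) hr hv₁ (by simp [hσ₁]) (by rw [hNL₁]; exact hn.NL)
        (by rw [hML, hMR]; exact (hm x hx.1).erase_of_adj hadj) hadj (by simp)
        (by
          rw [hMR]
          by_contra h
          exact (hm x hx.1).notMem_of_ne_none h hvL)
      set σ₂ := (tryMatch .w .v).run τ σ₁ with hσ₂
      have hF₂ : Frame _ σ₁ σ₂ := frame_run τ _ σ₁
      have hr₂ : σ₂.reg .u = some x := (hF₂.reg .u).trans hr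
      have hrun : (block [.setFlag .done false, tryMatch .w .v, insertSet (.tab .check) .u]).run τ
        σ' = (insertSet (.tab .check) .u).run τ σ₂ := rfl
      have hF₃ : Frame (block [.setFlag .done false, tryMatch .w .v, insertSet (.tab .check) .u])
        σ' _ := frame_run τ _ σ'
      have hne : ∀ y, y ≠ x → σ'.reg .u ≠ some y := fun y hy h => by
        rw [hr] at h; exact hy (by simpa using h.symm)
      refine ⟨⟨?_, ?_, ?_⟩, ?_⟩
      · intro y hy
        by_cases hyx : y = x
        · subst hyx
          rw [hrun]
          simp only [run_insertSet, run_insert, hr₂, State.fam_charge, State.fam_put_tab]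
          exact ⟨h5, hML ▸ h6⟩
        · have hyD := (Finset.mem_insert.1 hy).resolve_left hyx
          rw [hF₃.famOff .ML .u (hne y hyx), hF₃.famOff .MR .u (hne y hyx)]
          exact h1 y hyD
      · intro y hy
        rw [Finset.mem_insert, not_or] at hy
        rw [hF₃.famOff .ML .u (hne y hy.1), hF₃.famOff .MR .u (hne y hy.1)]
        exact h2 y hy.2
      · rw [hrun]
        simp only [run_insertSet, run_insert, hr₂, State.tab_charge, State.tab_put_tab,
          Function.update_self, State.get_tab, keys_update_some]
        rw [hF₂.tab .check]
        change insert x (keys (σ'.tab .check)) = _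
        rw [h3]
      · rw [hrun]
        simp only [run_insertSet, run_insert, hr₂, State.time_charge, State.time_put]
        have : σ₁.time = σ'.time + 1 := rfl
        rw [lN_erase_self] at h7
        omega)
  rw [hget] at h1 h2 h3 h4
  refine ⟨h1, h2, h3, h4.trans ?_⟩
  simp only [Finset.sum_const, smul_eq_mul]
  have := Nat.mul_le_mul_right (15 * p + 3 + 3) hp
  have e : p * (15 * p + 3 + 3) = 15 * p ^ 2 + 6 * p := by ring
  omega

def collect : Stmt :=
  forAll .x (.fam .MR .v) [
    forAll .u (.fam .NL .x) [when (.not (.eq .u .v)) [insertSet (.tab .union) .u]]]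

theorem collect_spec {τ : Traversal V} {σ : State V} (hv : σ.reg .v = some v) (hvL : v ∉ L)
    (hNL : ∀ x, keys (σ.fam .NL x) = lN G L x) (hp : (keys (σ.fam .MR v)).card ≤ p)
    (hR : ∀ x ∈ keys (σ.fam .MR v), (lN G L x).card ≤ p) (hc : keys (σ.tab .union) = ∅) :
    keys ((collect.run τ σ).tab .union) = (keys (σ.fam .MR v)).biUnion (lN G L) ∧
    (collect.run τ σ).time ≤ σ.time + 6 * p ^ 2 + 4 * p + 1 := by
  have hget : σ.get (.fam .MR .v) = σ.fam .MR v := by simp [hv]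
  obtain ⟨h1, h2⟩ := forAll_spec (τ := τ) (r := .x) (d := .fam .MR .v)
    (l := [forAll .u (.fam .NL .x) [when (.not (.eq .u .v)) [insertSet (.tab .union) .u]]]) (σ := σ)
    (fun D σ' => keys (σ'.tab .union) = D.biUnion (lN G L)) (fun _ => 6 * p + 1)
    (fun _ _ _ _ _ _ h => h) (by simp [hc]) (by
      intro D x σ' hI hF hD hx hxD hr
      rw [hget] at hx
      have hget' : keys (σ'.get (.fam .NL .x)) = lN G L x := by
        simp [hr, hF.fam .NL, hNL]
      obtain ⟨h3, h4⟩ := forAll_spec (τ := τ) (r := .u) (d := .fam .NL .x)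
        (l := [when (.not (.eq .u .v)) [insertSet (.tab .union) .u]]) (σ := σ')
        (fun E σ'' => keys (σ''.tab .union) = D.biUnion (lN G L) ∪ E) (fun _ => 3)
        (fun _ _ _ _ _ _ h => h) (by simp [hI]) (by
          intro E y σ'' hI' hF' _ hy _ hr'
          refine ⟨?_, time_simple τ σ'' _ rfl⟩
          have hv' : σ''.reg .v = some v := (hF'.reg .v).trans ((hF.reg .v).trans hv)
          rw [hget', mem_lN] at hy
          have hyv : y ≠ v := by rintro rfl; exact hvL hy.1
          simp [hr', hv', hyv, hI'])
      rw [hget'] at h3 h4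
      constructor
      · refine h3.trans ?_
        rw [Finset.biUnion_insert, Finset.union_comm]
      · have := hR x hx
        simp only [Finset.sum_const, smul_eq_mul] at h4
        refine h4.trans ?_
        omega)
  rw [hget] at h1 h2
  refine ⟨h1, h2.trans ?_⟩
  simp only [Finset.sum_const, smul_eq_mul]
  have := Nat.mul_le_mul_right (6 * p + 1 + 3) hp
  have e : p * (6 * p + 1 + 3) = 6 * p ^ 2 + 4 * p := by ring
  omega

def rematchBody : List Stmt := [
  when (.mem .v (.fam .ML .u)) [
    .lookup .z (.fam .ML .u) .v,
    removeEdge .u .v .z,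
    .setFlag .done false,
    tryMatch .y .z,
    insertSet (.tab .check) .u]]

/-- At most one edge is lost, namely the one at `v` when its other end finds no substitute; this is
the `+ 1`. -/
theorem rematchBody_spec {τ : Traversal V} {σ : State V} (hv : σ.reg .v = some v)
    (hu : σ.reg .u = some u) (hNL : ∀ x, keys (σ.fam .NL x) = lN G (L.erase v) x)
    (hm : v ∈ keys (σ.fam .ML u) → Mat G L u (σ.fam .ML u) (σ.fam .MR u))
    (hR : ∀ x ∉ L, (lN G L x).card ≤ p) :
    (v ∈ keys (σ.fam .ML u) → Mat G (L.erase v) u (((block rematchBody).run τ σ).fam .ML u)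
        (((block rematchBody).run τ σ).fam .MR u) ∧
      (keys (σ.fam .ML u)).card ≤ (keys (((block rematchBody).run τ σ).fam .ML u)).card + 1 ∧
      keys (((block rematchBody).run τ σ).tab .check) = insert u (keys (σ.tab .check))) ∧
    (v ∉ keys (σ.fam .ML u) → ((block rematchBody).run τ σ).fam = σ.fam ∧
      ((block rematchBody).run τ σ).tab = σ.tab) ∧
    ((block rematchBody).run τ σ).time ≤ σ.time + 15 * p + 7 := by
  by_cases hmem : v ∈ keys (σ.fam .ML u)
  · obtain ⟨z, hz⟩ := mem_keys_iff.1 hmem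
    have hM := hm hmem
    have hcond : (Cond.mem .v (.fam .ML .u)).eval σ = true := by simp [hv, hu, hz]
    set σ₁ := (block [.lookup .z (.fam .ML .u) .v, removeEdge .u .v .z, .setFlag .done false]).run τ
      (σ.charge 1) with hσ₁
    have hF₁ : Frame _ (σ.charge 1) σ₁ := frame_run τ _ _
    have ht₁ : σ₁.time ≤ (σ.charge 1).time + 4 := time_simple τ _ _ rfl
    have hz₁ : σ₁.reg .z = some z := by simp [hσ₁, hu, hv, hz, removeEdge]
    have hu₁ : σ₁.reg .u = some u := (hF₁.reg .u).trans hu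
    have hML₁ : σ₁.fam .ML u = Function.update (σ.fam .ML u) v none := by
      simp [hσ₁, hu, hv, hz, removeEdge]
    have hMR₁ : σ₁.fam .MR u = Function.update (σ.fam .MR u) z none := by
      simp [hσ₁, hu, hv, hz, removeEdge]
    obtain ⟨h1, h2, h3⟩ := tryMatch_mat (τ := τ) (σ := σ₁) (L := L.erase v) .y .z
      (by decide) (by decide) hu₁ hz₁ (by simp [hσ₁]) (by rw [hF₁.fam .NL]; exact hNL)
      (by rw [hML₁, hMR₁]; exact hM.erase_of_matched hz) (hM.adj hz)
      (fun h => hM.not_mem hz (Finset.mem_of_mem_erase h)) (by simp [hMR₁])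
    set σ₂ := (tryMatch .y .z).run τ σ₁ with hσ₂
    have hF₂ : Frame _ σ₁ σ₂ := frame_run τ _ σ₁
    have hu₂ : σ₂.reg .u = some u := (hF₂.reg .u).trans hu₁
    have hrun : (block rematchBody).run τ σ = (insertSet (.tab .check) .u).run τ σ₂ := by
      simp only [rematchBody, run_block_cons, run_block_nil, run_when, hcond, if_true]
      rfl
    refine ⟨fun _ => ⟨?_, ?_, ?_⟩, fun h => absurd hmem h, ?_⟩
    · rw [hrun]
      simpa only [run_insertSet, run_insert, hu₂, State.fam_charge, State.fam_put_tab] using h1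
    · rw [hrun]
      simp only [run_insertSet, run_insert, hu₂, State.fam_charge, State.fam_put_tab]
      rw [hML₁, keys_update_none, Finset.card_erase_of_mem hmem] at h2
      omega
    · rw [hrun]
      simp only [run_insertSet, run_insert, hu₂, State.tab_charge, State.tab_put_tab,
        Function.update_self, State.get_tab, keys_update_some]
      rw [hF₂.tab .check, hF₁.tab .check]
      rfl
    · rw [hrun]
      simp only [run_insertSet, run_insert, hu₂, State.time_charge, State.time_put]
      have h4 : (lN G (L.erase v) z).card ≤ p := by
        rw [lN_erase]
        exact (Finset.card_le_card (Finset.erase_subset _ _)).trans (hR z (hM.not_mem hz))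
      have : (σ.charge 1).time = σ.time + 1 := rfl
      omega
  · have h := not_mem_keys.1 hmem
    have hcond : (Cond.mem .v (.fam .ML .u)).eval σ = false := by simp [hv, hu, h]
    have hrun : (block rematchBody).run τ σ = σ.charge 1 := by
      simp only [rematchBody, run_block_cons, run_block_nil, run_when, hcond]
      rfl
    refine ⟨fun h => absurd h hmem, fun _ => ?_, ?_⟩
    · rw [hrun]; exact ⟨rfl, rfl⟩
    · rw [hrun]; simp only [State.time_charge]; omega

def rematchDist : Stmt := forAll .u (.tab .union) rematchBody

/-- The state of the matchings after the vertices in `D` have been treated. -/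
structure Rematched (G : SimpleGraph V) [DecidableRel G.Adj] (L : Finset V) (v : V) (σ : State V)
    (D : Finset V) (σ' : State V) : Prop where
  changed : ∀ u ∈ D, v ∈ keys (σ.fam .ML u) →
    Mat G (L.erase v) u (σ'.fam .ML u) (σ'.fam .MR u) ∧
    (keys (σ.fam .ML u)).card ≤ (keys (σ'.fam .ML u)).card + 1 ∧ u ∈ keys (σ'.tab .check)
  same : ∀ u, (u ∉ D ∨ v ∉ keys (σ.fam .ML u)) →
    σ'.fam .ML u = σ.fam .ML u ∧ σ'.fam .MR u = σ.fam .MR u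
  check : keys (σ.tab .check) ⊆ keys (σ'.tab .check)
  mem_check : ∀ u ∈ keys (σ'.tab .check), u ∈ keys (σ.tab .check) ∨
    (u ∈ D ∧ v ∈ keys (σ.fam .ML u))

theorem rematchDist_step {τ : Traversal V} {σ σ' : State V} {D : Finset V} {x : V}
    (hv : σ.reg .v = some v) (hNL : ∀ x, keys (σ.fam .NL x) = lN G (L.erase v) x)
    (hm : ∀ u, v ∈ keys (σ.fam .ML u) → Mat G L u (σ.fam .ML u) (σ.fam .MR u))
    (hR : ∀ x ∉ L, (lN G L x).card ≤ p) (hI : Rematched G L v σ D σ')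
    (hF : Frame rematchDist σ σ') (hxD : x ∉ D) (hr : σ'.reg .u = some x) :
    Rematched G L v σ (insert x D) ((block rematchBody).run τ σ') ∧
    ((block rematchBody).run τ σ').time ≤ σ'.time + (15 * p + 7) := by
  have hs := hI.same x (.inl hxD)
  obtain ⟨h1, h2, h3⟩ := rematchBody_spec (τ := τ) (G := G) (p := p) ((hF.reg .v).trans hv) hr
    (by rw [hF.fam .NL]; exact hNL) (by rw [hs.1, hs.2]; exact hm x) hR
  rw [hs.1] at h1 h2
  have hF' : Frame (block rematchBody) σ' _ := frame_run τ _ σ'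
  have hne : ∀ y, y ≠ x → σ'.reg .u ≠ some y := fun y hy h => by
    rw [hr] at h; exact hy (by simpa using h.symm)
  refine ⟨⟨?_, ?_, ?_, ?_⟩, h3⟩
  · intro y hy hvy
    by_cases hyx : y = x
    · subst hyx
      obtain ⟨h4, h5, h6⟩ := h1 hvy
      exact ⟨h4, h5, by rw [h6]; simp⟩
    · obtain ⟨h4, h5, h6⟩ := hI.changed y ((Finset.mem_insert.1 hy).resolve_left hyx) hvy
      rw [hF'.famOff .ML .u (hne y hyx), hF'.famOff .MR .u (hne y hyx)]
      refine ⟨h4, h5, ?_⟩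
      by_cases hvx : v ∈ keys (σ.fam .ML x)
      · rw [(h1 hvx).2.2]; exact Finset.mem_insert_of_mem h6
      · rw [(h2 hvx).2]; exact h6
  · intro y hy
    by_cases hyx : y = x
    · subst hyx
      have hvy : v ∉ keys (σ.fam .ML y) := by simpa using hy
      rw [(h2 hvy).1]; exact hs
    · rw [hF'.famOff .ML .u (hne y hyx), hF'.famOff .MR .u (hne y hyx)]
      exact hI.same y (by simpa [hyx] using hy)
  · by_cases hvx : v ∈ keys (σ.fam .ML x)
    · rw [(h1 hvx).2.2]; exact hI.check.trans (Finset.subset_insert _ _)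
    · rw [(h2 hvx).2]; exact hI.check
  · intro y hy
    by_cases hvx : v ∈ keys (σ.fam .ML x)
    · rw [(h1 hvx).2.2, Finset.mem_insert] at hy
      rcases hy with rfl | hy
      · exact .inr ⟨by simp, hvx⟩
      · exact (hI.mem_check y hy).imp id fun h => ⟨Finset.mem_insert_of_mem h.1, h.2⟩
    · rw [(h2 hvx).2] at hy
      exact (hI.mem_check y hy).imp id fun h => ⟨Finset.mem_insert_of_mem h.1, h.2⟩

/-- Up to `p ^ 2` iterations of time `O(p)` exceed the permitted memory if one word is charged per
unit. The peak is bounded through the sizes of the matchings at each iteration. -/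
theorem rematchDist_spec {τ : Traversal V} {σ : State V} {W : ℕ}
    (hv : σ.reg .v = some v) (hNL : ∀ x, keys (σ.fam .NL x) = lN G (L.erase v) x)
    (hm : ∀ u, v ∈ keys (σ.fam .ML u) → Mat G L u (σ.fam .ML u) (σ.fam .MR u))
    (hR : ∀ x ∉ L, (lN G L x).card ≤ p) (hU : (keys (σ.tab .union)).card ≤ p ^ 2)
    (hf : FamOk G σ) (hd : DigraphOk p σ)
    (hW : base G p + σ.held + Fintype.card V + (15 * p + 7) ≤ W) (hpk : σ.peak ≤ W) :
    Rematched G L v σ (keys (σ.tab .union)) (rematchDist.run τ σ) ∧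
    (rematchDist.run τ σ).time ≤ σ.time + 15 * p ^ 3 + 10 * p ^ 2 + 1 ∧
    (rematchDist.run τ σ).peak ≤ W := by
  have hst : Stable .u (Rematched G L v σ) :=
    fun _ _ _ _ _ _ h => ⟨h.1, h.2, h.3, h.4⟩
  have h0 : Rematched G L v σ ∅ σ := ⟨by simp, by simp, subset_rfl, fun u h => .inl h⟩
  obtain ⟨h1, h2⟩ := forAll_spec (τ := τ) (r := .u) (d := .tab .union) (l := rematchBody) (σ := σ)
    (Rematched G L v σ) (fun _ => 15 * p + 7) hst h0
    (fun D x σ' hI hF _ _ hxD hr => rematchDist_step hv hNL hm hR hI hF hxD hr)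
  refine ⟨h1, h2.trans ?_, ?_⟩
  · simp only [Finset.sum_const, smul_eq_mul, State.get_tab]
    have := Nat.mul_le_mul_right (15 * p + 7 + 3) hU
    have e : p ^ 2 * (15 * p + 7 + 3) = 15 * p ^ 3 + 10 * p ^ 2 := by ring
    omega
  · have hwords : ∀ (D : Finset V) (σ' : State V), Rematched G L v σ D σ' →
        Frame rematchDist σ σ' → σ'.held = σ.held + (keys (σ.get (.tab .union))).card →
        σ'.words ≤ base G p + σ.held + Fintype.card V := by
      intro D σ' hI hF hh
      have hcases : ∀ u, ((keys (σ'.fam .ML u)).card ≤ G.degree u) ∧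
          ((keys (σ'.fam .MR u)).card ≤ G.degree u) := by
        intro u
        by_cases h : u ∈ D ∧ v ∈ keys (σ.fam .ML u)
        · have h3 := (hI.changed u h.1 h.2).1
          exact ⟨h3.card_le_degree, h3.card_eq ▸ h3.card_le_degree⟩
        · have h3 := hI.same u (by tauto)
          rw [h3.1, h3.2]
          exact ⟨hf.ML u, hf.MR u⟩
      have hfm : FamOk G σ' := by
        constructor
        · rw [hF.fam .adj]; exact hf.adj
        · rw [hF.fam .NL]; exact hf.NL
        · rw [hF.fam .NR]; exact hf.NR
        · exact fun u => (hcases u).1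
        · exact fun u => (hcases u).2
        · rw [hF.output]; exact hf.output
      have hdg : DigraphOk p σ' := ⟨by rw [hF.fam .aux, hF.tab .auxVerts]; exact hd.aux,
        by rw [hF.fam .aux, hF.tab .auxVerts]; exact hd.aux_sub,
        by rw [hF.tab .auxVerts]; exact hd.card_le⟩
      have := words_le hfm hdg
      have := keys_card_le (σ.get (.tab .union))
      omega
    refine forIn_peak (τ := τ) (r := .u) (d := .tab .union) (c := .tt) (body := block rematchBody)
      (σ := σ) (Rematched G L v σ) W hst h0
      (fun D σ' hI hF hh => (hwords D σ' hI hF hh).trans (by omega)) ?_ hpk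
    intro D x σ' hI hF _ hh _ hxD hr _ hpk'
    obtain ⟨h3, h4⟩ := rematchDist_step (τ := τ) hv hNL hm hR hI hF hxD hr
    exact ⟨h3, peak_run_le h4 hpk' (by have := hwords D σ' hI hF hh; omega)⟩

end

section
variable {V : Type u} [Fintype V] [DecidableEq V]

/-! ### The invariant of Main -/

variable {G : SimpleGraph V} [DecidableRel G.Adj] {L : Finset V} {u v : V} {p : ℕ}

variable (G) in
/-- The invariant of Main, where the vertices in `B` are candidates or the root of a matching that
is too large. -/
structure Inv (p : ℕ) (L B : Finset V) (σ : State V) : Prop extends NbrOk G L σ, AuxOk p σ where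
  ctr : σ.ctr .p = p
  mat : ∀ u ∈ L, Mat G L u (σ.fam .ML u) (σ.fam .MR u)
  none : ∀ u ∉ L, σ.fam .ML u = (fun _ => none) ∧ σ.fam .MR u = fun _ => none
  right : ∀ x ∉ L, (lN G L x).card ≤ p
  cand : keys (σ.tab .cand) ⊆ L
  cover : ∀ u ∈ keys (σ.tab .cand), HasCover G L u p
  big : ∀ u ∈ B, u ∉ keys (σ.tab .cand) → p + 1 ≤ (keys (σ.fam .ML u)).card + (lN G L u).card
  check : (keys (σ.tab .check)).card ≤ p ^ 2 + p
  union : (keys (σ.tab .union)).card ≤ p ^ 2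
  output : σ.output.length ≤ Fintype.card V

theorem NbrOk.famOk {σ : State V} (h : NbrOk G L σ)
    (hm : ∀ u, (keys (σ.fam .ML u)).card ≤ G.degree u ∧ (keys (σ.fam .MR u)).card ≤ G.degree u)
    (ho : σ.output.length ≤ Fintype.card V) : FamOk G σ where
  adj x := by rw [h.adj, SimpleGraph.card_neighborFinset_eq_degree]
  NL x := by rw [h.NL]; exact lN_card_le_degree
  NR x := by rw [h.NR]; exact rN_card_le_degree
  ML x := (hm x).1
  MR x := (hm x).2
  output := ho

theorem PreMat.cards_le_degree {S : Set V} {ml mr : Table V} (h : PreMat G L u S ml mr) :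
    (keys ml).card ≤ G.degree u ∧ (keys mr).card ≤ G.degree u :=
  ⟨h.card_le_degree, h.card_eq ▸ h.card_le_degree⟩

theorem Inv.cards_le_degree {B : Finset V} {σ : State V} (h : Inv G p L B σ) (u : V) :
    (keys (σ.fam .ML u)).card ≤ G.degree u ∧ (keys (σ.fam .MR u)).card ≤ G.degree u := by
  by_cases hu : u ∈ L
  · exact (h.mat u hu).cards_le_degree
  · rw [(h.none u hu).1, (h.none u hu).2]; simp

theorem Inv.famOk {B : Finset V} {σ : State V} (h : Inv G p L B σ) : FamOk G σ :=
  h.toNbrOk.famOk h.cards_le_degree h.output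

/-! ### The matchings after the removal of a vertex -/

/-- The first part of Update: the data structures are adapted. -/
def rematch : Stmt := block [.clear (.tab .check), moveNbrs, rematchNbrs, .clear (.tab .union),
  collect, rematchDist]

variable (G) in
/-- The effect of the first part of Update. -/
structure RematchedAll (p : ℕ) (L : Finset V) (v : V) (σ σ' : State V) : Prop
    extends NbrOk G (L.erase v) σ' where
  mat : ∀ u ∈ L.erase v, Mat G (L.erase v) u (σ'.fam .ML u) (σ'.fam .MR u)
  off : ∀ u ∉ L.erase v, σ'.fam .ML u = σ.fam .ML u ∧ σ'.fam .MR u = σ.fam .MR u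
  le : ∀ u ∈ L.erase v, (keys (σ.fam .ML u)).card + (lN G L u).card ≤
    (keys (σ'.fam .ML u)).card + (lN G (L.erase v) u).card + 1
  le_of_notMem : ∀ u ∈ L.erase v, u ∉ keys (σ'.tab .check) →
    (keys (σ.fam .ML u)).card + (lN G L u).card ≤
    (keys (σ'.fam .ML u)).card + (lN G (L.erase v) u).card
  check : ∀ u ∈ keys (σ'.tab .check), u ∈ L.erase v ∧ (G.Adj u v ∨ v ∈ reach G L u)
  check_card : (keys (σ'.tab .check)).card ≤ p ^ 2 + p
  union_card : (keys (σ'.tab .union)).card ≤ p ^ 2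

/-- Let `v` be matched to `z` by `u`. If `z` is also matched by `v`, then `u` is a neighbour of `z`
in `L`. If not, maximality of the matching of `v`, applied to the edge from `z` to `u`, shows that
`u` itself is matched there, and its partner leads to `u`. So the third loop finds every affected
vertex by looking only at the matching of `v`. -/
theorem mem_biUnion_of_matched {σ : State V} (hv : v ∈ L)
    (hm : ∀ u ∈ L, Mat G L u (σ.fam .ML u) (σ.fam .MR u)) (hu : u ∈ L)
    (h : v ∈ keys (σ.fam .ML u)) :
    u ∈ (keys (σ.fam .MR v)).biUnion (lN G (L.erase v)) ∧ v ∈ reach G L u := by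
  obtain ⟨z, hz⟩ := mem_keys_iff.1 h
  have hM := hm u hu
  have hne := hM.ne hz
  have huv := hM.not_adj hz
  refine ⟨?_, mem_reach.2 ⟨⟨hne, hv⟩, huv, z, hM.adj hz, hM.not_mem hz, hM.edge hz⟩⟩
  rw [Finset.mem_biUnion]
  have hu' : u ∈ L.erase v := Finset.mem_erase.2 ⟨hne.symm, hu⟩
  by_cases hr : σ.fam .MR v z = none
  · have h1 := (hm v hv).maximal z u (by simp) (hM.edge hz).symm (hM.not_mem hz) hr (hM.adj hz).symm
      hu hne.symm fun e => huv e.symm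
    obtain ⟨x, hx⟩ := Option.ne_none_iff_exists'.1 h1
    exact ⟨x, mem_keys_iff.2 ⟨u, ((hm v hv).inv _ _).1 hx⟩, mem_lN.2 ⟨hu', (hm v hv).edge hx⟩⟩
  · exact ⟨z, mem_keys_iff.2 (Option.ne_none_iff_exists'.1 hr), mem_lN.2 ⟨hu', (hM.adj hz).symm⟩⟩

/-- Vertices of `L` other than `v` are of three kinds: neighbours of `v` lose a neighbour in `L` but
no matching edge, vertices that had matched `v` lose at most one edge, and all others keep both
terms. The first two kinds are in `check`, so an unchecked vertex suffers no loss. -/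
theorem rematch_spec {τ : Traversal V} {σ : State V} {B : Finset V} {W : ℕ}
    (hv : σ.reg .v = some v) (hvL : v ∈ L) (h : Inv G p L B σ) (hc : HasCover G L v p)
    (hW : base G p + σ.held + 6 * Fintype.card V + (24 * p ^ 2 + 30 * p + 20) ≤ W)
    (hpk : σ.peak ≤ W) :
    RematchedAll G p L v σ (rematch.run τ σ) ∧
    (rematch.run τ σ).time ≤ σ.time + 15 * p ^ 3 + 34 * p ^ 2 + 11 * p + 6 + 5 * G.degree v ∧
    (rematch.run τ σ).peak ≤ W := by
  have hMR : (keys (σ.fam .MR v)).card ≤ p := by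
    have h1 := (h.mat v hvL).card_add_le hc
    have h2 := (h.mat v hvL).card_eq
    omega
  have hlv : (lN G L v).card ≤ p := hc.lN_card_le
  set σ₁ := (Stmt.clear (.tab .check)).run τ σ with hσ₁
  have hF₁ : Frame _ σ σ₁ := frame_run τ _ σ
  have ht₁ : σ₁.time = σ.time + ((keys (σ.tab .check)).card + 1) := by simp [hσ₁]
  have hn₁ : NbrOk G L σ₁ := ⟨by rw [hF₁.fam .adj]; exact h.adj, by rw [hF₁.fam .NL]; exact h.NL,
    by rw [hF₁.fam .NR]; exact h.NR⟩
  have hv₁ : σ₁.reg .v = some v := (hF₁.reg .v).trans hv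
  obtain ⟨hn₂, ht₂⟩ := moveNbrs_spec (τ := τ) hv₁ hvL hn₁
  set σ₂ := moveNbrs.run τ σ₁ with hσ₂
  have hF₂ : Frame _ σ₁ σ₂ := frame_run τ _ σ₁
  have hv₂ : σ₂.reg .v = some v := (hF₂.reg .v).trans hv₁
  have hML₂ : σ₂.fam .ML = σ.fam .ML := (hF₂.fam _).trans (hF₁.fam _)
  have hMR₂ : σ₂.fam .MR = σ.fam .MR := (hF₂.fam _).trans (hF₁.fam _)
  obtain ⟨h3, h3', hc₃, ht₃⟩ := rematchNbrs_spec (τ := τ) (p := p) hv₂ hvL hn₂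
    (by rw [hML₂, hMR₂]; exact h.mat) hlv (by rw [hF₂.tab .check]; simp [hσ₁])
  rw [hML₂] at h3 h3'
  rw [hMR₂] at h3'
  set σ₃ := rematchNbrs.run τ σ₂ with hσ₃
  have hF₃ : Frame _ σ₂ σ₃ := frame_run τ _ σ₂
  have hv₃ : σ₃.reg .v = some v := (hF₃.reg .v).trans hv₂
  set σ₄ := (Stmt.clear (.tab .union)).run τ σ₃ with hσ₄
  have hF₄ : Frame _ σ₃ σ₄ := frame_run τ _ σ₃
  have ht₄ : σ₄.time = σ₃.time + ((keys (σ.tab .union)).card + 1) := by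
    rw [← hF₁.tab .union, ← hF₂.tab .union, ← hF₃.tab .union]; simp [hσ₄]
  have hv₄ : σ₄.reg .v = some v := (hF₄.reg .v).trans hv₃
  have hvlv : v ∉ lN G L v := by simp
  have hMRv : σ₄.fam .MR v = σ.fam .MR v := by rw [hF₄.fam .MR]; exact (h3' v hvlv).2
  have hNL₄ : ∀ x, keys (σ₄.fam .NL x) = lN G (L.erase v) x := by
    rw [hF₄.fam .NL, hF₃.fam .NL]; exact hn₂.NL
  have hR' : ∀ x ∉ L, (lN G (L.erase v) x).card ≤ p := fun x hx => by
    rw [lN_erase]; exact (Finset.card_le_card (Finset.erase_subset _ _)).trans (h.right x hx)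
  obtain ⟨h5, ht₅⟩ := collect_spec (τ := τ) (L := L.erase v) (p := p) hv₄ (by simp) hNL₄
    (by rw [hMRv]; exact hMR)
    (by
      rw [hMRv]
      exact fun x hx => hR' x (mem_rN.1 ((h.mat v hvL).keys_right hx)).2)
    (by simp [hσ₄])
  rw [hMRv] at h5
  set σ₅ := collect.run τ σ₄ with hσ₅
  have hF₅ : Frame _ σ₄ σ₅ := frame_run τ _ σ₄
  have hv₅ : σ₅.reg .v = some v := (hF₅.reg .v).trans hv₄
  have hML₅ : σ₅.fam .ML = σ₃.fam .ML := (hF₅.fam _).trans (hF₄.fam _)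
  have hMR₅ : σ₅.fam .MR = σ₃.fam .MR := (hF₅.fam _).trans (hF₄.fam _)
  have hU : (keys (σ₅.tab .union)).card ≤ p ^ 2 := by
    rw [h5, pow_two]
    refine (Finset.card_biUnion_le_card_mul _ _ p fun x hx => hR' x
      (mem_rN.1 ((h.mat v hvL).keys_right hx)).2).trans (Nat.mul_le_mul_right p hMR)
  have hnot : ∀ u ∈ lN G L v, v ∉ keys (σ₃.fam .ML u) := fun u hu hvu => by
    simpa using (h3 u hu).1.keys_left hvu
  have hin : ∀ u, v ∈ keys (σ₃.fam .ML u) → u ∈ L ∧ u ≠ v ∧ u ∉ lN G L v ∧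
      v ∈ keys (σ.fam .ML u) := by
    intro u hu
    have h6 : u ∉ lN G L v := fun h6 => hnot u h6 hu
    rw [(h3' u h6).1] at hu
    have h7 : u ∈ L := by
      by_contra h7
      rw [(h.none u h7).1] at hu
      simp at hu
    refine ⟨h7, ?_, h6, hu⟩
    rintro rfl
    obtain ⟨z, hz⟩ := mem_keys_iff.1 hu
    exact (h.mat u h7).ne hz rfl
  have hn₅ : NbrOk G (L.erase v) σ₅ := ⟨
    by rw [hF₅.fam .adj, hF₄.fam .adj, hF₃.fam .adj]; exact hn₂.adj,
    by rw [hF₅.fam .NL]; exact hNL₄,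
    by rw [hF₅.fam .NR, hF₄.fam .NR, hF₃.fam .NR]; exact hn₂.NR⟩
  have hf₅ : FamOk G σ₅ := by
    refine hn₅.famOk (fun u => ?_) ?_
    · rw [hML₅, hMR₅]
      by_cases hu : u ∈ lN G L v
      · exact (h3 u hu).1.cards_le_degree
      · rw [(h3' u hu).1, (h3' u hu).2]; exact h.cards_le_degree u
    · rw [hF₅.output, hF₄.output, hF₃.output, hF₂.output, hF₁.output]; exact h.output
  have hd₅ : DigraphOk p σ₅ := by
    have e1 : σ₅.fam .aux = σ.fam .aux := by
      rw [hF₅.fam .aux, hF₄.fam .aux, hF₃.fam .aux, hF₂.fam .aux, hF₁.fam .aux]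
    have e2 : σ₅.tab .auxVerts = σ.tab .auxVerts := by
      rw [hF₅.tab .auxVerts, hF₄.tab .auxVerts, hF₃.tab .auxVerts, hF₂.tab .auxVerts,
        hF₁.tab .auxVerts]
    exact ⟨by rw [e1, e2]; exact h.aux, by rw [e1, e2]; exact h.aux_sub, by
      rw [e2]; exact h.card_le⟩
  have hh₅ : σ₅.held = σ.held := by simp only [hσ₅, hσ₄, hσ₃, hσ₂, hσ₁, held_run]
  have hdeg : G.degree v ≤ Fintype.card V := (G.degree_lt_card_verts v).le
  have hch := h.check
  have hun := h.union
  -- Everything before the loop over `union` is short enough for its memory to be bounded by its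
  -- time, using that a degree is at most `n`.
  have htt : σ₅.time ≤ σ.time + (24 * p ^ 2 + 11 * p + 5 + 5 * G.degree v) := by omega
  have hpk₅ : σ₅.peak ≤ W := by
    have hg : Grow σ σ₅ := (grow_run τ _ σ).trans ((grow_run τ _ σ₁).trans ((grow_run τ _ σ₂).trans
      ((grow_run τ _ σ₃).trans (grow_run τ _ σ₄))))
    refine hg.peak_le htt hpk ?_
    have := words_le h.famOk h.toDigraphOk
    omega
  obtain ⟨h6, ht₆, hpk₆⟩ := rematchDist_spec (τ := τ) (L := L) (W := W) hv₅ hn₅.NL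
    (by
      rw [hML₅, hMR₅]
      intro u hu
      obtain ⟨h7, h8, h9, -⟩ := hin u hu
      rw [(h3' u h9).1, (h3' u h9).2]; exact h.mat u h7)
    h.right hU hf₅ hd₅ (by rw [hh₅]; omega) hpk₅
  have hrun : rematch.run τ σ = rematchDist.run τ σ₅ := rfl
  rw [hrun]
  set σ₆ := rematchDist.run τ σ₅ with hσ₆
  have hF₆ : Frame _ σ₅ σ₆ := frame_run τ _ σ₅
  have hc₅ : σ₅.tab .check = σ₃.tab .check := (hF₅.tab _).trans (hF₄.tab _)
  have hch₆ := h6.mem_check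
  have hchs := h6.check
  rw [hc₅, hc₃] at hch₆ hchs
  rw [hML₅] at hch₆
  -- neighbours of `v`
  have hA : ∀ u ∈ lN G L v, σ₆.fam .ML u = σ₃.fam .ML u ∧ σ₆.fam .MR u = σ₃.fam .MR u := by
    intro u hu
    have := h6.same u (.inr (by rw [hML₅]; exact hnot u hu))
    rwa [hML₅, hMR₅] at this
  -- vertices whose matching loses an edge
  have hB : ∀ u, v ∈ keys (σ₃.fam .ML u) → Mat G (L.erase v) u (σ₆.fam .ML u) (σ₆.fam .MR u) ∧
      (keys (σ.fam .ML u)).card ≤ (keys (σ₆.fam .ML u)).card + 1 ∧ u ∈ keys (σ₆.tab .check) := by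
    intro u hu
    obtain ⟨h7, h8, h9, h10⟩ := hin u hu
    have := h6.changed u (by rw [h5]; exact (mem_biUnion_of_matched hvL h.mat h7 h10).1)
      (by rw [hML₅]; exact hu)
    rwa [hML₅, (h3' u h9).1] at this
  -- all other vertices
  have hC : ∀ u, u ∉ lN G L v → v ∉ keys (σ₃.fam .ML u) →
      σ₆.fam .ML u = σ.fam .ML u ∧ σ₆.fam .MR u = σ.fam .MR u := by
    intro u hu hvu
    have := h6.same u (.inr (by rw [hML₅]; exact hvu))
    rwa [hML₅, hMR₅, (h3' u hu).1, (h3' u hu).2] at this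
  have hadj : ∀ u ∈ L, u ∉ lN G L v → ¬ G.Adj u v := fun u hu hn ha =>
    hn (mem_lN.2 ⟨hu, ha.symm⟩)
  refine ⟨⟨⟨?_, ?_, ?_⟩, ?_, ?_, ?_, ?_, ?_, ?_, ?_⟩, ?_, hpk₆⟩
  · rw [hF₆.fam .adj]; exact hn₅.adj
  · rw [hF₆.fam .NL]; exact hn₅.NL
  · rw [hF₆.fam .NR]; exact hn₅.NR
  · intro u hu
    have huL := Finset.mem_of_mem_erase hu
    by_cases h7 : u ∈ lN G L v
    · rw [(hA u h7).1, (hA u h7).2]; exact (h3 u h7).1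
    · by_cases h8 : v ∈ keys (σ₃.fam .ML u)
      · exact (hB u h8).1
      · rw [(hC u h7 h8).1, (hC u h7 h8).2]
        rw [(h3' u h7).1] at h8
        exact (h.mat u huL).erase_of_not_adj (hadj u huL h7) (not_mem_keys.1 h8)
  · intro u hu
    refine hC u (fun h7 => hu ?_) fun h8 => hu ?_
    · obtain ⟨h8, h9⟩ := mem_lN.1 h7
      exact Finset.mem_erase.2 ⟨h9.ne', h8⟩
    · exact Finset.mem_erase.2 ⟨(hin u h8).2.1, (hin u h8).1⟩
  · intro u hu
    have huL := Finset.mem_of_mem_erase hu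
    by_cases h7 : u ∈ lN G L v
    · have h8 := (h3 u h7).2
      have h9 : v ∈ lN G L u := mem_lN.2 ⟨hvL, (mem_lN.1 h7).2.symm⟩
      have h10 := Finset.card_erase_add_one h9
      rw [(hA u h7).1, lN_erase]
      omega
    · rw [lN_erase_of_not_adj (hadj u huL h7)]
      by_cases h8 : v ∈ keys (σ₃.fam .ML u)
      · have := (hB u h8).2.1; omega
      · rw [(hC u h7 h8).1]; omega
  · intro u hu hnc
    have huL := Finset.mem_of_mem_erase hu
    have h7 : u ∉ lN G L v := fun h7 => hnc (hchs h7)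
    have h8 : v ∉ keys (σ₃.fam .ML u) := fun h8 => hnc (hB u h8).2.2
    rw [lN_erase_of_not_adj (hadj u huL h7), (hC u h7 h8).1]
  · intro u hu
    rcases hch₆ u hu with h7 | ⟨-, h7⟩
    · obtain ⟨h8, h9⟩ := mem_lN.1 h7
      exact ⟨Finset.mem_erase.2 ⟨h9.ne', h8⟩, .inl h9.symm⟩
    · obtain ⟨h8, h9, h10, h11⟩ := hin u h7
      exact ⟨Finset.mem_erase.2 ⟨h9, h8⟩, .inr (mem_biUnion_of_matched hvL h.mat h8 h11).2⟩
  · have hsub : keys (σ₆.tab .check) ⊆ lN G L v ∪ keys (σ₅.tab .union) := fun u hu =>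
      Finset.mem_union.2 ((hch₆ u hu).imp id fun h7 => h7.1)
    have h7 := Finset.card_le_card hsub
    have h8 := Finset.card_union_le (lN G L v) (keys (σ₅.tab .union))
    omega
  · rw [hF₆.tab .union]; exact hU
  · omega

end

section
variable {V : Type u} [Fintype V] [DecidableEq V]

/-! ### Testing whether vertices become candidates -/

variable {G : SimpleGraph V} [DecidableRel G.Adj] {L : Finset V} {u v : V} {p : ℕ}

theorem AuxOk.of_eq {σ σ' : State V} (h : AuxOk p σ) (hf : σ'.fam .aux = σ.fam .aux)
    (hV : σ'.tab .auxVerts = σ.tab .auxVerts) (hd : ∀ d ∈ auxTabs, σ'.tab d = σ.tab d) :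
    AuxOk p σ' where
  aux := by rw [hf, hV]; exact h.aux
  aux_sub := by rw [hf, hV]; exact h.aux_sub
  card_le := by rw [hV]; exact h.card_le
  small d hm := by rw [hd d hm]; exact h.small d hm

theorem NbrOk.of_eq {σ σ' : State V} (h : NbrOk G L σ) (ha : σ'.fam .adj = σ.fam .adj)
    (hL : σ'.fam .NL = σ.fam .NL) (hR : σ'.fam .NR = σ.fam .NR) : NbrOk G L σ' where
  adj := by rw [ha]; exact h.adj
  NL := by rw [hL]; exact h.NL
  NR := by rw [hR]; exact h.NR

def recheckBody : List Stmt := [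
  when (.and (.numEq (.add (.size (.fam .ML .u)) (.size (.fam .NL .u))) (.ctr .p))
      (.not (.mem .u (.tab .cand)))) [
    .move .a .u,
    augmenting,
    when (.not (.flag .found)) [insertSet (.tab .cand) .u]]]

variable (G) in
/-- The time for one iteration of the fourth loop of Update. -/
def recheckCost (p : ℕ) (L : Finset V) (u : V) : ℕ :=
  if phi G p L u ≤ 2 * p ^ 2 + 2 * p then augCost p (G.degree u) else 0

/-- A vertex that is not a candidate enters with sum at least `p`. If the sum is exactly `p`,
Augmenting either raises it or certifies a cover of size `p`; if it is larger, nothing is needed. A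
call happens only when `PreMat.phi_le` applies, so its cost is accounted for by `recheckCost`. -/
theorem recheckBody_spec {τ : Traversal V} {σ : State V} {W : ℕ} (hu : σ.reg .u = some u)
    (hctr : σ.ctr .p = p) (hm : Mat G L u (σ.fam .ML u) (σ.fam .MR u)) (hx : AuxOk p σ)
    (hn : NbrOk G L σ) (hR : ∀ x ∉ L, (lN G L x).card ≤ p) (hf : FamOk G σ)
    (hbig : u ∉ keys (σ.tab .cand) → p ≤ (keys (σ.fam .ML u)).card + (lN G L u).card)
    (hW : base G p + σ.held + Fintype.card V + augCost p 0 + 12 ≤ W) (hpk : σ.peak ≤ W) :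
    AuxOk p ((block recheckBody).run τ σ) ∧
    Mat G L u (((block recheckBody).run τ σ).fam .ML u) (((block recheckBody).run τ σ).fam .MR u) ∧
    keys (σ.tab .cand) ⊆ keys (((block recheckBody).run τ σ).tab .cand) ∧
    keys (((block recheckBody).run τ σ).tab .cand) ⊆ insert u (keys (σ.tab .cand)) ∧
    (u ∈ keys (((block recheckBody).run τ σ).tab .cand) → u ∈ keys (σ.tab .cand) ∨
      HasCover G L u p) ∧
    (u ∉ keys (((block recheckBody).run τ σ).tab .cand) →
      p + 1 ≤ (keys (((block recheckBody).run τ σ).fam .ML u)).card + (lN G L u).card) ∧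
    (∀ y ≠ u, ((block recheckBody).run τ σ).fam .ML y = σ.fam .ML y ∧
      ((block recheckBody).run τ σ).fam .MR y = σ.fam .MR y) ∧
    ((block recheckBody).run τ σ).time ≤ σ.time + (12 + recheckCost G p L u) ∧
    ((block recheckBody).run τ σ).peak ≤ W := by
  have hwords := words_le hf hx.toDigraphOk
  set c : Cond := .and (.numEq (.add (.size (.fam .ML .u)) (.size (.fam .NL .u))) (.ctr .p))
      (.not (.mem .u (.tab .cand))) with hc
  have heval : c.eval σ = true ↔ (keys (σ.fam .ML u)).card + (lN G L u).card = p ∧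
      u ∉ keys (σ.tab .cand) := by
    simp [hc, Cond.eval, Expr.eval, hu, hctr, hn.NL, mem_keys]
  have hcost : c.cost = 8 := rfl
  by_cases hcall : c.eval σ = true
  · obtain ⟨hsum, hnc⟩ := heval.1 hcall
    set σ₁ := (Stmt.move .a .u).run τ (σ.charge 8) with hσ₁
    have hF₁ : Frame (Stmt.move .a .u) (σ.charge 8) σ₁ := frame_run τ _ _
    have hML₁ : σ₁.fam = σ.fam := rfl
    have htab₁ : σ₁.tab = σ.tab := rfl
    have ha₁ : σ₁.reg .a = some u := by simp [hσ₁, hu]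
    have hu₁ : σ₁.reg .u = some u := by simp [hσ₁, hu]
    have hpk₁ : σ₁.peak ≤ W := (Grow.charge.trans (grow_run τ (Stmt.move .a .u) (σ.charge 8))).peak_le
      (t := 9) (by rw [← hσ₁]; simp [hσ₁]) hpk (by omega)
    obtain ⟨h1, h2, h3, h4, h5, h6⟩ := augmenting_spec (τ := τ) (σ := σ₁) (W := W) ha₁ hm
      (by rw [hML₁]; omega) (hx.of_eq rfl rfl fun _ _ => rfl) (hn.of_eq rfl rfl rfl) hR
      ⟨hf.1, hf.2, hf.3, hf.4, hf.5, hf.6⟩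
      (by have : σ₁.held = σ.held := rfl
          omega) hpk₁
    rw [hML₁] at h3 h4
    set σ₂ := augmenting.run τ σ₁ with hσ₂
    have hF₂ : Frame augmenting σ₁ σ₂ := frame_run τ _ _
    have hcand₂ : σ₂.tab .cand = σ.tab .cand := hF₂.tab .cand
    have hu₂ : σ₂.reg .u = some u := (hF₂.reg .u).trans hu₁
    have hh₂ : σ₂.held = σ.held := held_run τ _ _
    have ht₁ : σ₁.time = σ.time + 9 := rfl
    have hn₂ : NbrOk G L σ₂ := hn.of_eq (hF₂.fam .adj) (hF₂.fam .NL) (hF₂.fam .NR)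
    have hoff : ∀ y ≠ u, σ₂.fam .ML y = σ.fam .ML y ∧ σ₂.fam .MR y = σ.fam .MR y := fun y hy =>
      have hne : σ₁.reg .a ≠ some y := by rw [ha₁]; simpa [eq_comm] using hy
      ⟨hF₂.famOff .ML .a hne, hF₂.famOff .MR .a hne⟩
    have hf₂ : FamOk G σ₂ := by
      refine hn₂.famOk (fun y => ?_) (by rw [hF₂.output]; exact hf.output)
      by_cases hy : y = u
      · subst hy; exact h2.cards_le_degree
      · rw [(hoff y hy).1, (hoff y hy).2]
        exact ⟨hf.ML y, hf.MR y⟩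
    have hwords₂ := words_le hf₂ h1.toDigraphOk
    set s : Stmt := when (.not (.flag .found)) [insertSet (.tab .cand) .u] with hs
    have hrun : (block recheckBody).run τ σ = s.run τ σ₂ := by
      simp only [recheckBody, run_block_cons, run_block_nil, run_when, ← hc, hcall, if_true, hcost]
      rfl
    rw [hrun]
    have ht₃ : (s.run τ σ₂).time ≤ σ₂.time + 3 := time_simple τ σ₂ s rfl
    have hpk₃ : (s.run τ σ₂).peak ≤ W := peak_run_le ht₃ h6 (by omega)
    have hF₃ : Frame s σ₂ (s.run τ σ₂) := frame_run τ _ _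
    have hphi : recheckCost G p L u = augCost p (G.degree u) := by
      rw [recheckCost, if_pos (hm.phi_le hsum.le hR)]
    refine ⟨h1.of_eq (hF₃.fam _) (hF₃.tab _) fun d hd => hF₃.tab d (by revert d; decide),
      ?_, ?_, ?_, ?_, ?_, ?_, ?_, hpk₃⟩
    · rw [hF₃.fam .ML, hF₃.fam .MR]; exact h2
    on_goal 5 => rw [hF₃.fam .ML, hF₃.fam .MR]; exact hoff
    all_goals
      cases hfound : σ₂.flag .found
    all_goals
      simp only [hs, run_when, Cond.eval, hfound, Bool.not_false, Bool.not_true, if_true,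
        run_block_cons, run_block_nil, run_insertSet, run_insert, State.reg_charge, hu₂,
        State.tab_charge, State.tab_put_tab, Function.update_self, State.get_tab, keys_update_some,
        hcand₂, State.fam_charge, Bool.false_eq_true, if_false, State.fam_put_tab]
    · exact Finset.subset_insert _ _
    · exact subset_rfl
    · exact subset_rfl
    · exact Finset.subset_insert _ _
    · exact fun _ => .inr (hsum ▸ (h4 hfound).2)
    · exact .inl
    · exact fun h => absurd (Finset.mem_insert_self _ _) h
    · intro _; have := h3 hfound; omega
    · rw [hphi]; simp [Cond.cost]; omega
    · rw [hphi]; simp [Cond.cost]; omega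
  · have hrun : (block recheckBody).run τ σ = σ.charge 8 := by
      simp only [recheckBody, run_block_cons, run_block_nil, run_when, ← hc, hcall, hcost]
      rfl
    rw [hrun]
    refine ⟨hx.of_eq rfl rfl fun _ _ => rfl, hm, subset_rfl, Finset.subset_insert _ _, .inl, ?_,
      fun _ _ => ⟨rfl, rfl⟩, ?_, ?_⟩
    · intro h
      have h' : u ∉ keys (σ.tab .cand) := h
      have h1 := hbig h'
      have h2 : (keys (σ.fam .ML u)).card + (lN G L u).card ≠ p := fun e => hcall (heval.2 ⟨e, h'⟩)
      change p + 1 ≤ (keys (σ.fam .ML u)).card + (lN G L u).card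
      omega
    · simp only [State.time_charge]; omega
    · exact Grow.charge.peak_le (t := 8) (by simp) hpk (by omega)

def recheck : Stmt := forAll .u (.tab .check) recheckBody

variable (G) in
/-- The state after the vertices in `D` have been tested. -/
structure Rechecked (p : ℕ) (L : Finset V) (σ : State V) (D : Finset V) (σ' : State V) : Prop where
  sub : D ⊆ L
  aux : AuxOk p σ'
  mat : ∀ u ∈ L, Mat G L u (σ'.fam .ML u) (σ'.fam .MR u)
  off : ∀ u ∉ D, σ'.fam .ML u = σ.fam .ML u ∧ σ'.fam .MR u = σ.fam .MR u
  cand_off : ∀ u ∉ D, u ∈ keys (σ'.tab .cand) ↔ u ∈ keys (σ.tab .cand)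
  cand : keys (σ'.tab .cand) ⊆ L
  cover : ∀ u ∈ keys (σ'.tab .cand), HasCover G L u p
  big : ∀ u ∈ D, u ∉ keys (σ'.tab .cand) → p + 1 ≤ (keys (σ'.fam .ML u)).card + (lN G L u).card

theorem recheck_spec {τ : Traversal V} {σ : State V} {W : ℕ} (hctr : σ.ctr .p = p)
    (hn : NbrOk G L σ) (hR : ∀ x ∉ L, (lN G L x).card ≤ p) (hf : FamOk G σ)
    (hcheck : keys (σ.tab .check) ⊆ L)
    (hbig : ∀ u ∈ L, u ∉ keys (σ.tab .cand) → p ≤ (keys (σ.fam .ML u)).card + (lN G L u).card)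
    (h0 : Rechecked G p L σ ∅ σ)
    (hW : base G p + σ.held + 2 * Fintype.card V + augCost p 0 + 12 ≤ W) (hpk : σ.peak ≤ W) :
    Rechecked G p L σ (keys (σ.tab .check)) (recheck.run τ σ) ∧
    (recheck.run τ σ).time ≤ σ.time + ∑ u ∈ keys (σ.tab .check), (12 + recheckCost G p L u + 3) + 1 ∧
    (recheck.run τ σ).peak ≤ W := by
  have hst : Stable .u (Rechecked G p L σ) := fun _ _ _ _ _ _ h =>
    ⟨h.sub, h.aux.of_eq rfl rfl fun _ _ => rfl, h.mat, h.off, h.cand_off, h.cand, h.cover, h.big⟩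
  have hfam : ∀ (D : Finset V) (σ' : State V), Rechecked G p L σ D σ' → Frame recheck σ σ' →
      NbrOk G L σ' ∧ FamOk G σ' := by
    intro D σ' hI hF
    have hn' : NbrOk G L σ' := hn.of_eq (hF.fam .adj) (hF.fam .NL) (hF.fam .NR)
    refine ⟨hn', hn'.famOk (fun u => ?_) (by rw [hF.output]; exact hf.output)⟩
    by_cases hu : u ∈ L
    · exact (hI.mat u hu).cards_le_degree
    · have hD : u ∉ D := fun hD => hu (hI.sub hD)
      rw [(hI.off u hD).1, (hI.off u hD).2]; exact ⟨hf.ML u, hf.MR u⟩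
  -- The bound `W'` is arbitrary, so the same step serves the time bound, where memory does not
  -- matter and a trivial maximum is inserted.
  have hstep : ∀ (D : Finset V) (x : V) (σ' : State V) (W' : ℕ), Rechecked G p L σ D σ' →
      Frame recheck σ σ' → x ∈ keys (σ.tab .check) → x ∉ D → σ'.reg .u = some x → σ'.peak ≤ W' →
      base G p + σ'.held + Fintype.card V + augCost p 0 + 12 ≤ W' →
      Rechecked G p L σ (insert x D) ((block recheckBody).run τ σ') ∧
      ((block recheckBody).run τ σ').time ≤ σ'.time + (12 + recheckCost G p L x) ∧
      ((block recheckBody).run τ σ').peak ≤ W' := by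
    intro D x σ' W' hI hF hx hxD hr hpk' hW'
    have hxL := hcheck hx
    obtain ⟨hn', hf'⟩ := hfam D σ' hI hF
    obtain ⟨h1, h2, h3, h4, h5, h6, hoff, h7, h8⟩ := recheckBody_spec (τ := τ) (p := p) (W := W') hr
      ((hF.ctr .p).trans hctr) (hI.mat x hxL) hI.aux hn' hR hf'
      (by
        rw [hI.cand_off x hxD, (hI.off x hxD).1]
        exact hbig x hxL) hW' hpk'
    have hF' : Frame (block recheckBody) σ' _ := frame_run τ _ σ'
    set σ₁ := (block recheckBody).run τ σ' with hσ₁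
    have hc : ∀ y, y ≠ x → (y ∈ keys (σ₁.tab .cand) ↔ y ∈ keys (σ'.tab .cand)) := fun y hy =>
      ⟨fun h => (Finset.mem_insert.1 (h4 h)).resolve_left hy, fun h => h3 h⟩
    refine ⟨⟨Finset.insert_subset hxL hI.sub, h1, fun y hy => ?_, fun y hy => ?_, fun y hy => ?_,
      h4.trans (Finset.insert_subset hxL hI.cand), fun y hy => ?_, fun y hy hyc => ?_⟩, h7, h8⟩
    · by_cases hyx : y = x
      · subst hyx; exact h2
      · rw [(hoff y hyx).1, (hoff y hyx).2]; exact hI.mat y hy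
    · rw [Finset.mem_insert, not_or] at hy
      rw [(hoff y hy.1).1, (hoff y hy.1).2]; exact hI.off y hy.2
    · rw [Finset.mem_insert, not_or] at hy
      rw [hc y hy.1]; exact hI.cand_off y hy.2
    · by_cases hyx : y = x
      · subst hyx; exact (h5 hy).elim (hI.cover y) id
      · exact hI.cover y ((hc y hyx).1 hy)
    · by_cases hyx : y = x
      · subst hyx; exact h6 hyc
      · rw [hc y hyx] at hyc
        rw [(hoff y hyx).1]
        exact hI.big y ((Finset.mem_insert.1 hy).resolve_left hyx) hyc
  obtain ⟨h1, h2⟩ := forAll_spec (τ := τ) (r := .u) (d := .tab .check) (l := recheckBody) (σ := σ)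
    (Rechecked G p L σ) (fun u => 12 + recheckCost G p L u) hst h0
    (fun D x σ' hI hF _ hx hxD hr =>
      have h := hstep D x σ' _ hI hF hx hxD hr (le_max_left _ _) (le_max_right _ _)
      ⟨h.1, h.2.1⟩)
  refine ⟨h1, h2, ?_⟩
  have hcard := keys_card_le (σ.get (.tab .check))
  refine forIn_peak (τ := τ) (r := .u) (d := .tab .check) (c := .tt) (body := block recheckBody)
    (σ := σ) (Rechecked G p L σ) W hst h0 (fun D σ' hI hF hh => ?_)
    (fun D x σ' hI hF _ hh hx hxD hr _ hpk' => ?_) hpk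
  · have := words_le (hfam D σ' hI hF).2 hI.aux.toDigraphOk
    omega
  · have h := hstep D x σ' W hI hF hx hxD hr hpk' (by omega)
    exact ⟨h.1, h.2.2⟩

end

section
variable {V : Type u} [Fintype V] [DecidableEq V]

/-! ### The specification of Update -/

variable {G : SimpleGraph V} [DecidableRel G.Adj] {L : Finset V} {u v : V} {p : ℕ}

variable (G) in
/-- The amount of time that is reserved for future calls of Augmenting. -/
def potential (p : ℕ) (L : Finset V) : ℕ :=
  ∑ u ∈ L, augCost p (G.degree u) * min (phi G p L u) (2 * p ^ 2 + 2 * p + 1)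

/-- The value of `phi` drops for each checked vertex. If a call may occur, the new value is below
the cap `2 * p ^ 2 + 2 * p + 1`, so the capped value drops as well and pays for the call. The cap
keeps the initial potential at `O(p ^ 2)` calls per vertex, however large `phi` is at first. -/
theorem sum_recheckCost_add_potential_le {C : Finset V} (hv : v ∈ L) (hp : (lN G L v).card ≤ p)
    (hC : ∀ u ∈ C, u ∈ L.erase v ∧ (G.Adj u v ∨ v ∈ reach G L u)) :
    ∑ u ∈ C, recheckCost G p (L.erase v) u + potential G p (L.erase v) ≤ potential G p L := by
  have h1 : ∑ u ∈ C, recheckCost G p (L.erase v) u =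
      ∑ u ∈ L.erase v, if u ∈ C then recheckCost G p (L.erase v) u else 0 := by
    rw [← Finset.sum_filter, Finset.filter_mem_eq_inter, Finset.inter_eq_right.2]
    exact fun u hu => (hC u hu).1
  rw [h1, potential, ← Finset.sum_add_distrib]
  refine (Finset.sum_le_sum fun u _ => ?_).trans
    (Finset.sum_le_sum_of_subset (Finset.erase_subset v L))
  by_cases hu : u ∈ C
  · have h2 := phi_erase_lt hv hp (hC u hu).2
    rw [if_pos hu, recheckCost]
    split
    · have h3 : min (phi G p (L.erase v) u) (2 * p ^ 2 + 2 * p + 1) + 1 ≤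
          min (phi G p L u) (2 * p ^ 2 + 2 * p + 1) := by omega
      calc _ = augCost p (G.degree u) *
            (min (phi G p (L.erase v) u) (2 * p ^ 2 + 2 * p + 1) + 1) := by ring
        _ ≤ _ := Nat.mul_le_mul_left _ h3
    · rw [zero_add]
      exact Nat.mul_le_mul_left _ (by omega)
  · have h2 := phi_erase_le (u := u) hv hp
    rw [if_neg hu, zero_add]
    exact Nat.mul_le_mul_left _ (by omega)

/-- Rematching lets the sum of a non-candidate fall from at least `p + 1` to at least `p`, and only
for checked vertices; the fourth loop repairs exactly those. Calls of Augmenting are paid from the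
potential, which leaves a cost of `O(p ^ 3 + deg v)`. -/
theorem update_spec {τ : Traversal V} {σ : State V} {W : ℕ} (hv : σ.reg .v = some v) (hvL : v ∈ L)
    (h : Inv G p L (L.erase v) σ) (hvc : v ∉ keys (σ.tab .cand)) (hc : HasCover G L v p)
    (hW : base G p + σ.held + 6 * Fintype.card V + (53 * p ^ 2 + 200 * p + 112) ≤ W)
    (hpk : σ.peak ≤ W) :
    Inv G p (L.erase v) (L.erase v) (update.run τ σ) ∧
    (update.run τ σ).time + potential G p (L.erase v) ≤ σ.time + potential G p L +
      (15 * p ^ 3 + 49 * p ^ 2 + 28 * p + 9 + 5 * G.degree v) ∧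
    (update.run τ σ).peak ≤ W := by
  have hlv : (lN G L v).card ≤ p := hc.lN_card_le
  obtain ⟨h1, ht₁, hpk₁⟩ := rematch_spec (τ := τ) (W := W) hv hvL h hc (by omega) hpk
  set σ₁ := rematch.run τ σ with hσ₁
  have hF₁ : Frame rematch σ σ₁ := frame_run τ _ _
  have hcand₁ : σ₁.tab .cand = σ.tab .cand := hF₁.tab .cand
  have hcov : ∀ u ∈ keys (σ₁.tab .cand), HasCover G (L.erase v) u p := fun u hu =>
    (h.cover u (hcand₁ ▸ hu)).erase v
  have hR : ∀ x ∉ L.erase v, (lN G (L.erase v) x).card ≤ p := by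
    intro x hx
    rw [lN_erase]
    refine (Finset.card_le_card (Finset.erase_subset _ _)).trans ?_
    by_cases hxv : x = v
    · rw [hxv]; exact hlv
    · exact h.right x fun hxL => hx (Finset.mem_erase.2 ⟨hxv, hxL⟩)
  have hfam₁ : FamOk G σ₁ := by
    refine h1.toNbrOk.famOk (fun u => ?_) (by rw [hF₁.output]; exact h.output)
    by_cases hu : u ∈ L.erase v
    · exact (h1.mat u hu).cards_le_degree
    · rw [(h1.off u hu).1, (h1.off u hu).2]; exact h.cards_le_degree u
  have hcheck : keys (σ₁.tab .check) ⊆ L.erase v := fun u hu => (h1.check u hu).1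
  have hsub : keys (σ.tab .cand) ⊆ L.erase v := fun u hu =>
    Finset.mem_erase.2 ⟨fun e => hvc (e ▸ hu), h.cand hu⟩
  obtain ⟨h2, ht₂, hpk₂⟩ := recheck_spec (τ := τ) (W := W) ((hF₁.ctr .p).trans h.ctr) h1.toNbrOk hR
    hfam₁ hcheck
    (fun u hu hun => by
      have := h1.le u hu
      have := h.big u hu (hcand₁ ▸ hun)
      omega)
    ⟨by simp, h.toAuxOk.of_eq (hF₁.fam .aux) (hF₁.tab .auxVerts)
      fun d hd => hF₁.tab d (by revert d; decide), h1.mat, fun _ _ => ⟨rfl, rfl⟩,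
      fun _ _ => Iff.rfl, hcand₁ ▸ hsub, hcov, by simp⟩
    (by
      have : σ₁.held = σ.held := held_run τ _ _
      simp only [augCost]; omega) hpk₁
  set σ₂ := recheck.run τ σ₁ with hσ₂
  have hF₂ : Frame recheck σ₁ σ₂ := frame_run τ _ _
  have hv₂ : σ₂.reg .v = some v := (hF₂.reg .v).trans ((hF₁.reg .v).trans hv)
  set s : Stmt := block [.clear (.fam .ML .v), .clear (.fam .MR .v)] with hs
  have hrun : update.run τ σ = s.run τ σ₂ := rfl
  rw [hrun]
  have hoff : ∀ u ∉ L.erase v, σ₂.fam .ML u = σ.fam .ML u ∧ σ₂.fam .MR u = σ.fam .MR u := by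
    intro u hu
    have h3 := h2.off u fun hc => hu (hcheck hc)
    have h4 := h1.off u hu
    exact ⟨h3.1.trans h4.1, h3.2.trans h4.2⟩
  have hn₂ : NbrOk G (L.erase v) σ₂ := h1.toNbrOk.of_eq (hF₂.fam _) (hF₂.fam _) (hF₂.fam _)
  have hfam₂ : FamOk G σ₂ := by
    refine hn₂.famOk (fun u => ?_) (by rw [hF₂.output, hF₁.output]; exact h.output)
    by_cases hu : u ∈ L.erase v
    · exact (h2.mat u hu).cards_le_degree
    · rw [(hoff u hu).1, (hoff u hu).2]; exact h.cards_le_degree u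
  have hF₃ : Frame s σ₂ (s.run τ σ₂) := frame_run τ _ _
  have hML : (s.run τ σ₂).fam .ML = Function.update (σ₂.fam .ML) v fun _ => none := by
    simp [hs, hv₂]
  have hMR : (s.run τ σ₂).fam .MR = Function.update (σ₂.fam .MR) v fun _ => none := by
    simp [hs, hv₂]
  have hsame : ∀ u ∈ L.erase v, (s.run τ σ₂).fam .ML u = σ₂.fam .ML u ∧
      (s.run τ σ₂).fam .MR u = σ₂.fam .MR u := by
    intro u hu
    have hne := Finset.ne_of_mem_erase hu
    rw [hML, hMR, Function.update_of_ne hne, Function.update_of_ne hne]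
    exact ⟨rfl, rfl⟩
  have hMLv := (h.mat v hvL).card_add_le hc
  have hMRv := (h.mat v hvL).card_eq
  have ht₃ : (s.run τ σ₂).time ≤ σ₂.time + (2 * p + 2) := by
    have e : (s.run τ σ₂).time =
        σ₂.time + ((keys (σ₂.fam .ML v)).card + 1 + ((keys (σ₂.fam .MR v)).card + 1)) := by
      simp [hs, hv₂]; omega
    rw [e, (hoff v (by simp)).1, (hoff v (by simp)).2]
    omega
  refine ⟨⟨hn₂.of_eq (hF₃.fam _) (hF₃.fam _) (hF₃.fam _),
    h2.aux.of_eq (hF₃.fam _) (hF₃.tab _) fun d _ => hF₃.tab d, ?_, ?_, ?_, hR, ?_, ?_, ?_, ?_, ?_,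
    ?_⟩, ?_, ?_⟩
  · rw [hF₃.ctr .p, hF₂.ctr .p, hF₁.ctr .p]; exact h.ctr
  · intro u hu
    rw [(hsame u hu).1, (hsame u hu).2]; exact h2.mat u hu
  · intro u hu
    rw [hML, hMR]
    by_cases huv : u = v
    · subst huv; simp
    · rw [Function.update_of_ne huv, Function.update_of_ne huv, (hoff u hu).1, (hoff u hu).2]
      exact h.none u fun huL => hu (Finset.mem_erase.2 ⟨huv, huL⟩)
  · rw [hF₃.tab .cand]; exact h2.cand
  · rw [hF₃.tab .cand]; exact h2.cover
  · rw [hF₃.tab .cand]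
    intro u hu hun
    rw [(hsame u hu).1]
    by_cases huc : u ∈ keys (σ₁.tab .check)
    · exact h2.big u huc hun
    · rw [h2.cand_off u huc, hcand₁] at hun
      rw [(h2.off u huc).1]
      have := h1.le_of_notMem u hu huc
      have := h.big u hu hun
      omega
  · rw [hF₃.tab .check, hF₂.tab .check]; exact h1.check_card
  · rw [hF₃.tab .union, hF₂.tab .union]; exact h1.union_card
  · rw [hF₃.output, hF₂.output, hF₁.output]; exact h.output
  · have h3 := sum_recheckCost_add_potential_le hvL hlv h1.check
    have h4 : ∑ u ∈ keys (σ₁.tab .check), (12 + recheckCost G p (L.erase v) u + 3) =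
        ∑ u ∈ keys (σ₁.tab .check), recheckCost G p (L.erase v) u +
          15 * (keys (σ₁.tab .check)).card := by
      simp only [Finset.sum_add_distrib, Finset.sum_const, smul_eq_mul]; omega
    have h5 := h1.check_card
    omega
  · refine peak_run_le ht₃ hpk₂ ?_
    have := words_le hfam₂ h2.aux.toDigraphOk
    have : σ₂.held = σ.held := by rw [hσ₂, held_run, hσ₁, held_run]
    omega

end

section
variable {V : Type u} [Fintype V] [DecidableEq V]

/-! ### The main loop -/

variable {G : SimpleGraph V} [DecidableRel G.Adj] {L : Finset V} {u v : V} {p : ℕ}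

variable (G) in
/-- The state of Main before an iteration. -/
structure MainInv (p : ℕ) (L : Finset V) (σ : State V) : Prop extends Inv G p L L σ where
  keys_L : keys (σ.tab .L) = L
  good : GoodSuffixes G p σ.output
  nodup : σ.output.Nodup
  eq_sdiff : L = Finset.univ \ σ.output.toFinset
  failed : σ.flag .failed = true → (p : ℕ∞) < graphAdm G 2

def mainBody : List Stmt := [
  .pick .v (.tab .cand),
  .ite (.isSet .v)
    (block [.delete (.tab .cand) .v, .delete (.tab .L) .v, .emit .v, update])
    (.setFlag .failed true)]

theorem Inv.lt_graphAdm {σ : State V} (h : Inv G p L L σ) (hL : L.Nonempty)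
    (hc : keys (σ.tab .cand) = ∅) : (p : ℕ∞) < graphAdm G 2 :=
  lt_graphAdm_of_stuck hL fun u hu X huX hX =>
    (h.mat u hu).le_pathPacking' (h.big u hu (by simp [hc])) huX hX

/-- The cover of the chosen candidate refers to `L` before its removal, which is the set that
`GoodSuffixes` requires when the vertex is put in front. Without a candidate, all vertices of `L`
have large packings. -/
theorem mainBody_spec {τ : Traversal V} {σ : State V} {W : ℕ} (h : MainInv G p L σ)
    (hL : L.Nonempty) (hfail : σ.flag .failed = false)
    (hW : base G p + σ.held + 6 * Fintype.card V + (53 * p ^ 2 + 200 * p + 117) ≤ W)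
    (hpk : σ.peak ≤ W) :
    ((∃ v ∈ L, MainInv G p (L.erase v) ((block mainBody).run τ σ) ∧
        ((block mainBody).run τ σ).output = v :: σ.output ∧
        ((block mainBody).run τ σ).flag .failed = false ∧
        ((block mainBody).run τ σ).time + potential G p (L.erase v) ≤ σ.time + potential G p L +
          (15 * p ^ 3 + 49 * p ^ 2 + 28 * p + 14 + 5 * G.degree v)) ∨
      (MainInv G p L ((block mainBody).run τ σ) ∧
        ((block mainBody).run τ σ).flag .failed = true ∧
        ((block mainBody).run τ σ).time ≤ σ.time + 3)) ∧
    ((block mainBody).run τ σ).peak ≤ W := by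
  have hwords := words_le h.famOk h.toDigraphOk
  by_cases hc : (keys (σ.tab .cand)).Nonempty
  · obtain ⟨v, hvc, hpick⟩ := τ.head?_order σ.time hc
    have hvL := h.cand hvc
    set σ₁ := ((σ.setReg .v (some v)).charge 1).charge 1 with hσ₁
    set s : Stmt := block [.delete (.tab .cand) .v, .delete (.tab .L) .v, .emit .v] with hs
    set σ₂ := s.run τ σ₁ with hσ₂
    have hF₁ : Frame (Stmt.pick .v (.tab .cand)) σ σ₁ := fun l hl =>
      ((Reg.same_setReg (by simpa only [Stmt.writes] using hl) _ _).charge _).charge _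
    have hF₂ : Frame s σ₁ σ₂ := frame_run τ _ _
    have hfam : σ₂.fam = σ.fam := by simp [hσ₂, hs, hσ₁, Stmt.run]
    have hcand : σ₂.tab .cand = Function.update (σ.tab .cand) v none := by
      simp [hσ₂, hs, hσ₁, Stmt.run]
    have hLtab : σ₂.tab .L = Function.update (σ.tab .L) v none := by
      simp [hσ₂, hs, hσ₁, Stmt.run]
    have hout : σ₂.output = v :: σ.output := by simp [hσ₂, hs, hσ₁, Stmt.run]
    have hv₂ : σ₂.reg .v = some v := by simp [hσ₂, hs, hσ₁, Stmt.run]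
    have ht₂ : σ₂.time ≤ σ.time + 5 := time_simple τ σ₁ s rfl
    have hpk₂ : σ₂.peak ≤ W := by
      have hg : Grow σ σ₂ := (Grow.step (σ := σ) (σ' := σ.setReg .v (some v)) (k := 1) rfl rfl
        (Nat.le_add_right _ _)).trans (Grow.charge.trans (grow_run τ s σ₁))
      exact hg.peak_le ht₂ hpk (by omega)
    have hh₂ : σ₂.held = σ.held := held_run τ _ _
    have hvout : v ∉ σ.output := by
      have := hvL
      rw [h.eq_sdiff] at this
      simpa using this
    have hnd : σ₂.output.Nodup := by rw [hout]; exact List.nodup_cons.2 ⟨hvout, h.nodup⟩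
    have hcov := h.cover v hvc
    have hInv : Inv G p L (L.erase v) σ₂ := by
      refine ⟨h.toNbrOk.of_eq (by rw [hfam]) (by rw [hfam]) (by rw [hfam]), h.toAuxOk.of_eq
        (by rw [hfam]) ((hF₂.tab _).trans (hF₁.tab _)) fun d hd =>
        (hF₂.tab d (by revert d; decide)).trans (hF₁.tab d), ?_, ?_, ?_, h.right, ?_, ?_, ?_,
        ?_, ?_, hnd.length_le_card⟩
      · rw [hF₂.ctr, hF₁.ctr]; exact h.ctr
      · rw [hfam]; exact h.mat
      · rw [hfam]; exact h.none
      · rw [hcand, keys_update_none]; exact (Finset.erase_subset _ _).trans h.cand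
      · rw [hcand, keys_update_none]; exact fun u hu => h.cover u (Finset.mem_of_mem_erase hu)
      · rw [hcand, keys_update_none, hfam]
        intro u hu hun
        exact h.big u (Finset.mem_of_mem_erase hu) fun hc =>
          hun (Finset.mem_erase.2 ⟨Finset.ne_of_mem_erase hu, hc⟩)
      · rw [hF₂.tab .check, hF₁.tab .check]; exact h.check
      · rw [hF₂.tab .union, hF₁.tab .union]; exact h.union
    obtain ⟨h1, h2, h3⟩ := update_spec (τ := τ) (W := W) hv₂ hvL hInv
      (by rw [hcand, keys_update_none]; simp) hcov (by rw [hh₂]; omega) hpk₂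
    have hrun : (block mainBody).run τ σ = update.run τ σ₂ := by
      have e : (Stmt.pick .v (.tab .cand)).run τ σ = (σ.setReg .v (some v)).charge 1 := by
        simp only [Stmt.run, State.get_tab, hpick]
      have e' : (Cond.isSet .v).eval ((σ.setReg .v (some v)).charge 1) = true := by
        simp [Cond.eval]
      simp only [mainBody, run_block_cons, run_block_nil, e, run_ite, e', if_true]
      rfl
    rw [hrun]
    have hF₃ : Frame update σ₂ (update.run τ σ₂) := frame_run τ _ _
    have hfl : (update.run τ σ₂).flag .failed = false := by
      rw [hF₃.flag .failed, hF₂.flag .failed, hF₁.flag .failed]; exact hfail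
    refine ⟨.inl ⟨v, hvL, ⟨h1, ?_, ?_, ?_, ?_, fun e => by simp [hfl] at e⟩, ?_, hfl, by omega⟩, h3⟩
    · rw [hF₃.tab .L, hLtab, keys_update_none, h.keys_L]
    · rw [hF₃.output, hout]
      exact ⟨h.eq_sdiff ▸ hcov, h.good⟩
    · rw [hF₃.output]; exact hnd
    · rw [hF₃.output, hout]
      ext y
      rw [h.eq_sdiff]
      simp
    · rw [hF₃.output, hout]
  · rw [Finset.not_nonempty_iff_eq_empty] at hc
    have hpick : (τ.order σ.time (keys (σ.tab .cand))).head? = none := by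
      have := τ.length_order σ.time (keys (σ.tab .cand))
      rw [hc, Finset.card_empty, List.length_eq_zero_iff] at this
      rw [hc, this]; rfl
    have hrun : (block mainBody).run τ σ =
        (Stmt.setFlag .failed true).run τ (((σ.setReg .v none).charge 1).charge 1) := by
      have e : (Stmt.pick .v (.tab .cand)).run τ σ = (σ.setReg .v none).charge 1 := by
        simp only [Stmt.run, State.get_tab, hpick]
      have e' : (Cond.isSet .v).eval ((σ.setReg .v none).charge 1) = false := by
        simp [Cond.eval]
      simp only [mainBody, run_block_cons, run_block_nil, e, run_ite, e', Bool.false_eq_true,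
        if_false]
      rfl
    have hg := grow_run τ (block mainBody) σ
    rw [hrun] at hg ⊢
    refine ⟨.inr ⟨⟨⟨h.toNbrOk.of_eq rfl rfl rfl, h.toAuxOk.of_eq rfl rfl fun _ _ => rfl, h.ctr,
      h.mat, h.none, h.right, h.cand, h.cover, h.big, h.check, h.union, h.output⟩, h.keys_L, h.good,
      h.nodup, h.eq_sdiff, fun _ => h.lt_graphAdm hL hc⟩, ?_, le_rfl⟩, hg.peak_le (t := 3) le_rfl hpk (by omega)⟩
    simp

def mainGuard : Cond := .and (.not (.isEmpty (.tab .L))) (.not (.flag .failed))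

def mainLoop : Stmt := forWhile .iter (.tab .verts) mainGuard mainBody

theorem MainInv.of_eq {σ σ' : State V} (h : MainInv G p L σ) (hc : σ'.ctr = σ.ctr)
    (hf : σ'.flag = σ.flag) (ht : σ'.tab = σ.tab) (hfam : σ'.fam = σ.fam)
    (ho : σ'.output = σ.output) : MainInv G p L σ' where
  toInv := ⟨h.toNbrOk.of_eq (by rw [hfam]) (by rw [hfam]) (by rw [hfam]),
    h.toAuxOk.of_eq (by rw [hfam]) (by rw [ht]) fun _ _ => by rw [ht], by rw [hc]; exact h.ctr,
    by rw [hfam]; exact h.mat, by rw [hfam]; exact h.none, h.right, by rw [ht]; exact h.cand,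
    by rw [ht]; exact h.cover, by rw [ht, hfam]; exact h.big, by rw [ht]; exact h.check,
    by rw [ht]; exact h.union, by rw [ho]; exact h.output⟩
  keys_L := by rw [ht]; exact h.keys_L
  good := by rw [ho]; exact h.good
  nodup := by rw [ho]; exact h.nodup
  eq_sdiff := by rw [ho]; exact h.eq_sdiff
  failed := by rw [hf]; exact h.failed

/-- As long as no failure occurs, every iteration emits one vertex, so running through all keys of
`verts` empties `L`. The degree terms add up over distinct removed vertices. Since the time is
amortised against the potential, `forIn_induct` is used directly, without fixed costs per key. -/
theorem mainLoop_spec {τ : Traversal V} {σ : State V} {W : ℕ} (h : MainInv G p Finset.univ σ)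
    (hverts : keys (σ.tab .verts) = Finset.univ)
    (hW : base G p + σ.held + 7 * Fintype.card V + (53 * p ^ 2 + 200 * p + 117) ≤ W)
    (hpk : σ.peak ≤ W) :
    (∃ L, MainInv G p L (mainLoop.run τ σ) ∧
      ((mainLoop.run τ σ).flag .failed = false → L = ∅)) ∧
    (mainLoop.run τ σ).time ≤ σ.time + potential G p Finset.univ +
      Fintype.card V * (15 * p ^ 3 + 49 * p ^ 2 + 28 * p + 21) + 10 * G.edgeFinset.card + 16 ∧
    (mainLoop.run τ σ).peak ≤ W := by
  have hn : (keys (σ.get (.tab .verts))).card = Fintype.card V := by simp [hverts]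
  have hout0 : σ.output = [] := by
    have := h.eq_sdiff
    rw [← List.toFinset_eq_empty_iff]
    refine Finset.eq_empty_of_forall_notMem fun x hx => ?_
    have hx' : x ∈ Finset.univ \ σ.output.toFinset := by rw [← this]; simp
    exact (Finset.mem_sdiff.1 hx').2 hx
  set κ := 15 * p ^ 3 + 49 * p ^ 2 + 28 * p + 20 with hκ
  have hsum : ∀ L : Finset V, ∑ v ∈ Finset.univ \ L, (κ + 5 * G.degree v) ≤
      Fintype.card V * κ + 10 * G.edgeFinset.card := by
    intro L
    refine (Finset.sum_le_sum_of_subset (Finset.subset_univ _)).trans ?_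
    rw [Finset.sum_add_distrib, ← Finset.mul_sum, G.sum_degrees_eq_twice_card_edges]
    simp only [Finset.sum_const, Finset.card_univ, smul_eq_mul]
    omega
  have hguard : ∀ (σ' : State V), mainGuard.eval σ' = true ↔
      (keys (σ'.tab .L)).Nonempty ∧ σ'.flag .failed = false := by
    intro σ'
    simp [mainGuard, Cond.eval, Finset.nonempty_iff_ne_empty]
  -- `κ` includes 6 units for entering an iteration. The extra 9 pay for the iteration that sets
  -- `failed`, namely 6 to enter it and 3 for its body; the guard test that leaves the loop
  -- afterwards makes this 15.
  obtain ⟨σ', hσ', e⟩ := forIn_induct (τ := τ) (r := .iter) (d := .tab .verts) (c := mainGuard)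
    (body := block mainBody) (σ := σ)
    (I := fun D σ' => ∃ L, MainInv G p L σ' ∧
      (σ'.flag .failed = false → D.card = σ'.output.length) ∧
      σ'.time + potential G p L ≤ σ.time + Fintype.card V + 1 + potential G p Finset.univ +
        ∑ v ∈ Finset.univ \ L, (κ + 5 * G.degree v) + (if σ'.flag .failed then 9 else 0) ∧
      σ'.peak ≤ W ∧ σ'.held = σ.held + Fintype.card V)
    (Q := fun σ' => (∃ L, MainInv G p L σ' ∧ (σ'.flag .failed = false → L = ∅)) ∧
      σ'.time ≤ σ.time + Fintype.card V + 1 + potential G p Finset.univ +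
        (Fintype.card V * κ + 10 * G.edgeFinset.card) + 15 ∧ σ'.peak ≤ W)
    (by
      have h1 := h.of_eq (σ' := σ.enter (.tab .verts)) rfl rfl rfl rfl rfl
      refine ⟨Finset.univ, h1, ?_, ?_, ?_, ?_⟩
      · change _ → _ = σ.output.length
        simp [hout0]
      · change σ.time + ((keys (σ.get (.tab .verts))).card + 1) + _ ≤ _
        rw [hn]; omega
      · have h2 := words_le h1.famOk h1.toDigraphOk
        change max σ.peak (σ.enter (.tab .verts)).words ≤ W
        have h3 : (σ.enter (.tab .verts)).held = σ.held + (keys (σ.get (.tab .verts))).card := rfl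
        omega
      · change σ.held + (keys (σ.get (.tab .verts))).card = _
        rw [hn])
    (by
      rintro D x σ' ⟨L, h1, h2, h3, h4, h5⟩ hx hxD
      have h1' := h1.of_eq (σ' := σ'.advance .iter x mainGuard) rfl rfl rfl rfl rfl
      have hw := words_le h1'.famOk h1'.toDigraphOk
      set σ₁ := σ'.advance .iter x mainGuard with hσ₁
      have ht₁ : σ₁.time = σ'.time + 6 := rfl
      have hh₁ : σ₁.held = σ'.held := rfl
      have hf₁ : σ₁.flag = σ'.flag := rfl
      have ho₁ : σ₁.output = σ'.output := rfl
      have hpk₁ : σ₁.peak ≤ W := by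
        have : σ₁.peak = max σ'.peak σ₁.words := rfl
        omega
      rw [← hf₁] at h2 h3
      have hsL := hsum L
      split
      · rename_i hg
        obtain ⟨hg1, hg2⟩ := (hguard _).1 hg
        rw [h1'.keys_L] at hg1
        have hc := h2 hg2
        rw [hg2] at h3
        simp only [Bool.false_eq_true, if_false] at h3
        obtain ⟨h6, h7⟩ := mainBody_spec (τ := τ) (W := W) h1' hg1 hg2 (by omega) hpk₁
        have hh₂ : ((block mainBody).run τ σ₁).held = σ.held + Fintype.card V := by
          rw [held_run, hh₁, h5]
        rcases h6 with ⟨v, hv, h8, h9, h10, h11⟩ | ⟨h8, h9, h10⟩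
        · refine ⟨L.erase v, h8, fun _ => ?_, ?_, h7, hh₂⟩
          · rw [Finset.card_insert_of_notMem hxD, h9, List.length_cons, ho₁, hc]
          · have e : Finset.univ \ L.erase v = insert v (Finset.univ \ L) := by
              ext y; by_cases hy : y = v <;> simp [hy]
            rw [e, Finset.sum_insert (by simpa using hv), h10]
            simp only [Bool.false_eq_true, if_false]
            omega
        · refine ⟨L, h8, fun h => by simp [h9] at h, ?_, h7, hh₂⟩
          rw [h9]
          simp only [if_true]
          omega
      · rename_i hg
        refine ⟨⟨L, h1', fun hf => ?_⟩, ?_, hpk₁⟩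
        · rw [hguard, not_and] at hg
          by_contra hne
          exact hg (by rw [h1'.keys_L]; exact Finset.nonempty_iff_ne_empty.2 hne) hf
        · split at h3 <;> omega)
  have hrun : mainLoop.run τ σ = { σ' with held := σ.held } := e
  rw [hrun]
  have key : (∃ L, MainInv G p L σ' ∧ (σ'.flag .failed = false → L = ∅)) ∧
      σ'.time ≤ σ.time + Fintype.card V + 1 + potential G p Finset.univ +
        (Fintype.card V * κ + 10 * G.edgeFinset.card) + 15 ∧ σ'.peak ≤ W := by
    refine hσ'.elim ?_ id
    rintro ⟨L, h1, h2, h3, h4, h5⟩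
    refine ⟨⟨L, h1, fun hf => ?_⟩, ?_, h4⟩
    · have h6 := h2 hf
      rw [hn, ← List.toFinset_card_of_nodup h1.nodup] at h6
      rw [h1.eq_sdiff, Finset.eq_univ_of_card _ h6.symm, Finset.sdiff_self]
    · have hsL := hsum L
      split at h3 <;> omega
  obtain ⟨⟨L, h1, h2⟩, h3, h4⟩ := key
  refine ⟨⟨L, h1.of_eq rfl rfl rfl rfl rfl, h2⟩, ?_, h4⟩
  have e : Fintype.card V * (15 * p ^ 3 + 49 * p ^ 2 + 28 * p + 21) =
    Fintype.card V * κ + Fintype.card V := by rw [hκ]; ring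
  change σ'.time ≤ _
  omega

end

section
variable {V : Type u} [Fintype V] [DecidableEq V]

/-! ### The set-up phase -/

variable {G : SimpleGraph V} [DecidableRel G.Adj] {L : Finset V} {u v : V} {p : ℕ}

theorem lN_univ : lN G Finset.univ u = G.neighborFinset u := by ext; simp

theorem rN_univ : rN G Finset.univ u = ∅ := by ext; simp [rN]

theorem keys_inputState_adj (x : V) :
    keys ((inputState G p).fam .adj x) = G.neighborFinset x := by
  ext y; by_cases h : G.Adj x y <;> simp [mem_keys, inputState, h]

theorem inputState_fam {f : Fam} (hf : f ≠ .adj) (x : V) :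
    (inputState G p).fam f x = fun _ => none := by
  funext y; simp [inputState, hf]

theorem inputState_tab {d : Tab} (hd : d ≠ .verts) : (inputState G p).tab d = fun _ => none := by
  funext y; simp [inputState, hd]

theorem keys_inputState_verts : keys ((inputState G p).tab .verts) = Finset.univ := by
  ext y; simp [mem_keys, inputState]

theorem words_le_of_input {σ : State V} (hfam : σ.fam = (inputState G p).fam)
    (htab : σ.tab = (inputState G p).tab) (hout : σ.output = []) :
    σ.words ≤ base G p + σ.held := by
  refine words_le ⟨?_, ?_, ?_, ?_, ?_, ?_⟩ ⟨?_, ?_, ?_⟩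
  · intro x; rw [hfam, keys_inputState_adj, SimpleGraph.card_neighborFinset_eq_degree]
  · intro x; rw [hfam, inputState_fam (by decide)]; simp
  · intro x; rw [hfam, inputState_fam (by decide)]; simp
  · intro x; rw [hfam, inputState_fam (by decide)]; simp
  · intro x; rw [hfam, inputState_fam (by decide)]; simp
  · rw [hout]; simp
  · intro x _; rw [hfam, inputState_fam (by decide)]
  · intro x; rw [hfam, inputState_fam (by decide)]; simp
  · rw [htab, inputState_tab (by decide)]; simp

/-- Every edge is counted twice in the sum of the degrees, so the budget grows by `2 * p` for each
vertex. -/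
theorem checkEdges_spec {τ : Traversal V} {σ : State V} (hctr : σ.ctr .p = p)
    (hflag : σ.flag .failed = false) (hfam : σ.fam = (inputState G p).fam)
    (hverts : keys (σ.tab .verts) = Finset.univ) :
    ((checkEdges.run τ σ).flag .failed = true ↔ p * Fintype.card V < G.edgeFinset.card) ∧
    (checkEdges.run τ σ).time ≤ σ.time + 13 * Fintype.card V + 10 := by
  set σ₁ := (Stmt.setCtr .budget .zero).run τ ((Stmt.setCtr .degSum .zero).run τ σ) with hσ₁
  have ht₁ : σ₁.time = σ.time + 4 := rfl
  set l : List Stmt := [.setCtr .degSum (.add (.ctr .degSum) (.size (.fam .adj .v))),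
    .setCtr .budget (.add (.ctr .budget) (.add (.ctr .p) (.ctr .p)))] with hl
  have hctr₁ : σ₁.ctr .p = p := by simp [hσ₁, hctr]
  obtain ⟨⟨h1, h2⟩, h3⟩ := forAll_spec (τ := τ) (r := .v) (d := .tab .verts) (l := l) (σ := σ₁)
    (fun D σ' => σ'.ctr .degSum = ∑ x ∈ D, G.degree x ∧ σ'.ctr .budget = D.card * (2 * p))
    (fun _ => 10) (fun _ _ _ _ _ _ h => h) (by simp [hσ₁, Expr.eval]) (by
      rintro D x σ' ⟨h1, h2⟩ hF _ _ hxD hr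
      refine ⟨?_, time_simple τ σ' _ rfl⟩
      have hadj : keys (σ'.fam .adj x) = G.neighborFinset x := by
        rw [hF.fam .adj]
        change keys (σ.fam .adj x) = _
        rw [hfam, keys_inputState_adj]
      have hp : σ'.ctr .p = p := (hF.ctr .p).trans hctr₁
      constructor
      · simp [hl, Expr.eval, hr, hadj, h1, Finset.sum_insert hxD]; omega
      · simp [hl, Expr.eval, hp, h2, Finset.card_insert_of_notMem hxD]; ring)
  have hK : keys (σ₁.get (.tab .verts)) = Finset.univ := hverts
  rw [hK] at h1 h2 h3
  rw [G.sum_degrees_eq_twice_card_edges] at h1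
  rw [Finset.card_univ] at h2
  simp only [Finset.sum_const, Finset.card_univ, smul_eq_mul] at h3
  set σ₂ := (forAll .v (.tab .verts) l).run τ σ₁ with hσ₂
  have hF₂ : Frame (forAll .v (.tab .verts) l) σ₁ σ₂ := frame_run τ _ _
  have hflag₂ : σ₂.flag .failed = false := (hF₂.flag .failed).trans hflag
  set s : Stmt := when (.not (.numLe (.ctr .degSum) (.ctr .budget))) [.setFlag .failed true] with hs
  have hrun : checkEdges.run τ σ = s.run τ σ₂ := rfl
  have ht₃ : (s.run τ σ₂).time ≤ σ₂.time + 5 := time_simple τ σ₂ s rfl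
  rw [hrun]
  refine ⟨?_, by omega⟩
  have e : p * Fintype.card V < G.edgeFinset.card ↔ σ₂.ctr .budget < σ₂.ctr .degSum := by
    rw [h1, h2]
    have : Fintype.card V * (2 * p) = 2 * (p * Fintype.card V) := by ring
    omega
  rw [e]
  have heval : (Cond.not (.numLe (.ctr .degSum) (.ctr .budget))).eval σ₂ =
      decide (σ₂.ctr .budget < σ₂.ctr .degSum) := by
    rw [Bool.eq_iff_iff]
    simp only [Cond.eval, Expr.eval, Bool.not_eq_true', decide_eq_true_eq]
    exact decide_eq_false_iff_not.trans not_le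
  rw [hs, run_when, heval]
  by_cases hlt : σ₂.ctr .budget < σ₂.ctr .degSum
  · simp [hlt]
  · simp [hlt, hflag₂]

/-- While all vertices are in `L`, nothing lies on the other side: empty matchings are maximal, a
neighbourhood is a cover, and a vertex that is not a candidate has at least `p + 1` neighbours in
`L`. -/
theorem setup_spec {τ : Traversal V} {σ : State V} (hctr : σ.ctr .p = p)
    (hflag : σ.flag .failed = false) (hfam : σ.fam = (inputState G p).fam)
    (htab : σ.tab = (inputState G p).tab) (hout : σ.output = []) :
    MainInv G p Finset.univ (setup.run τ σ) ∧
    (setup.run τ σ).time ≤ σ.time + 9 * Fintype.card V + 8 * G.edgeFinset.card + 1 := by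
  set l : List Stmt := [insertSet (.tab .L) .v,
    forAll .u (.fam .adj .v) [insertSet (.fam .NL .v) .u],
    when (.numLe (.size (.fam .adj .v)) (.ctr .p)) [insertSet (.tab .cand) .v]] with hl
  have hF : Frame setup σ (setup.run τ σ) := frame_run τ _ _
  obtain ⟨⟨h1, h2, h3⟩, h4⟩ := forAll_spec (τ := τ) (r := .v) (d := .tab .verts) (l := l) (σ := σ)
    (fun D σ' => (∀ x, keys (σ'.fam .NL x) = if x ∈ D then G.neighborFinset x else ∅) ∧
      keys (σ'.tab .L) = D ∧ keys (σ'.tab .cand) = D.filter fun x => G.degree x ≤ p)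
    (fun v => 4 * G.degree v + 6) (fun _ _ _ _ _ _ h => h)
    (by rw [hfam, htab, inputState_tab (by decide), inputState_tab (by decide)]
        refine ⟨fun x => ?_, by simp, by simp⟩
        rw [inputState_fam (by decide)]; simp) (by
      rintro D x σ' ⟨h1, h2, h3⟩ hF _ _ hxD hr
      set σ₁ := (insertSet (.tab .L) .v).run τ σ' with hσ₁
      have hF₁ : Frame (insertSet (.tab .L) .v) σ' σ₁ := frame_run τ _ _
      have hr₁ : σ₁.reg .v = some x := (hF₁.reg .v).trans hr
      have hadj₁ : keys (σ₁.get (.fam .adj .v)) = G.neighborFinset x := by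
        simp only [State.get_fam, hr₁]
        rw [hF₁.fam .adj, hF.fam .adj, hfam, keys_inputState_adj]
      have hL₁ : keys (σ₁.tab .L) = insert x D := by simp [hσ₁, hr, h2]
      have ht₁ : σ₁.time = σ'.time + 1 := by simp [hσ₁, hr]
      obtain ⟨h5, h6⟩ := forAll_spec (τ := τ) (r := .u) (d := .fam .adj .v)
        (l := [insertSet (.fam .NL .v) .u]) (σ := σ₁)
        (fun E σ'' => keys (σ''.fam .NL x) = E) (fun _ => 1) (fun _ _ _ _ _ _ h => h)
        (by rw [hF₁.fam .NL, h1, if_neg hxD]) (by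
          intro E y σ'' hI hF' _ _ _ hr'
          have hv' : σ''.reg .v = some x := (hF'.reg .v).trans hr₁
          refine ⟨?_, time_simple τ σ'' _ rfl⟩
          simp [hr', hv', hI])
      rw [hadj₁] at h5 h6
      simp only [Finset.sum_const, smul_eq_mul, SimpleGraph.card_neighborFinset_eq_degree] at h6
      set σ₂ := (forAll .u (.fam .adj .v) [insertSet (.fam .NL .v) .u]).run τ σ₁ with hσ₂
      have hF₂ : Frame (forAll .u (.fam .adj .v) [insertSet (.fam .NL .v) .u]) σ₁ σ₂ :=
        frame_run τ _ _
      have hr₂ : σ₂.reg .v = some x := (hF₂.reg .v).trans hr₁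
      set s : Stmt := when (.numLe (.size (.fam .adj .v)) (.ctr .p)) [insertSet (.tab .cand) .v]
        with hs
      have hrun : (block l).run τ σ' = s.run τ σ₂ := rfl
      have hF₃ : Frame s σ₂ (s.run τ σ₂) := frame_run τ _ _
      have ht₃ : (s.run τ σ₂).time ≤ σ₂.time + 4 := time_simple τ σ₂ s rfl
      rw [hrun]
      refine ⟨⟨fun y => ?_, ?_, ?_⟩, by omega⟩
      · rw [hF₃.fam .NL]
        by_cases hyx : y = x
        · subst hyx; simpa using h5
        · have hne : σ₁.reg .v ≠ some y := by rw [hr₁]; simpa [eq_comm] using hyx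
          rw [hF₂.famOff .NL .v hne, hF₁.fam .NL, h1]
          simp [hyx]
      · rw [hF₃.tab .L, hF₂.tab .L, hL₁]
      · have hp : σ₂.ctr .p = p := by rw [hF₂.ctr .p, hF₁.ctr .p, hF.ctr .p, hctr]
        have hadj₂ : (keys (σ₂.fam .adj x)).card = G.degree x := by
          rw [hF₂.fam .adj, hF₁.fam .adj, hF.fam .adj, hfam, keys_inputState_adj,
            SimpleGraph.card_neighborFinset_eq_degree]
        have hc₂ : keys (σ₂.tab .cand) = D.filter fun x => G.degree x ≤ p := by
          rw [hF₂.tab .cand, hF₁.tab .cand, h3]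
        rw [Finset.filter_insert]
        by_cases hd : G.degree x ≤ p
        · simp [hs, Cond.eval, Expr.eval, hr₂, hp, hadj₂, hd, hc₂]
        · simp [hs, Cond.eval, Expr.eval, hr₂, hp, hadj₂, hd, hc₂])
  have hK : keys (σ.get (.tab .verts)) = Finset.univ := by
    rw [State.get_tab, htab, keys_inputState_verts]
  rw [hK] at h1 h2 h3 h4
  have hrun : (forAll .v (.tab .verts) l) = setup := rfl
  rw [hrun] at h1 h2 h3 h4
  set σ₁ := setup.run τ σ with hσ₁
  have hML : ∀ x, σ₁.fam .ML x = fun _ => none := fun x => by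
    rw [hF.fam .ML, hfam, inputState_fam (by decide)]
  have hMR : ∀ x, σ₁.fam .MR x = fun _ => none := fun x => by
    rw [hF.fam .MR, hfam, inputState_fam (by decide)]
  have haux : ∀ x, σ₁.fam .aux x = fun _ => none := fun x => by
    rw [hF.fam .aux, hfam, inputState_fam (by decide)]
  have htabs : ∀ d, setup.writes (.tab d) = false → d ≠ .verts → keys (σ₁.tab d) = ∅ :=
    fun d hd hd' => by rw [hF.tab d hd, htab, inputState_tab hd', keys_empty]
  have hout₁ : σ₁.output = [] := hF.output.trans hout
  constructor
  · refine ⟨⟨⟨?_, ?_, ?_⟩, ⟨⟨?_, ?_, ?_⟩, ?_⟩, ?_, ?_, ?_, ?_, ?_, ?_, ?_, ?_, ?_, ?_⟩, h2, ?_, ?_, ?_,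
      ?_⟩
    · intro x; rw [hF.fam .adj, hfam, keys_inputState_adj]
    · intro x; rw [h1, lN_univ]; simp
    · intro x; rw [hF.fam .NR, hfam, inputState_fam (by decide), rN_univ]; simp
    · exact fun x _ => haux x
    · intro x; rw [haux]; simp
    · rw [htabs .auxVerts rfl (by decide)]; simp
    · intro d hd
      rw [htabs d (by revert d; decide) (by revert d; decide)]; simp
    · rw [hF.ctr .p]; exact hctr
    · intro x _; rw [hML, hMR]; exact emptyMat x
    · intro x hx; simp at hx
    · intro x hx; simp at hx
    · exact Finset.subset_univ _
    · rw [h3]; exact fun x hx => .of_degree_le (Finset.mem_filter.1 hx).2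
    · rw [h3]
      intro x _ hx
      rw [hML, lN_univ, SimpleGraph.card_neighborFinset_eq_degree]
      have : ¬ G.degree x ≤ p := fun h => hx (by simp [h])
      simp; omega
    · rw [htabs .check rfl (by decide)]; simp
    · rw [htabs .union rfl (by decide)]; simp
    · rw [hout₁]; simp
    · rw [hout₁]; trivial
    · rw [hout₁]; simp
    · rw [hout₁]; simp
    · intro h; rw [hF.flag .failed, hflag] at h; simp at h
  · refine h4.trans ?_
    have e : ∑ x : V, (4 * G.degree x + 6 + 3) = 8 * G.edgeFinset.card + 9 * Fintype.card V := by
      simp only [Finset.sum_add_distrib, ← Finset.mul_sum, G.sum_degrees_eq_twice_card_edges,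
        Finset.sum_const, Finset.card_univ, smul_eq_mul]
      ring
    omega

end

section
variable {V : Type u} [Fintype V] [DecidableEq V]

/-! ### The specification of Main -/

variable {G : SimpleGraph V} [DecidableRel G.Adj] {p : ℕ}

/-- There are two time bounds because a graph with too many edges is rejected before any time
proportional to the number of edges is spent. In the other case the bound on the edges is available
for the estimate. -/
theorem main_spec (τ : Traversal V) {W : ℕ}
    (hW : base G p + 22 * Fintype.card V + 8 * G.edgeFinset.card +
      (53 * p ^ 2 + 200 * p + 117) ≤ W) :
    ((finalState G p τ).flag .failed = true → (p : ℕ∞) < graphAdm G 2) ∧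
    ((finalState G p τ).flag .failed = false → GoodSuffixes G p (finalState G p τ).output ∧
      (finalState G p τ).output.Nodup ∧ ∀ v, v ∈ (finalState G p τ).output) ∧
    ((finalState G p τ).time ≤ 13 * Fintype.card V + 15 ∨
      G.edgeFinset.card ≤ p * Fintype.card V ∧ (finalState G p τ).time ≤ potential G p Finset.univ +
        Fintype.card V * (15 * p ^ 3 + 49 * p ^ 2 + 28 * p + 43) + 18 * G.edgeFinset.card + 31) ∧
    (finalState G p τ).peak ≤ W := by
  set σ₀ : State V := inputState G p with hσ₀
  set σ₁ := checkEdges.run τ ((Stmt.setFlag .failed false).run τ σ₀) with hσ₁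
  have hF₀ : Frame (.setFlag .failed false) σ₀ ((Stmt.setFlag .failed false).run τ σ₀) :=
    frame_run τ _ _
  have hF₁ : Frame checkEdges ((Stmt.setFlag .failed false).run τ σ₀) σ₁ := frame_run τ _ _
  have hfam : σ₁.fam = (inputState G p).fam := by
    funext f; rw [hF₁.fam f (by cases f <;> rfl)]; rfl
  have htab : σ₁.tab = (inputState G p).tab := by
    funext d; rw [hF₁.tab d (by cases d <;> rfl)]; rfl
  have hout : σ₁.output = [] := hF₁.output
  have hctr : σ₁.ctr .p = p := hF₁.ctr .p
  have hw₀ : σ₀.words ≤ base G p := words_le_of_input (G := G) (p := p) rfl rfl rfl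
  obtain ⟨h1, h2⟩ := checkEdges_spec (τ := τ) (G := G) (p := p)
    (σ := (Stmt.setFlag .failed false).run τ σ₀) rfl rfl rfl (keys_inputState_verts (G := G) (p := p))
  rw [← hσ₁] at h1 h2
  have ht₁ : σ₁.time ≤ 13 * Fintype.card V + 11 := by
    have : ((Stmt.setFlag .failed false).run τ σ₀).time = 1 := rfl
    omega
  have hg₁ : Grow σ₀ σ₁ := (grow_run τ _ _).trans (grow_run τ _ _)
  have hrun : finalState G p τ = (when (.not (.flag .failed)) [setup, mainLoop]).run τ σ₁ := rfl
  rw [hrun, run_when]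
  have heval : (Cond.not (.flag .failed)).eval σ₁ = !σ₁.flag .failed := rfl
  rw [heval]
  cases hfl : σ₁.flag .failed
  · simp only [Bool.not_false, if_true, run_block_cons, run_block_nil]
    have hm : G.edgeFinset.card ≤ p * Fintype.card V := by
      rw [hfl] at h1
      by_contra hlt
      simpa using h1.2 (not_le.1 hlt)
    obtain ⟨h3, h4⟩ := setup_spec (τ := τ) (σ := σ₁.charge (Cond.not (.flag .failed)).cost) hctr hfl
      hfam htab hout
    set σ₂ := setup.run τ (σ₁.charge (Cond.not (.flag .failed)).cost) with hσ₂
    have hF₂ : Frame setup (σ₁.charge (Cond.not (.flag .failed)).cost) σ₂ := frame_run τ _ _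
    have hc : (Cond.not (.flag .failed)).cost = 2 := rfl
    rw [State.time_charge, hc] at h4
    have hg₂ : Grow σ₀ σ₂ := hg₁.trans (Grow.charge.trans (grow_run τ _ _))
    have hh₂ : σ₂.held = 0 := by
      rw [hσ₂, held_run]
      change σ₁.held = 0
      rw [hσ₁, held_run, held_run]; rfl
    have ht₂ : σ₂.time ≤ σ₀.time + (22 * Fintype.card V + 8 * G.edgeFinset.card + 14) := by omega
    have hpk₂ : σ₂.peak ≤ W := hg₂.peak_le ht₂ (Nat.zero_le _) (by omega)
    have hσ₀t : σ₀.time = 0 := rfl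
    obtain ⟨⟨L, h5, h6⟩, h7, h8⟩ := mainLoop_spec (τ := τ) (W := W) h3
      (by rw [hF₂.tab .verts]; change keys (σ₁.tab .verts) = _; rw [htab, keys_inputState_verts])
      (by rw [hh₂]; omega) hpk₂
    refine ⟨h5.failed, fun hf => ⟨h5.good, h5.nodup, fun v => ?_⟩, .inr ⟨hm, ?_⟩, h8⟩
    · have h9 := h5.eq_sdiff
      rw [h6 hf] at h9
      by_contra hv
      have : v ∈ (∅ : Finset V) := by rw [h9]; simpa using hv
      simp at this
    · have e : Fintype.card V * (15 * p ^ 3 + 49 * p ^ 2 + 28 * p + 43) =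
          Fintype.card V * (15 * p ^ 3 + 49 * p ^ 2 + 28 * p + 21) + 22 * Fintype.card V := by ring
      omega
  · simp only [Bool.not_true, Bool.false_eq_true, if_false]
    have hc : (Cond.not (.flag .failed)).cost = 2 := rfl
    have hg₂ : Grow σ₀ (σ₁.charge 2) := hg₁.trans Grow.charge
    have hσ₀t : σ₀.time = 0 := rfl
    rw [hc]
    refine ⟨fun _ => ?_, fun h => ?_, .inl ?_, ?_⟩
    · by_contra h3
      have := card_edgeFinset_le (not_lt.1 h3)
      have := h1.1 hfl
      omega
    · rw [State.flag_charge, hfl] at h; simp at h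
    · rw [State.time_charge]; omega
    · exact hg₂.peak_le (t := 13 * Fintype.card V + 13) (by rw [State.time_charge]; omega)
        (Nat.zero_le _) (by omega)

/-! ### Numerical bounds for time and space -/

/-- Summing `augCost` gives `353 = 53 + 200 + 100` from the terms without degree and `30 = 2 * 15`
from the degrees, in total `383 * p ^ 2 * n`. The cap is at most `5 * p ^ 2`, and `383 * 5 = 1915`.
-/
theorem potential_univ_le (hp : 1 ≤ p) (hm : G.edgeFinset.card ≤ p * Fintype.card V) :
    potential G p Finset.univ ≤ 1915 * (p ^ 4 * Fintype.card V) := by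
  have h1 : potential G p Finset.univ ≤
      (∑ u : V, augCost p (G.degree u)) * (2 * p ^ 2 + 2 * p + 1) := by
    rw [potential, Finset.sum_mul]
    exact Finset.sum_le_sum fun u _ => Nat.mul_le_mul_left _ (min_le_right _ _)
  have h2 : ∑ u : V, augCost p (G.degree u) = Fintype.card V * (53 * p ^ 2 + 200 * p + 100) +
      2 * G.edgeFinset.card * (11 * p + 4) := by
    simp only [augCost, Finset.sum_add_distrib, ← Finset.sum_mul,
      G.sum_degrees_eq_twice_card_edges, Finset.sum_const, Finset.card_univ, smul_eq_mul]
    ring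
  have hpp : p ≤ p ^ 2 := by nlinarith
  have h3 : 53 * p ^ 2 + 200 * p + 100 ≤ 353 * p ^ 2 := by omega
  have h4 : 2 * G.edgeFinset.card * (11 * p + 4) ≤ 2 * (p * Fintype.card V) * (15 * p) :=
    Nat.mul_le_mul (by omega) (by omega)
  have h5 : ∑ u : V, augCost p (G.degree u) ≤ 383 * p ^ 2 * Fintype.card V := by
    rw [h2]
    calc _ ≤ Fintype.card V * (353 * p ^ 2) + 2 * (p * Fintype.card V) * (15 * p) :=
          Nat.add_le_add (Nat.mul_le_mul_left _ h3) h4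
      _ = _ := by ring
  calc _ ≤ _ := h1
    _ ≤ 383 * p ^ 2 * Fintype.card V * (5 * p ^ 2) := Nat.mul_le_mul h5 (by omega)
    _ = _ := by ring

/-- Every remaining term is absorbed into `p ^ 4 * n`: the coefficients `1915 + 135 + 18 + 31` stay
below 2200. -/
theorem runTime_le (τ : Traversal V) (hp : 1 ≤ p) (hn : 1 ≤ Fintype.card V) :
    runTime G p τ ≤ 2200 * (p ^ 4 * Fintype.card V) := by
  have h := (main_spec (G := G) (p := p) τ le_rfl).2.2.1
  change runTime G p τ ≤ _ ∨ _ ∧ runTime G p τ ≤ _ at h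
  have h4 : 1 ≤ p ^ 4 := Nat.one_le_pow _ _ hp
  have hn4 : Fintype.card V ≤ p ^ 4 * Fintype.card V := Nat.le_mul_of_pos_left _ h4
  rcases h with h | ⟨hm, h⟩
  · omega
  · have h1 := potential_univ_le hp hm
    have e1 : p ≤ p ^ 4 := Nat.le_self_pow (by norm_num) p
    have e2 : p ^ 2 ≤ p ^ 4 := Nat.pow_le_pow_right hp (by norm_num)
    have e3 : p ^ 3 ≤ p ^ 4 := Nat.pow_le_pow_right hp (by norm_num)
    have h2 : Fintype.card V * (15 * p ^ 3 + 49 * p ^ 2 + 28 * p + 43) ≤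
        Fintype.card V * (135 * p ^ 4) := Nat.mul_le_mul_left _ (by omega)
    have h3 : p * Fintype.card V ≤ p ^ 4 * Fintype.card V := Nat.mul_le_mul_right _ e1
    have e : Fintype.card V * (135 * p ^ 4) = 135 * (p ^ 4 * Fintype.card V) := by ring
    omega

/-- The additive constants and the terms linear in `p` are absorbed into `p ^ 2`, which is where `1
≤ p` enters. -/
theorem space_le (τ : Traversal V) (hp : 1 ≤ p) :
    space G p τ ≤ 500 * (Fintype.card V + G.edgeFinset.card + p ^ 2) := by
  have h := (main_spec (G := G) (p := p) τ le_rfl).2.2.2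
  have hpp : p ≤ p ^ 2 := Nat.le_self_pow (by norm_num) p
  unfold base at h
  change space G p τ ≤ _ at h
  omega

theorem card_le_of_no_isolated (h : ∀ v : V, ∃ w, G.Adj v w) :
    Fintype.card V ≤ 2 * G.edgeFinset.card := by
  rw [← G.sum_degrees_eq_twice_card_edges, ← Finset.card_univ, Finset.card_eq_sum_ones]
  exact Finset.sum_le_sum fun v _ => (G.degree_pos_iff_exists_adj v).2 (h v)

end

end TwoAdm

/-! ### The theorem on correctness, time and space -/

theorem mainTheorem1 :
    ∃ C : ℕ, ∀ (V : Type*) [Fintype V] [DecidableEq V] (G : SimpleGraph V) [DecidableRel G.Adj]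
      (p : ℕ) (τ : TwoAdm.Traversal V),
      ((p : ℕ∞) < TwoAdm.graphAdm G 2 → TwoAdm.answer G p τ = none) ∧
      (TwoAdm.graphAdm G 2 ≤ (p : ℕ∞) →
        ∃ (l : List V) (o : LinearOrder V), TwoAdm.answer G p τ = some l ∧
          (∀ v : V, v ∈ l) ∧ l.Pairwise o.lt ∧ TwoAdm.orderAdm G 2 o ≤ (p : ℕ∞)) ∧
      (1 ≤ p → Nonempty V →
        TwoAdm.runTime G p τ ≤ C * (p ^ 4 * Fintype.card V) ∧
        TwoAdm.space G p τ ≤ C * (Fintype.card V + G.edgeFinset.card + p ^ 2) ∧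
        ((∀ v : V, ∃ w : V, G.Adj v w) →
          TwoAdm.space G p τ ≤ C * (G.edgeFinset.card + p ^ 2))) := by
  refine ⟨2200, fun V _ _ G _ p τ => ?_⟩
  obtain ⟨h1, h2, -⟩ := TwoAdm.main_spec (G := G) (p := p) τ le_rfl
  refine ⟨fun h => ?_, fun h => ?_, fun hp _ => ?_⟩
  · unfold TwoAdm.answer
    rw [if_pos]
    by_contra hf
    obtain ⟨h3, h4, h5⟩ := h2 (by simpa using hf)
    obtain ⟨o, -, ho⟩ := h3.exists_order h4 h5
    exact absurd ((iInf_le _ o).trans ho) (not_le.2 h)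
  · have hf : (TwoAdm.finalState G p τ).flag .failed = false := by
      by_contra hf
      exact absurd h (not_le.2 (h1 (by simpa using hf)))
    obtain ⟨h3, h4, h5⟩ := h2 hf
    obtain ⟨o, ho, ho'⟩ := h3.exists_order h4 h5
    exact ⟨_, o, by rw [TwoAdm.answer, hf]; rfl, h5, ho, ho'⟩
  · have hs := TwoAdm.space_le (G := G) τ hp
    refine ⟨TwoAdm.runTime_le τ hp Fintype.card_pos, by omega, fun hi => ?_⟩
    -- Now `n ≤ 2 * m`, so the space is at most `500 * (3 * m + p ^ 2)`, still within the constant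
    -- 2200.
    have := TwoAdm.card_le_of_no_isolated hi
    omega
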